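/- Let $H$ and $H_0$ be separable complex Hilbert spaces, let $(e^{-tA})_{t\ge 0}$ be a bounded $C_0$ semigroup on $H$ with generator $-A$, let $D(A)$ be the domain of $A$ with the graph norm $(\|\xi\|^2+\|A\xi\|^2)^{1/2}$, and let $C:D(A)\to H_0$ be a bounded linear operator that is admissible for $e^{-tA}$: there is a constant $K$ such that $\int_0^\infty\|Ce^{-sA}\xi\|^2\,ds\le K^2\|\xi\|^2$ for all $\xi\in D(A)$, so that $\xi\mapsto Ce^{-sA}\xi$ extends to a bounded operator $\Theta^\dagger:H\to L^2((0,\infty);H_0)$. Let $\Theta:L^2((0,\infty);H_0)\to H$, $\Theta f=\int_0^\infty e^{-sA^\dagger}C^\dagger f(s)\,ds$, be its adjoint (the observability operator), let $Q_x=\int_x^\infty e^{-sA^\dagger}C^\dagger Ce^{-sA}\,ds$ for $x\ge 0$ (the observability Gramian; both integrals converge in the weak sense, $\langle Q_x\xi,\eta\rangle=\int_x^\infty\langle Ce^{-sA}\xi,Ce^{-sA}\eta\rangle\,ds$), and let $P_{(x,\infty)}$ be the projection of $L^2((0,\infty);H_0)$ given by multiplication by the indicator function of $(x,\infty)$. (0)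 If $C(iyI+A)^{-1}$ exists and is Hilbert–Schmidt for all $y\in\mathbb R$, with $\int_{-\infty}^\infty\|C(iyI+A)^{-1}\|_{HS}^2\,dy<\infty$, then $\Theta$ is Hilbert–Schmidt. Suppose now that $\Theta$ is Hilbert–Schmidt. (i) For every $x\ge 0$ the operators $Q_x$ and $P_{(x,\infty)}\Theta^\dagger\Theta P_{(x,\infty)}$ are of trace class, and $$\det(I-\lambda Q_x)=\det(I-\lambda P_{(x,\infty)}\Theta^\dagger\Theta P_{(x,\infty)})\qquad(\lambda\in\mathbb C)$$ (Fredholm determinants) defines an entire function of $\lambda$, all of whose zeros lie on the positive real axis. (ii) Suppose further that $A=A^\dagger$, and let $\phi(x)=Ce^{-xA}C^\dagger$ for $x>0$, which is a bounded operator on $H_0$ (namely the product of the bounded operator $Ce^{-(x/2)A}$ with its adjoint). Then the Hankel operator $\Gamma_\phi f(s)=\int_0^\infty\phi(s+t)f(t)\,dt$ is defined on all of $L^2((0,\infty);H_0)$, the integral converging absolutely for almost every $s>0$, and $\Gamma_\phi=\Theta^\dagger\Theta\ge 0$. Moreover, for every $x>0$ the operator $\phi(2x)$ is of trace class and $$\frac{d}{dx}\operatorname{trace}Q_x=-\operatorname{trace}\phi(2x).$$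 (iii) Suppose still further that $H_0$ has finite dimension $m$. Then for every $x\ge 0$ all the zeros of $\lambda\mapsto\det(I-\lambda Q_x)$ have order at most $m$. -/

import Mathlib

open MeasureTheory Filter Topology Set
open scoped InnerProductSpace NNReal ENNReal

noncomputable section

namespace LinSys

/-! ### Hilbert-Schmidt and trace class operators, trace and determinant -/

section Schatten

variable {E F : Type*} [NormedAddCommGroup E] [InnerProductSpace ℂ E] [CompleteSpace E]
  [NormedAddCommGroup F] [InnerProductSpace ℂ F]

variable (E) in
/-- The index set of a fixed orthonormal basis of the Hilbert space `E`. -/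
def OnbIndex : Set E := (exists_hilbertBasis ℂ E).choose

variable (E) in
/-- A fixed orthonormal basis of the Hilbert space `E`. None of the notions below depends on it:
the sum `∑ ‖T eᵢ‖²` and, for trace class operators, the trace and the determinant have the same
value for all orthonormal bases. -/
def onb : HilbertBasis (OnbIndex E) ℂ E := (exists_hilbertBasis ℂ E).choose_spec.choose

/-- The square of the Hilbert-Schmidt norm, `∑ ‖T eᵢ‖²`, with values in `[0, ∞]`. -/
def hsNormSq (T : E →ₗ[ℂ] F) : ℝ≥0∞ := ∑' i, ‖T (onb E i)‖ₑ ^ 2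

/-- Hilbert-Schmidt operators. -/
def IsHilbertSchmidt (T : E →L[ℂ] F) : Prop := hsNormSq (T : E →ₗ[ℂ] F) < ∞

/-- Trace class operators: `|T| = (T† T)^{1/2}` has finite trace. -/
def IsTraceClass (T : E →L[ℂ] E) : Prop :=
  ∑' i, ENNReal.ofReal (⟪onb E i, CFC.abs T (onb E i)⟫_ℂ).re < ∞

/-- The trace `∑ ⟨T eᵢ, eᵢ⟩` of a trace class operator. -/
def trace (T : E →L[ℂ] E) : ℂ := ∑' i, ⟪onb E i, T (onb E i)⟫_ℂ

open scoped Classical in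
/-- The Fredholm determinant `det (I + T) = ∑ₙ trace (Λⁿ T)` of a trace class operator. In the
orthonormal basis of `Λⁿ E` consisting of the exterior products of `n` distinct basis vectors,
`trace (Λⁿ T)` is the sum of the principal minors of size `n` of the matrix of `T`, so that
`det (I + T)` is the (absolutely convergent) sum of all finite principal minors. -/
def detOneAdd (T : E →L[ℂ] E) : ℂ :=
  ∑' s : Finset (OnbIndex E),
    (Matrix.of fun i j : s => ⟪onb E i, T (onb E j)⟫_ℂ).det

end Schatten

/-! ### Square integrable functions on the half line -/

section HalfLine

variable (F : Type*) [NormedAddCommGroup F]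

/-- Lebesgue measure on `(0, ∞)`. -/
abbrev halfLine : Measure ℝ := volume.restrict (Ioi 0)

/-- `L²((0, ∞); F)`. -/
abbrev L2 := Lp F 2 halfLine

variable {F}

theorem memLp_indicator (x : ℝ) (f : L2 F) : MemLp ((Ioi x).indicator f) 2 halfLine :=
  (Lp.memLp f).indicator measurableSet_Ioi

variable [InnerProductSpace ℂ F]

/-- Multiplication of square integrable functions by the indicator function of `(x, ∞)`. -/
def projLin (x : ℝ) : L2 F →ₗ[ℂ] L2 F where
  toFun f := (memLp_indicator x f).toLp
  map_add' f g := by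
    rw [← MemLp.toLp_add, MemLp.toLp_eq_toLp_iff]
    filter_upwards [Lp.coeFn_add f g] with s hs
    by_cases h : s ∈ Ioi x
    · simp only [Pi.add_apply, Set.indicator_of_mem h, hs]
    · simp [h]
  map_smul' c f := by
    rw [RingHom.id_apply, ← MemLp.toLp_const_smul, MemLp.toLp_eq_toLp_iff]
    filter_upwards [Lp.coeFn_smul c f] with s hs
    by_cases h : s ∈ Ioi x <;> simp [h, hs]

theorem coeFn_projLin (x : ℝ) (f : L2 F) :
    (projLin x f : ℝ → F) =ᵐ[halfLine] (Ioi x).indicator f :=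
  (memLp_indicator x f).coeFn_toLp

theorem norm_projLin_le (x : ℝ) (f : L2 F) : ‖projLin x f‖ ≤ ‖f‖ := by
  refine Lp.norm_le_norm_of_ae_le ?_
  filter_upwards [coeFn_projLin x f] with s hs
  rw [hs]
  exact norm_indicator_le_norm_self _ _

/-- The orthogonal projection `P_{(x,∞)}` on `L²((0, ∞); F)`, multiplication by the indicator
function of `(x, ∞)`. -/
def proj (x : ℝ) : L2 F →L[ℂ] L2 F :=
  LinearMap.mkContinuous (projLin x) 1 fun f => by simpa using norm_projLin_le x f

/-- The sesquilinear form `∫_x^∞ ⟨f(s), g(s)⟩ ds`. -/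
def tailInner (x : ℝ) (f g : L2 F) : ℂ := ∫ s in Ioi x, ⟪f s, g s⟫_ℂ ∂halfLine

theorem tailInner_eq (x : ℝ) (f g : L2 F) : tailInner x f g = ⟪f, projLin x g⟫_ℂ := by
  rw [L2.inner_def, tailInner, ← integral_indicator measurableSet_Ioi]
  refine integral_congr_ae ?_
  filter_upwards [coeFn_projLin x g] with s hs
  rw [hs]
  by_cases hx : s ∈ Ioi x <;> simp [hx]

/-- The form `∫_x^∞ ⟨f(s), g(s)⟩ ds` as a bounded sesquilinear form. -/
def tailForm (x : ℝ) : L2 F →L⋆[ℂ] L2 F →L[ℂ] ℂ :=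
  LinearMap.mkContinuous₂
    (LinearMap.mk₂'ₛₗ (starRingEnd ℂ) (RingHom.id ℂ) (tailInner x)
      (fun f f' g => by simp only [tailInner_eq, inner_add_left])
      (fun c f g => by simp only [tailInner_eq, inner_smul_left, smul_eq_mul])
      (fun f g g' => by simp only [tailInner_eq, map_add, inner_add_right])
      (fun c f g => by
        simp only [tailInner_eq, map_smul, inner_smul_right, smul_eq_mul, RingHom.id_apply]))
    1 fun f g => by
      rw [one_mul]
      change ‖tailInner x f g‖ ≤ _
      rw [tailInner_eq]
      exact (norm_inner_le_norm _ _).trans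
        (mul_le_mul_of_nonneg_left (norm_projLin_le x g) (norm_nonneg _))

/-- `Γ` is the Hankel integral operator on `L²((0, ∞); F)` with kernel `φ(s + t)`: for every
square integrable `f` and almost every `s > 0` the integral of `φ(s + t) f(t)` over `t > 0`
converges absolutely, and its value is `(Γ f)(s)`. -/
def IsHankelOperator (φ : ℝ → F →L[ℂ] F) (Γ : L2 F →L[ℂ] L2 F) : Prop :=
  ∀ f : L2 F, ∀ᵐ s ∂halfLine, Integrable (fun t => φ (s + t) (f t)) halfLine ∧
    Γ f s = ∫ t, φ (s + t) (f t) ∂halfLine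

end HalfLine

/-! ### Semigroups and their generators -/

/-- A strongly continuous one-parameter semigroup of bounded operators on `H`. In the notation
`S t = e^{-tA}`, the operator `-A` is its generator. -/
structure C0Semigroup (H : Type*) [NormedAddCommGroup H] [InnerProductSpace ℂ H] where
  /-- The operator `e^{-tA}`. -/
  op : ℝ≥0 → H →L[ℂ] H
  op_zero : op 0 = 1
  op_add : ∀ s t, op (s + t) = op s * op t
  strongly_continuous : ∀ ξ, Tendsto (fun t => op t ξ) (𝓝 0) (𝓝 ξ)

namespace C0Semigroup

variable {H H₀ : Type*} [NormedAddCommGroup H] [InnerProductSpace ℂ H]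
  [NormedAddCommGroup H₀] [InnerProductSpace ℂ H₀]

section Generator

variable (S : C0Semigroup H)

/-- `A ξ = η`, that is, `(ξ - e^{-tA} ξ) / t → η` as `t` decreases to `0`. -/
def GenRel (ξ η : H) : Prop :=
  Tendsto (fun t : ℝ => ((t : ℂ)⁻¹) • (ξ - S.op t.toNNReal ξ)) (𝓝[>] 0) (𝓝 η)

variable {S} in
theorem GenRel.unique {ξ η η' : H} (h : S.GenRel ξ η) (h' : S.GenRel ξ η') : η = η' :=
  tendsto_nhds_unique h h'

variable {S} in
theorem GenRel.add {ξ η ξ' η' : H} (h : S.GenRel ξ η) (h' : S.GenRel ξ' η') :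
    S.GenRel (ξ + ξ') (η + η') := by
  refine (Tendsto.add h h').congr fun t => ?_
  rw [map_add, ← smul_add]
  congr 1
  abel

variable {S} in
theorem GenRel.smul {ξ η : H} (c : ℂ) (h : S.GenRel ξ η) : S.GenRel (c • ξ) (c • η) := by
  refine (Tendsto.const_smul h c).congr fun t => ?_
  rw [map_smul, ← smul_sub, smul_comm]

theorem GenRel.zero : S.GenRel 0 0 := by
  refine tendsto_const_nhds.congr fun t => ?_
  simp

variable {S} in
theorem GenRel.orbit {ξ η : H} (h : S.GenRel ξ η) (s : ℝ≥0) :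
    S.GenRel (S.op s ξ) (S.op s η) := by
  refine (((S.op s).continuous.tendsto η).comp h).congr fun t => ?_
  have hc : S.op t.toNNReal (S.op s ξ) = S.op s (S.op t.toNNReal ξ) := by
    rw [← mul_apply_eq_comp, ← mul_apply_eq_comp, ← S.op_add,
      ← S.op_add, add_comm]
  simp [hc]

/-- The operator `A`, with its domain `D(A)`, such that `-A` generates the semigroup. -/
def A : H →ₗ.[ℂ] H where
  domain :=
    { carrier := {ξ | ∃ η, S.GenRel ξ η}
      add_mem' := fun ⟨_, h⟩ ⟨_, h'⟩ => ⟨_, h.add h'⟩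
      zero_mem' := ⟨0, GenRel.zero S⟩
      smul_mem' := fun c _ ⟨_, h⟩ => ⟨_, h.smul c⟩ }
  toFun :=
    { toFun := fun ξ => ξ.2.choose
      map_add' := fun ξ ξ' => (ξ + ξ').2.choose_spec.unique
        (ξ.2.choose_spec.add ξ'.2.choose_spec)
      map_smul' := fun c ξ => (c • ξ).2.choose_spec.unique (ξ.2.choose_spec.smul c) }

/-- The semigroup maps `D(A)` into itself. -/
def onDomain (t : ℝ≥0) : S.A.domain →ₗ[ℂ] S.A.domain :=
  (S.op t : H →ₗ[ℂ] H).restrict fun _ ⟨_, h⟩ => ⟨_, h.orbit t⟩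

/-- The operator `iyI + A` on `D(A)`. -/
def shift (y : ℝ) : S.A.domain →ₗ[ℂ] H :=
  (Complex.I * (y : ℂ)) • S.A.domain.subtype + S.A.toFun

end Generator

section Output

variable {S : C0Semigroup H} (C : S.A.domain →ₗ[ℂ] H₀)

/-- `C` is bounded on `D(A)` with the graph norm `(‖ξ‖² + ‖A ξ‖²)^{1/2}`. -/
def GraphBounded : Prop := ∃ c : ℝ, ∀ ξ : S.A.domain, ‖C ξ‖ ≤ c * √(‖(ξ : H)‖ ^ 2 + ‖S.A ξ‖ ^ 2)

/-- The output `s ↦ C e^{-sA} ξ` for an initial state `ξ ∈ D(A)`. -/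
def output (ξ : S.A.domain) (s : ℝ) : H₀ := C (S.onDomain s.toNNReal ξ)

/-- `C` is admissible for `e^{-sA}`: `∫₀^∞ ‖C e^{-sA} ξ‖² ds ≤ K² ‖ξ‖²`. It suffices to require
this on the dense subspace `D(A)`, where `C e^{-sA} ξ` is defined pointwise; for other `ξ ∈ H`
the function `C e^{-sA} ξ` is defined by continuous extension. -/
def Admissible : Prop := ∃ K : ℝ, ∀ ξ : S.A.domain, MemLp (output C ξ) 2 halfLine ∧
  ∫ s, ‖output C ξ s‖ ^ 2 ∂halfLine ≤ K ^ 2 * ‖(ξ : H)‖ ^ 2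

/-- `C (iyI + A)⁻¹` exists and is Hilbert-Schmidt for all real `y`, and its squared
Hilbert-Schmidt norm is integrable over `y ∈ ℝ`. -/
def ResolventHilbertSchmidt [CompleteSpace H] : Prop :=
  ∃ R : ℝ → H →ₗ[ℂ] S.A.domain,
    (∀ y, (∀ ξ, R y (S.shift y ξ) = ξ) ∧ ∀ η, S.shift y (R y η) = η) ∧
    (∀ y, hsNormSq (C ∘ₗ R y) < ∞) ∧ ∫⁻ y, hsNormSq (C ∘ₗ R y) < ∞

variable {C}

/-- The map `D(A) → L²((0, ∞); H₀)`, `ξ ↦ C e^{-sA} ξ`. -/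
def outputL2 (h : Admissible C) : S.A.domain →ₗ[ℂ] L2 H₀ where
  toFun ξ := (h.choose_spec ξ).1.toLp
  map_add' ξ η := by
    rw [← MemLp.toLp_add, MemLp.toLp_eq_toLp_iff]
    exact Eventually.of_forall fun s => by simp [output]
  map_smul' c ξ := by
    rw [RingHom.id_apply, ← MemLp.toLp_const_smul, MemLp.toLp_eq_toLp_iff]
    exact Eventually.of_forall fun s => by simp [output]

variable [CompleteSpace H₀]

/-- `Θ† : H → L²((0, ∞); H₀)`, `Θ† ξ (s) = C e^{-sA} ξ`, the continuous extension to `H` of this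
map on the dense subspace `D(A)`. -/
def obsAdj (h : Admissible C) : H →L[ℂ] L2 H₀ :=
  (outputL2 h).extendOfNorm S.A.domain.subtype

variable (C) in
/-- The bounded extension to `H` of the operator `C e^{-tA}` on `D(A)` (for those `t` for which
there is one: if `A` is self-adjoint, for all `t > 0`). -/
def outputAt (t : ℝ) : H →L[ℂ] H₀ :=
  (C ∘ₗ S.onDomain t.toNNReal).extendOfNorm S.A.domain.subtype

variable [CompleteSpace H]

/-- The observability operator `Θ f = ∫₀^∞ e^{-sA†} C† f(s) ds`, where the integral is taken in
the weak sense `⟨ξ, Θ f⟩ = ∫₀^∞ ⟨C e^{-sA} ξ, f(s)⟩ ds`. -/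
def obs (h : Admissible C) : L2 H₀ →L[ℂ] H := (obsAdj h).adjoint

/-- The sesquilinear form `∫_x^∞ ⟨C e^{-sA} ξ, C e^{-sA} η⟩ ds` on `H`. -/
def gramianForm (h : Admissible C) (x : ℝ) : H →L⋆[ℂ] H →L[ℂ] ℂ :=
  (tailForm x).bilinearComp (obsAdj h) (obsAdj h)

/-- The observability Gramian `Q_x = ∫_x^∞ e^{-sA†} C† C e^{-sA} ds`, where the integral is taken
in the weak sense `⟨Q_x ξ, η⟩ = ∫_x^∞ ⟨C e^{-sA} ξ, C e^{-sA} η⟩ ds`. -/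
def gramian (h : Admissible C) (x : ℝ) : H →L[ℂ] H :=
  InnerProductSpace.continuousLinearMapOfBilin (gramianForm h x)

variable (C) in
/-- For self-adjoint `A` and `x > 0`, the operator `φ(x) = C e^{-xA} C†` on `H₀`. As `C` need not
extend to a bounded operator on `H`, this is read as the product of the bounded operator
`C e^{-(x/2)A}` with its adjoint `e^{-(x/2)A} C†`. -/
def phi (x : ℝ) : H₀ →L[ℂ] H₀ := outputAt C (x / 2) ∘L (outputAt C (x / 2)).adjoint

end Output

end C0Semigroup

end LinSys

end

/-!
All four parts concern `T = P_{(x,∞)} Θ†`, for which `Q_x = T† T` and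
`P_{(x,∞)} Θ†Θ P_{(x,∞)} = T T†`, and `T` is Hilbert-Schmidt when `Θ` is.

**Hilbert-Schmidt criterion.** The Laplace transform of the output `C e^{-sA} ξ` is
`C (z + A)⁻¹ ξ` for `Re z > 0`. As `Re z → 0` it converges to `C (iy + A)⁻¹ ξ`, so that Plancherel's
theorem gives `2π ‖Θ† ξ‖² = ∫ ‖C (iy + A)⁻¹ ξ‖² dy`; summation over an orthonormal basis gives
`isHilbertSchmidt_obs`.

**Determinants.** The determinant of `I - z T† T` is defined by the principal minors in a fixed
orthonormal basis. Grouped by size `n`, these are Gram determinants of the vectors `T eᵢ`, hence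
nonnegative, and their sum is a supremum of sums over finite sections. For a finite section
matrix `M` the sums for `M† M` and `M M†` are the coefficients of `Xⁿ` in
`det (1 + X M† M) = det (1 + X M M†)`. This shows (`gramSum_eq`) that the sums do not depend on the
basis, and agree for `T† T` and `T T†`. In an eigenbasis the determinant becomes the canonical
product `∏ (1 - z μᵢ)` (`detOneAdd_eq_tprod`) with `μᵢ ≥ 0` summable, whose zeros are the `1 / μᵢ`,
with their multiplicities.

**Self-adjoint `A`.** The semigroup is self-adjoint and contractive, and
`‖A e^{-tA}‖ ≤ 1 / t`, so that `C e^{-tA}` is bounded for `t > 0` and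
`φ(s + t) = (C e^{-sA}) (C e^{-tA})†`; this identifies the Hankel operator with `Θ†Θ`. The squared
Hilbert-Schmidt norm of `C e^{-sA}` is `trace φ(2s)`. It is continuous, and its integral over
`(x, ∞)` is `trace Q_x`, which gives the derivative of the trace.

**Multiplicity.** Let `dim H₀ = m`. For `r > 0` put `J = (r + A)⁻¹` and `B = I - 2rJ`, the Cayley
transform of `A`. The Lyapunov equation `Q_x A + A Q_x = (C e^{-xA})† C e^{-xA}` turns into
`‖T η‖² - ‖T B η‖² = 2r ‖C e^{-xA} J η‖²` (`norm_sq_tailObs_cayley`). With `Γ = T T†` and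
`N = T B T†` this says that `‖Γ w‖ = ‖N w‖` on a subspace of codimension at most `m`, whereas
`N ≤ Γ`, strictly off the kernel of `N`, because `J` is strictly positive. As `T e^{-tA} → 0`
strongly, `Γ - N = 2r T J T†` is small in norm when `r` is small, so that the eigenvalues of `N`
exceed any prescribed negative number. By a min-max count (`card_eigenvalue_le_finrank`) no
eigenvalue of `Γ` other than `0` has multiplicity above `m`.
-/

open scoped ComplexOrder

noncomputable section

set_option linter.unusedSectionVars false

namespace LinSys

/-! ### Hilbert-Schmidt operators -/

section HilbertSchmidt

variable {E F K : Type*} [NormedAddCommGroup E] [InnerProductSpace ℂ E] [CompleteSpace E]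
  [NormedAddCommGroup F] [InnerProductSpace ℂ F] [CompleteSpace F]
  [NormedAddCommGroup K] [InnerProductSpace ℂ K] [CompleteSpace K]

theorem enorm_inner_symm (x y : E) : ‖⟪x, y⟫_ℂ‖ₑ = ‖⟪y, x⟫_ℂ‖ₑ := by
  rw [← ofReal_norm, ← ofReal_norm, norm_inner_symm]

/-- Parseval's identity. -/
theorem hasSum_norm_inner_sq {ι : Type*} (e : HilbertBasis ι ℂ E) (x : E) :
    HasSum (fun i => ‖⟪e i, x⟫_ℂ‖ ^ 2) (‖x‖ ^ 2) := by
  have h := e.hasSum_inner_mul_inner x x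
  rw [inner_self_eq_norm_sq_to_K] at h
  have h2 := Complex.hasSum_re h
  convert h2 using 1
  · ext i
    rw [← inner_conj_symm x, ← Complex.normSq_eq_conj_mul_self, Complex.ofReal_re,
      Complex.normSq_eq_norm_sq]
  · norm_cast

theorem tsum_enorm_inner_sq {ι : Type*} (e : HilbertBasis ι ℂ E) (x : E) :
    ∑' i, ‖⟪e i, x⟫_ℂ‖ₑ ^ 2 = ‖x‖ₑ ^ 2 := by
  have h := hasSum_norm_inner_sq e x
  have h2 := ENNReal.ofReal_tsum_of_nonneg (fun i => sq_nonneg ‖⟪e i, x⟫_ℂ‖) h.summable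
  rw [h.tsum_eq, ENNReal.ofReal_pow (norm_nonneg _), ofReal_norm] at h2
  rw [h2]
  simp_rw [ENNReal.ofReal_pow (norm_nonneg _), ofReal_norm]

theorem tsum_enorm_adjoint {ι κ : Type*} (e : HilbertBasis ι ℂ E) (f : HilbertBasis κ ℂ F)
    (T : E →L[ℂ] F) : ∑' i, ‖T (e i)‖ₑ ^ 2 = ∑' k, ‖T.adjoint (f k)‖ₑ ^ 2 := by
  simp_rw [← tsum_enorm_inner_sq f, ← tsum_enorm_inner_sq e]
  rw [ENNReal.tsum_comm]
  simp_rw [ContinuousLinearMap.adjoint_inner_right, enorm_inner_symm]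

/-- The Hilbert-Schmidt norm can be computed in any orthonormal basis. -/
theorem hsNormSq_eq {ι : Type*} (e : HilbertBasis ι ℂ E) (T : E →L[ℂ] F) :
    hsNormSq (T : E →ₗ[ℂ] F) = ∑' i, ‖T (e i)‖ₑ ^ 2 := by
  rw [tsum_enorm_adjoint e (onb F), ← tsum_enorm_adjoint (onb E) (onb F)]
  rfl

theorem hsNormSq_adjoint (T : E →L[ℂ] F) :
    hsNormSq (T.adjoint : F →ₗ[ℂ] E) = hsNormSq (T : E →ₗ[ℂ] F) :=
  (tsum_enorm_adjoint (onb E) (onb F) T).symm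

theorem IsHilbertSchmidt.adjoint {T : E →L[ℂ] F} (hT : IsHilbertSchmidt T) :
    IsHilbertSchmidt T.adjoint := by
  rw [IsHilbertSchmidt, hsNormSq_adjoint]
  exact hT

theorem enorm_apply_le (T : E →L[ℂ] F) (x : E) : ‖T x‖ₑ ≤ ‖T‖ₑ * ‖x‖ₑ := by
  rw [← ofReal_norm, ← ofReal_norm, ← ofReal_norm, ← ENNReal.ofReal_mul (norm_nonneg _)]
  exact ENNReal.ofReal_le_ofReal (T.le_opNorm x)

theorem hsNormSq_comp_le (R : F →L[ℂ] K) (T : E →L[ℂ] F) :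
    hsNormSq ((R ∘L T : E →L[ℂ] K) : E →ₗ[ℂ] K) ≤ ‖R‖ₑ ^ 2 * hsNormSq (T : E →ₗ[ℂ] F) := by
  rw [hsNormSq, hsNormSq, ← ENNReal.tsum_mul_left]
  refine ENNReal.tsum_le_tsum fun i => ?_
  rw [← mul_pow]
  exact pow_le_pow_left' (enorm_apply_le R _) 2

theorem IsHilbertSchmidt.comp_left {T : E →L[ℂ] F} (hT : IsHilbertSchmidt T) (R : F →L[ℂ] K) :
    IsHilbertSchmidt (R ∘L T) :=
  (hsNormSq_comp_le R T).trans_lt (ENNReal.mul_lt_top (by simp) hT)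

theorem hsNormSq_comp_le' (R : F →L[ℂ] K) (T : E →L[ℂ] F) :
    hsNormSq ((R ∘L T : E →L[ℂ] K) : E →ₗ[ℂ] K) ≤ ‖T‖ₑ ^ 2 * hsNormSq (R : F →ₗ[ℂ] K) := by
  rw [← hsNormSq_adjoint, ← hsNormSq_adjoint R, ContinuousLinearMap.adjoint_comp]
  refine (hsNormSq_comp_le _ _).trans_eq ?_
  rw [← ofReal_norm, ← ofReal_norm, LinearIsometryEquiv.norm_map]

theorem IsHilbertSchmidt.comp_right {T : E →L[ℂ] F} {R : F →L[ℂ] K} (hR : IsHilbertSchmidt R) :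
    IsHilbertSchmidt (R ∘L T) :=
  (hsNormSq_comp_le' R T).trans_lt (ENNReal.mul_lt_top (by simp) hR)

theorem enorm_sq_apply_le_hsNormSq (T : E →L[ℂ] F) (x : E) :
    ‖T x‖ₑ ^ 2 ≤ hsNormSq (T : E →ₗ[ℂ] F) * ‖x‖ₑ ^ 2 := by
  rw [← hsNormSq_adjoint, ← tsum_enorm_inner_sq (onb F), hsNormSq, ← ENNReal.tsum_mul_right]
  refine ENNReal.tsum_le_tsum fun i => ?_
  rw [← ContinuousLinearMap.adjoint_inner_left, ← mul_pow]
  refine pow_le_pow_left' ?_ 2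
  rw [← ofReal_norm, ← ofReal_norm, ← ofReal_norm, ← ENNReal.ofReal_mul (norm_nonneg _)]
  exact ENNReal.ofReal_le_ofReal (norm_inner_le_norm _ _)

theorem norm_sq_le_hsNormSq {T : E →L[ℂ] F} (hT : IsHilbertSchmidt T) :
    ‖T‖ ^ 2 ≤ (hsNormSq (T : E →ₗ[ℂ] F)).toReal := by
  have h0 : 0 ≤ (hsNormSq (T : E →ₗ[ℂ] F)).toReal := ENNReal.toReal_nonneg
  refine (Real.le_sqrt (norm_nonneg _) h0).mp
    (ContinuousLinearMap.opNorm_le_bound _ (Real.sqrt_nonneg _) fun x => ?_)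
  refine le_of_sq_le_sq ?_ (by positivity)
  rw [mul_pow, Real.sq_sqrt h0]
  have := ENNReal.toReal_mono (ENNReal.mul_ne_top hT.ne (by simp)) (enorm_sq_apply_le_hsNormSq T x)
  simpa using this

theorem IsHilbertSchmidt.summable {T : E →L[ℂ] F} (hT : IsHilbertSchmidt T) {ι : Type*}
    (e : HilbertBasis ι ℂ E) : Summable fun i => ‖T (e i)‖ ^ 2 := by
  have h : ∑' i, ‖T (e i)‖ₑ ^ 2 ≠ ∞ := by
    rw [← hsNormSq_eq e]; exact hT.ne
  simpa using ENNReal.summable_toReal h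

theorem hsNormSq_toReal {T : E →L[ℂ] F} {ι : Type*}
    (e : HilbertBasis ι ℂ E) : (hsNormSq (T : E →ₗ[ℂ] F)).toReal = ∑' i, ‖T (e i)‖ ^ 2 := by
  rw [hsNormSq_eq e, ENNReal.tsum_toReal_eq (by simp)]
  simp

/-- A Hilbert-Schmidt operator is the norm limit of its restrictions to the spans of finitely many
basis vectors, hence compact. -/
theorem IsHilbertSchmidt.isCompactOperator {T : E →L[ℂ] F} (hT : IsHilbertSchmidt T) :
    IsCompactOperator T := by
  classical
  let e := onb E
  let A : Finset (OnbIndex E) → E →L[ℂ] F := fun s =>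
    ∑ i ∈ s, (innerSL ℂ (e i)).smulRight (T (e i))
  have hA : ∀ s i, A s (e i) = if i ∈ s then T (e i) else 0 := by
    intro s i
    simp only [A, _root_.sum_apply, ContinuousLinearMap.smulRight_apply,
      innerSL_apply_apply, orthonormal_iff_ite.mp e.orthonormal]
    simp
  refine isCompactOperator_of_tendsto (F := A) (l := atTop) (f := T) ?_ (.of_forall fun s => ?_)
  · rw [tendsto_iff_norm_sub_tendsto_zero]
    have h1 := tendsto_tsum_compl_atTop_zero fun i => ‖T (e i)‖ ^ 2
    have h2 : ∀ s, ‖A s - T‖ ^ 2 ≤ ∑' i : {i // i ∉ s}, ‖T (e i)‖ ^ 2 := by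
      intro s
      have h3 : ∑' i, ‖(A s - T) (e i)‖ ^ 2 = ∑' i : {i // i ∉ s}, ‖T (e i)‖ ^ 2 := by
        rw [← tsum_subtype_eq_of_support_subset (s := {i | i ∉ s})]
        · refine tsum_congr fun i => ?_
          have hi : (i : OnbIndex E) ∉ s := i.2
          simp [hA, hi]
        · intro i hi h
          simp [hA, h] at hi
      rw [← h3, ← hsNormSq_toReal]
      refine norm_sq_le_hsNormSq ?_
      refine (ENNReal.tsum_le_tsum fun i => ?_).trans_lt hT
      change ‖(A s - T) (e i)‖ₑ ^ 2 ≤ ‖T (e i)‖ₑ ^ 2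
      by_cases hi : i ∈ s <;> simp [hA, hi]
    have h4 := squeeze_zero (fun s => sq_nonneg _) h2 h1
    have h5 := h4.sqrt
    simpa using h5
  · refine Submodule.sum_mem (compactOperator (RingHom.id ℂ) E F) fun i _ => ?_
    exact isCompactOperator_of_locallyCompactSpace_rng
       (ContinuousLinearMap.toSpanSingleton ℂ (T (e i))) |>.comp_clm (innerSL ℂ (e i))

/-- If `T` is Hilbert-Schmidt, then `T† T` is of trace class. -/
theorem IsHilbertSchmidt.isTraceClass {T : E →L[ℂ] F} (hT : IsHilbertSchmidt T) :
    IsTraceClass (T.adjoint ∘L T) := by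
  have h0 : 0 ≤ T.adjoint ∘L T :=
    (ContinuousLinearMap.nonneg_iff_isPositive _).mpr
      (ContinuousLinearMap.isPositive_adjoint_comp_self T)
  rw [IsTraceClass, CFC.abs_of_nonneg _ h0]
  refine lt_of_eq_of_lt (tsum_congr fun i => ?_) hT
  rw [ContinuousLinearMap.comp_apply, ContinuousLinearMap.adjoint_inner_right,
    inner_self_eq_norm_sq_to_K, ← ofReal_norm, ← ENNReal.ofReal_pow (norm_nonneg _)]
  congr 1
  norm_cast

theorem inner_adjoint_comp_self (T : E →L[ℂ] F) (x : E) :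
    ⟪x, (T.adjoint ∘L T) x⟫_ℂ = ((‖T x‖ ^ 2 : ℝ) : ℂ) := by
  rw [ContinuousLinearMap.comp_apply, ContinuousLinearMap.adjoint_inner_right,
    inner_self_eq_norm_sq_to_K]
  norm_cast

theorem trace_adjoint_comp_self (T : E →L[ℂ] F) :
    trace (T.adjoint ∘L T) = ((hsNormSq (T : E →ₗ[ℂ] F)).toReal : ℂ) := by
  simp_rw [trace, inner_adjoint_comp_self, hsNormSq_toReal (onb E), Complex.ofReal_tsum]

end HilbertSchmidt

/-! ### Principal minors and Fredholm determinants -/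

section Minors

open Polynomial in
/-- The sum of the principal minors of size `n` is the coefficient of `Xⁿ` in `det (1 + X a)`. -/
theorem sum_principal_minors {ι : Type*} (a : ι → ι → ℂ) (s : Finset ι) (n : ℕ)
    [DecidableEq ι] :
    ∑ t ∈ s.powersetCard n, (Matrix.of fun i j : t => a i j).det =
      (Matrix.det (1 + (X : ℂ[X]) • (Matrix.of fun i j : s => a i j).map C)).coeff n := by
  rw [Matrix.coeff_det_one_add_X_smul_eq_sum_minors]
  have h : s.powersetCard n = (Finset.univ.powersetCard n).map
      (Finset.mapEmbedding (Function.Embedding.subtype (· ∈ s))).toEmbedding := by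
    rw [← Finset.powersetCard_map]
    congr 1
    ext i
    simp
  rw [h, Finset.sum_map]
  refine Finset.sum_congr rfl fun t _ => ?_
  let g : t → t.map (Function.Embedding.subtype (· ∈ s)) := fun i =>
    ⟨i.1, Finset.mem_map_of_mem _ i.2⟩
  have hg : Function.Bijective g := by
    refine ⟨fun i j h => Subtype.ext (Subtype.ext (congrArg (fun x => x.1) h)), fun j => ?_⟩
    obtain ⟨i, hi, hij⟩ := Finset.mem_map.mp j.2
    exact ⟨⟨i, hi⟩, Subtype.ext hij⟩
  refine (Matrix.det_submatrix_equiv_self (Equiv.ofBijective g hg)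
    (Matrix.of fun i j => a i j)).symm.trans ?_
  rfl

/-- The sum of the principal minors of size `n` is the same for `M† M` and for `M M†`, since both
are the coefficient of `Xⁿ` in `det (1 + X M† M) = det (1 + X M M†)`. -/
theorem sum_minors_comm {ι κ : Type*} (m : κ → ι → ℂ) (s : Finset ι) (u : Finset κ) (n : ℕ)
    [DecidableEq ι] [DecidableEq κ] :
    ∑ t ∈ s.powersetCard n,
        (Matrix.of fun i j : t => ∑ k ∈ u, starRingEnd ℂ (m k i) * m k j).det =
      ∑ t ∈ u.powersetCard n,
        (Matrix.of fun k l : t => ∑ i ∈ s, starRingEnd ℂ (starRingEnd ℂ (m k i)) *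
          starRingEnd ℂ (m l i)).det := by
  rw [sum_principal_minors (fun i j => ∑ k ∈ u, starRingEnd ℂ (m k i) * m k j),
    sum_principal_minors (fun k l => ∑ i ∈ s, starRingEnd ℂ (starRingEnd ℂ (m k i)) *
          starRingEnd ℂ (m l i))]
  let M : Matrix u s ℂ := Matrix.of fun k i => m k i
  have h1 : (Matrix.of fun i j : s => ∑ k ∈ u, starRingEnd ℂ (m k i) * m k j) =
      M.conjTranspose * M := by
    ext i j
    simp only [Matrix.of_apply, Matrix.mul_apply, Matrix.conjTranspose_apply, M]
    rw [← Finset.sum_coe_sort u]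
    rfl
  have h2 : (Matrix.of fun k l : u => ∑ i ∈ s, starRingEnd ℂ (starRingEnd ℂ (m k i)) *
      starRingEnd ℂ (m l i)) = M * M.conjTranspose := by
    ext i j
    simp only [Matrix.of_apply, Matrix.mul_apply, Matrix.conjTranspose_apply, M]
    rw [← Finset.sum_coe_sort s]
    simp
  rw [h1, h2, Matrix.map_mul, Matrix.map_mul, ← Matrix.smul_mul, Matrix.det_one_add_mul_comm,
    Matrix.mul_smul]

theorem det_finite_gram_nonneg {ι κ : Type*} (m : κ → ι → ℂ) (u : Finset κ) (t : Finset ι)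
    [DecidableEq ι] :
    0 ≤ (Matrix.of fun i j : t => ∑ k ∈ u, starRingEnd ℂ (m k i) * m k j).det := by
  let M : Matrix u t ℂ := Matrix.of fun k i => m k i
  have h1 : (Matrix.of fun i j : t => ∑ k ∈ u, starRingEnd ℂ (m k i) * m k j) =
      M.conjTranspose * M := by
    ext i j
    simp only [Matrix.of_apply, Matrix.mul_apply, Matrix.conjTranspose_apply, M]
    rw [← Finset.sum_coe_sort u]
    rfl
  rw [h1]
  exact (Matrix.posSemidef_conjTranspose_mul_self M).det_nonneg

end Minors

section Gram

variable {E F : Type*} [NormedAddCommGroup E] [InnerProductSpace ℂ E] [CompleteSpace E]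
  [NormedAddCommGroup F] [InnerProductSpace ℂ F] [CompleteSpace F]

open scoped Classical in
/-- The Gram determinant of the vectors `v i`, `i ∈ s`. -/
def gramDet {ι : Type*} (v : ι → F) (s : Finset ι) : ℝ :=
  ((Matrix.of fun i j : s => ⟪v i, v j⟫_ℂ).det).re

open scoped Classical in
theorem gramDet_eq {ι : Type*} (v : ι → F) (s : Finset ι) :
    (Matrix.of fun i j : s => ⟪v i, v j⟫_ℂ).det = (gramDet v s : ℂ) := by
  have h : 0 ≤ (Matrix.of fun i j : s => ⟪v i, v j⟫_ℂ).det :=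
    (Matrix.posSemidef_gram ℂ (fun i : s => v i)).det_nonneg
  rw [gramDet]
  exact Complex.ext (by simp) (by simpa using (Complex.nonneg_iff.mp h).2.symm)

open scoped Classical in
theorem gramDet_nonneg {ι : Type*} (v : ι → F) (s : Finset ι) : 0 ≤ gramDet v s := by
  have h : 0 ≤ (Matrix.of fun i j : s => ⟪v i, v j⟫_ℂ).det :=
    (Matrix.posSemidef_gram ℂ (fun i : s => v i)).det_nonneg
  exact (Complex.nonneg_iff.mp h).1

/-- The trace of the `n`-th exterior power of `T† T`, computed in the orthonormal basis `e`: the sum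
of all Gram determinants of `n` of the vectors `T eᵢ`. -/
def gramSum {ι : Type*} (e : HilbertBasis ι ℂ E) (T : E →L[ℂ] F) (n : ℕ) : ℝ≥0∞ :=
  ∑' s : Finset ι, if s.card = n then ENNReal.ofReal (gramDet (fun i => T (e i)) s) else 0

open scoped Classical in
/-- A sum of principal minors of size `n` of the finite section `M† M`, where `M` has the entries
`⟨f k, T (e i)⟩` with `i ∈ s` and `k ∈ u`. -/
def sectionSum {ι κ : Type*} (e : HilbertBasis ι ℂ E) (f : HilbertBasis κ ℂ F) (T : E →L[ℂ] F)
    (n : ℕ) (s : Finset ι) (u : Finset κ) : ℝ≥0∞ :=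
  ∑ t ∈ s.powersetCard n, ENNReal.ofReal
    (Matrix.of fun i j : t => ∑ k ∈ u, starRingEnd ℂ ⟪f k, T (e i)⟫_ℂ * ⟪f k, T (e j)⟫_ℂ).det.re

theorem sectionSum_comm {ι κ : Type*} (e : HilbertBasis ι ℂ E) (f : HilbertBasis κ ℂ F)
    (T : E →L[ℂ] F) (n : ℕ) (s : Finset ι) (u : Finset κ) :
    sectionSum e f T n s u = sectionSum f e T.adjoint n u s := by
  classical
  have h := sum_minors_comm (fun k i => ⟪f k, T (e i)⟫_ℂ) s u n
  have h' := congrArg Complex.re h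
  rw [Complex.re_sum, Complex.re_sum] at h'
  rw [sectionSum, sectionSum, ← ENNReal.ofReal_sum_of_nonneg, ← ENNReal.ofReal_sum_of_nonneg]
  · congr 1
    convert h' using 6
    ext l
    simp only [inner_conj_symm, ContinuousLinearMap.adjoint_inner_right]
  · intro t _
    have h3 := det_finite_gram_nonneg (fun i k => ⟪e i, T.adjoint (f k)⟫_ℂ) s t
    convert (Complex.nonneg_iff.mp h3).1
  · intro t _
    have h3 := det_finite_gram_nonneg (fun k i => ⟪f k, T (e i)⟫_ℂ) u t
    convert (Complex.nonneg_iff.mp h3).1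

theorem sectionSum_mono {ι κ : Type*} (e : HilbertBasis ι ℂ E) (f : HilbertBasis κ ℂ F)
    (T : E →L[ℂ] F) (n : ℕ) (u : Finset κ) : Monotone fun s => sectionSum e f T n s u :=
  fun _ _ h => Finset.sum_le_sum_of_subset (Finset.powersetCard_mono h)

open scoped Classical in
theorem iSup_sectionSum {ι κ : Type*} (e : HilbertBasis ι ℂ E) (f : HilbertBasis κ ℂ F)
    (T : E →L[ℂ] F) (n : ℕ) (s : Finset ι) :
    ⨆ u, sectionSum e f T n s u =
      ∑ t ∈ s.powersetCard n, ENNReal.ofReal (gramDet (fun i => T (e i)) t) := by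
  have hm : Monotone fun u => sectionSum e f T n s u := by
    intro u v huv
    simp only [sectionSum_comm e f]
    exact sectionSum_mono f e T.adjoint n s huv
  refine tendsto_nhds_unique (tendsto_atTop_iSup hm) ?_
  refine tendsto_finsetSum _ fun t _ => ?_
  refine ENNReal.tendsto_ofReal ?_
  refine (Complex.continuous_re.tendsto _).comp ?_
  have hc : Continuous fun M : Matrix t t ℂ => M.det := Continuous.matrix_det continuous_id
  refine (hc.tendsto (Matrix.of fun i j : t => ⟪T (e i), T (e j)⟫_ℂ)).comp ?_
  refine tendsto_pi_nhds.mpr fun i => tendsto_pi_nhds.mpr fun j => ?_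
  have h := f.hasSum_inner_mul_inner (T (e i)) (T (e j))
  simp only [Matrix.of_apply, inner_conj_symm]
  exact h

open scoped Classical in
theorem gramSum_eq_iSup {ι κ : Type*} (e : HilbertBasis ι ℂ E) (f : HilbertBasis κ ℂ F)
    (T : E →L[ℂ] F) (n : ℕ) : gramSum e T n = ⨆ s, ⨆ u, sectionSum e f T n s u := by
  simp_rw [iSup_sectionSum]
  rw [gramSum, ENNReal.tsum_eq_iSup_sum' (fun s : Finset ι => s.powerset)]
  · refine iSup_congr fun s => ?_
    rw [← Finset.sum_filter]
    congr 1
    ext t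
    simp [Finset.mem_powersetCard]
  · intro t
    exact ⟨t.biUnion id, fun x hx => Finset.mem_powerset.mpr
      (Finset.subset_biUnion_of_mem id hx)⟩

/-- The traces of the exterior powers of `T† T` and of `T T†` agree, whatever the bases. -/
theorem gramSum_eq {ι κ : Type*} (e : HilbertBasis ι ℂ E) (f : HilbertBasis κ ℂ F)
    (T : E →L[ℂ] F) (n : ℕ) : gramSum e T n = gramSum f T.adjoint n := by
  rw [gramSum_eq_iSup e f, gramSum_eq_iSup f e, iSup_comm]
  simp_rw [sectionSum_comm e f]

end Gram

section Determinant

variable {E F : Type*} [NormedAddCommGroup E] [InnerProductSpace ℂ E] [CompleteSpace E]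
  [NormedAddCommGroup F] [InnerProductSpace ℂ F] [CompleteSpace F]

open scoped Classical in
theorem detOneAdd_adjoint_comp_self (T : E →L[ℂ] F) (z : ℂ) :
    detOneAdd (-(z • (T.adjoint ∘L T))) =
      ∑' s : Finset (OnbIndex E), (-z) ^ s.card * (gramDet (fun i => T (onb E i)) s : ℂ) := by
  refine tsum_congr fun s => ?_
  rw [← gramDet_eq]
  have h : (Matrix.of fun i j : s => ⟪onb E i, (-(z • (T.adjoint ∘L T))) (onb E j)⟫_ℂ) =
      (-z) • Matrix.of fun i j : s => ⟪T (onb E i), T (onb E j)⟫_ℂ := by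
    ext i j
    simp [inner_smul_right, ContinuousLinearMap.adjoint_inner_right]
  rw [h, Matrix.det_smul, Fintype.card_coe]
  congr!

/-- Grouping the principal minors by their size. -/
theorem tsum_pow_mul_gramDet {ι : Type*} (e : HilbertBasis ι ℂ E) (T : E →L[ℂ] F) (w : ℂ)
    (h : ∑' n, ‖w‖ₑ ^ n * gramSum e T n < ∞) :
    ∑' s : Finset ι, w ^ s.card * (gramDet (fun i => T (e i)) s : ℂ) =
      ∑' n, w ^ n * ((gramSum e T n).toReal : ℂ) := by
  set g : Finset ι → ℝ := gramDet (fun i => T (e i)) with hg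
  have hg0 : ∀ s, 0 ≤ g s := gramDet_nonneg _
  let a : ℕ → Finset ι → ℂ := fun n s => w ^ n * (if s.card = n then (g s : ℂ) else 0)
  have ha : ∀ n s, ‖a n s‖ₑ = ‖w‖ₑ ^ n * (if s.card = n then ENNReal.ofReal (g s) else 0) := by
    intro n s
    simp only [a, enorm_mul, enorm_pow]
    congr 1
    split_ifs
    · rw [← ofReal_norm, Complex.norm_real, Real.norm_of_nonneg (hg0 s)]
    · simp
  have hsum : Summable (Function.uncurry a) := by
    have h1 : ∑' p : ℕ × Finset ι, ‖Function.uncurry a p‖ₑ ≠ ∞ := by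
      rw [ENNReal.tsum_prod']
      simp only [Function.uncurry_apply_pair, ha, ENNReal.tsum_mul_left]
      exact h.ne
    have h2 := ENNReal.summable_toReal h1
    simp only [toReal_enorm] at h2
    exact h2.of_norm
  have h3 := hsum.tsum_comm
  have h4 : ∀ s, ∑' n, a n s = w ^ s.card * (g s : ℂ) := by
    intro s
    rw [tsum_eq_single s.card]
    · simp [a]
    · intro n hn
      simp [a, hn.symm]
  have h5 : ∀ n, ∑' s, a n s = w ^ n * ((gramSum e T n).toReal : ℂ) := by
    intro n
    simp only [a, tsum_mul_left]
    congr 1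
    rw [gramSum, ENNReal.tsum_toReal_eq, Complex.ofReal_tsum]
    · refine tsum_congr fun s => ?_
      split_ifs
      · rw [ENNReal.toReal_ofReal (hg0 s)]
      · simp
    · intro s
      split_ifs <;> simp
  simp_rw [h4, h5] at h3
  exact h3

/-- If the vectors `T (b i)` are orthogonal, the Gram determinants are products. -/
theorem gramDet_of_eigenbasis {ι : Type*} {b : HilbertBasis ι ℂ E} {T : E →L[ℂ] F} {μ : ι → ℝ}
    (hb : ∀ i, (T.adjoint ∘L T) (b i) = (μ i : ℂ) • b i) (s : Finset ι) :
    gramDet (fun i => T (b i)) s = ∏ i ∈ s, μ i := by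
  classical
  have h : (Matrix.of fun i j : s => ⟪T (b i), T (b j)⟫_ℂ) =
      Matrix.diagonal fun i : s => (μ i : ℂ) := by
    ext i j
    rw [Matrix.of_apply, ← ContinuousLinearMap.adjoint_inner_right,
      ← ContinuousLinearMap.comp_apply, hb, inner_smul_right,
      orthonormal_iff_ite.mp b.orthonormal, Matrix.diagonal_apply]
    by_cases hij : i = j
    · simp [hij]
    · simp [hij, Subtype.coe_injective.eq_iff]
  have h2 := gramDet_eq (fun i => T (b i)) s
  have h3 : (Matrix.of fun i j : s => ⟪T (b i), T (b j)⟫_ℂ).det = ((∏ i ∈ s, μ i : ℝ) : ℂ) := by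
    rw [h, Matrix.det_diagonal, Finset.prod_coe_sort s fun i => (μ i : ℂ)]
    push_cast
    rfl
  have h4 := h2.symm.trans (by convert h3)
  exact_mod_cast h4

theorem eigenvalue_eq_norm_sq {ι : Type*} {b : HilbertBasis ι ℂ E} {T : E →L[ℂ] F} {μ : ι → ℝ}
    (hb : ∀ i, (T.adjoint ∘L T) (b i) = (μ i : ℂ) • b i) (i : ι) : μ i = ‖T (b i)‖ ^ 2 := by
  have h := inner_adjoint_comp_self T (b i)
  rw [hb, inner_smul_right, inner_self_eq_norm_sq_to_K, b.orthonormal.1 i] at h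
  have h2 : (μ i : ℂ) = ((‖T (b i)‖ ^ 2 : ℝ) : ℂ) := by simpa using h
  exact_mod_cast h2

theorem summable_eigenvalues {ι : Type*} {b : HilbertBasis ι ℂ E} {T : E →L[ℂ] F} {μ : ι → ℝ}
    (hT : IsHilbertSchmidt T) (hb : ∀ i, (T.adjoint ∘L T) (b i) = (μ i : ℂ) • b i) :
    Summable μ :=
  (hT.summable b).congr fun i => (eigenvalue_eq_norm_sq hb i).symm

theorem tsum_pow_mul_gramSum_lt_top {ι : Type*} {b : HilbertBasis ι ℂ E} {T : E →L[ℂ] F}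
    {μ : ι → ℝ} (hT : IsHilbertSchmidt T)
    (hb : ∀ i, (T.adjoint ∘L T) (b i) = (μ i : ℂ) • b i) (w : ℂ) :
    ∑' n, ‖w‖ₑ ^ n * gramSum b T n < ∞ := by
  have hμ : ∀ i, 0 ≤ μ i := fun i => by rw [eigenvalue_eq_norm_sq hb]; positivity
  have h1 : ∑' n, ‖w‖ₑ ^ n * gramSum b T n =
      ∑' s : Finset ι, ENNReal.ofReal (∏ i ∈ s, ‖w‖ * μ i) := by
    simp_rw [gramSum, ← ENNReal.tsum_mul_left]
    rw [ENNReal.tsum_comm]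
    refine tsum_congr fun s => ?_
    rw [tsum_eq_single s.card]
    · rw [if_pos rfl, gramDet_of_eigenbasis hb, Finset.prod_mul_distrib, Finset.prod_const,
        ENNReal.ofReal_mul (by positivity), ENNReal.ofReal_pow (norm_nonneg _), ofReal_norm]
    · intro n hn
      rw [if_neg hn.symm, mul_zero]
  rw [h1]
  have h2 : Summable fun s : Finset ι => ∏ i ∈ s, ‖w‖ * μ i :=
    summable_finsetProd_of_summable_nonneg (fun i => mul_nonneg (norm_nonneg _) (hμ i))
      ((summable_eigenvalues hT hb).mul_left _)
  exact h2.tsum_ofReal_lt_top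

theorem tsum_pow_mul_gramDet_eq_tprod {ι : Type*} {b : HilbertBasis ι ℂ E} {T : E →L[ℂ] F}
    {μ : ι → ℝ} (hT : IsHilbertSchmidt T)
    (hb : ∀ i, (T.adjoint ∘L T) (b i) = (μ i : ℂ) • b i) (w : ℂ) :
    ∑' s : Finset ι, w ^ s.card * (gramDet (fun i => T (b i)) s : ℂ) = ∏' i, (1 + w * μ i) := by
  rw [tprod_one_add]
  · refine tsum_congr fun s => ?_
    rw [gramDet_of_eigenbasis hb, Finset.prod_mul_distrib, Finset.prod_const]
    push_cast
    rfl
  · refine summable_finsetProd_of_summable_norm ?_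
    simp_rw [norm_mul, Complex.norm_real]
    exact ((summable_eigenvalues hT hb).norm).mul_left _

universe u in
/-- A compact self-adjoint operator has an orthonormal basis of eigenvectors. -/
theorem exists_eigenbasis {E : Type u} [NormedAddCommGroup E] [InnerProductSpace ℂ E]
    [CompleteSpace E] {A : E →L[ℂ] E} (hA : IsCompactOperator A) (hs : IsSelfAdjoint A) :
    ∃ (ι : Type u) (b : HilbertBasis ι ℂ E) (μ : ι → ℝ), ∀ i, A (b i) = (μ i : ℂ) • b i := by
  have hsym : (A : E →ₗ[ℂ] E).IsSymmetric := hs.isSymmetric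
  have hcl : ∀ μ : ℂ, IsClosed (Module.End.eigenspace (A : E →ₗ[ℂ] E) μ : Set E) := by
    intro μ
    have : (Module.End.eigenspace (A : E →ₗ[ℂ] E) μ : Set E) = {x | A x = μ • x} := by
      ext x
      simp
    rw [this]
    exact isClosed_eq A.continuous (continuous_const_smul μ)
  have (μ : ℂ) : CompleteSpace (Module.End.eigenspace (A : E →ₗ[ℂ] E) μ) :=
    (hcl μ).completeSpace_coe
  let v : (Σ μ : ℂ, OnbIndex (Module.End.eigenspace (A : E →ₗ[ℂ] E) μ)) → E :=
    fun a => (onb (Module.End.eigenspace (A : E →ₗ[ℂ] E) a.1) a.2 : E)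
  have hv : Orthonormal ℂ v :=
    hsym.orthogonalFamily_eigenspaces.orthonormal_sigma_orthonormal
      (v_family := fun μ => (onb (Module.End.eigenspace (A : E →ₗ[ℂ] E) μ) :
        OnbIndex (Module.End.eigenspace (A : E →ₗ[ℂ] E) μ) → _)) fun μ => (onb _).orthonormal
  have hperp : (Submodule.span ℂ (range v))ᗮ = ⊥ := by
    rw [← ContinuousLinearMap.orthogonalComplement_iSup_eigenspaces_eq_bot hA hsym]
    refine le_antisymm (fun x hx => ?_) (Submodule.orthogonal_le ?_)
    · rw [← Submodule.iInf_orthogonal, Submodule.mem_iInf]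
      intro μ y hy
      have h1 := (onb (Module.End.eigenspace (A : E →ₗ[ℂ] E) μ)).hasSum_repr ⟨y, hy⟩
      have h2 := h1.mapL ((innerSL ℂ x) ∘L (Module.End.eigenspace (A : E →ₗ[ℂ] E) μ).subtypeL)
      rw [← inner_conj_symm]
      refine (map_eq_zero _).mpr (h2.unique ?_)
      convert! hasSum_zero with i
      have h3 : ⟪v ⟨μ, i⟩, x⟫_ℂ = 0 := hx _ (Submodule.subset_span ⟨⟨μ, i⟩, rfl⟩)
      have h4 : ⟪x, v ⟨μ, i⟩⟫_ℂ = 0 := inner_eq_zero_symm.mp h3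
      simp only [map_smul, ContinuousLinearMap.comp_apply, Submodule.subtypeL_apply,
        innerSL_apply_apply]
      exact (congrArg _ h4).trans (smul_zero _)
    · rw [Submodule.span_le]
      rintro _ ⟨a, rfl⟩
      exact Submodule.mem_iSup_of_mem a.1 (onb (Module.End.eigenspace (A : E →ₗ[ℂ] E) a.1) a.2).2
  let b := HilbertBasis.mkOfOrthogonalEqBot hv hperp
  have hb : ∀ a, b a = v a := fun a => by simp [b]
  refine ⟨_, b, fun a => a.1.re, fun a => ?_⟩
  have h1 : A (b a) = a.1 • b a := by
    rw [hb]
    exact Module.End.mem_eigenspace_iff.mp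
      (onb (Module.End.eigenspace (A : E →ₗ[ℂ] E) a.1) a.2).2
  have h2 : (starRingEnd ℂ) a.1 = a.1 := by
    refine hsym.conj_eigenvalue_eq_self (Module.End.hasEigenvalue_of_hasEigenvector (x := b a)
      ⟨Module.End.mem_eigenspace_iff.mpr h1, b.orthonormal.ne_zero a⟩)
  rw [h1, Complex.conj_eq_iff_re.mp h2]

universe u in
theorem exists_eigenbasis_adjoint_comp_self {E : Type u} [NormedAddCommGroup E]
    [InnerProductSpace ℂ E] [CompleteSpace E] {T : E →L[ℂ] F} (hT : IsHilbertSchmidt T) :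
    ∃ (ι : Type u) (b : HilbertBasis ι ℂ E) (μ : ι → ℝ),
      ∀ i, (T.adjoint ∘L T) (b i) = (μ i : ℂ) • b i :=
  exists_eigenbasis (hT.isCompactOperator.clm_comp T.adjoint)
    (ContinuousLinearMap.isPositive_adjoint_comp_self T).isSelfAdjoint

/-- The Fredholm determinant is basis independent, and `T† T` and `T T†` have the same one. -/
theorem tsum_pow_mul_gramDet_adjoint {ι κ : Type*} (e : HilbertBasis ι ℂ E)
    (f : HilbertBasis κ ℂ F) {T : E →L[ℂ] F} (hT : IsHilbertSchmidt T) (w : ℂ) :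
    ∑' s : Finset ι, w ^ s.card * (gramDet (fun i => T (e i)) s : ℂ) =
      ∑' s : Finset κ, w ^ s.card * (gramDet (fun i => T.adjoint (f i)) s : ℂ) := by
  obtain ⟨ι', b, μ, hb⟩ := exists_eigenbasis_adjoint_comp_self hT
  have h1 : ∑' n, ‖w‖ₑ ^ n * gramSum f T.adjoint n < ∞ := by
    simp_rw [← gramSum_eq b f T]
    exact tsum_pow_mul_gramSum_lt_top hT hb w
  have h2 : ∑' n, ‖w‖ₑ ^ n * gramSum e T n < ∞ := by
    simp_rw [gramSum_eq e f]
    exact h1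
  rw [tsum_pow_mul_gramDet _ _ _ h1, tsum_pow_mul_gramDet _ _ _ h2]
  simp_rw [gramSum_eq e f]

theorem detOneAdd_comm {T : E →L[ℂ] F} (hT : IsHilbertSchmidt T) (z : ℂ) :
    detOneAdd (-(z • (T.adjoint ∘L T))) = detOneAdd (-(z • (T ∘L T.adjoint))) := by
  have h := detOneAdd_adjoint_comp_self T.adjoint z
  rw [ContinuousLinearMap.adjoint_adjoint] at h
  rw [detOneAdd_adjoint_comp_self, h]
  exact tsum_pow_mul_gramDet_adjoint _ _ hT _

/-- The Fredholm determinant `det (I - z T† T)` is the product over the eigenvalues of `T† T`. -/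
theorem detOneAdd_eq_tprod {ι : Type*} {b : HilbertBasis ι ℂ E} {T : E →L[ℂ] F}
    {μ : ι → ℝ} (hT : IsHilbertSchmidt T)
    (hb : ∀ i, (T.adjoint ∘L T) (b i) = (μ i : ℂ) • b i) (z : ℂ) :
    detOneAdd (-(z • (T.adjoint ∘L T))) = ∏' i, (1 + -z * μ i) := by
  rw [← tsum_pow_mul_gramDet_eq_tprod hT hb, detOneAdd_adjoint_comp_self,
    tsum_pow_mul_gramDet_adjoint _ (onb F) hT, ← tsum_pow_mul_gramDet_adjoint b (onb F) hT]

/-! ### Zeros of canonical products -/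

theorem differentiable_tprod {ι : Type*} {μ : ι → ℝ} (hμ : Summable μ) :
    Differentiable ℂ fun z : ℂ => ∏' i, (1 + -z * μ i) := by
  have h : HasProdLocallyUniformlyOn (fun i (z : ℂ) => 1 + -z * μ i)
      (fun z => ∏' i, (1 + -z * μ i)) univ := by
    refine hasProdLocallyUniformlyOn_of_forall_compact isOpen_univ fun K _ hK => ?_
    obtain ⟨R, hR⟩ := hK.isBounded.exists_norm_le
    refine Summable.hasProdUniformlyOn_one_add hK (hμ.norm.mul_left R)
      (.of_forall fun i z hz => ?_) fun i => by fun_prop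
    rw [norm_mul, norm_neg, Complex.norm_real]
    exact mul_le_mul_of_nonneg_right (hR z hz) (norm_nonneg _)
  rw [← differentiableOn_univ]
  refine TendstoLocallyUniformlyOn.differentiableOn h (.of_forall fun s => ?_) isOpen_univ
  fun_prop

theorem summable_norm_neg_mul {ι : Type*} {μ : ι → ℝ} (hμ : Summable μ) (z : ℂ) :
    Summable fun i => ‖-z * (μ i : ℂ)‖ := by
  simp_rw [norm_mul, Complex.norm_real]
  exact hμ.norm.mul_left _

theorem exists_of_tprod_eq_zero {ι : Type*} {μ : ι → ℝ} (hμ : Summable μ) {z : ℂ}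
    (h : ∏' i, (1 + -z * μ i) = 0) : ∃ i, 1 + -z * μ i = 0 := by
  by_contra! hne
  exact tprod_one_add_ne_zero_of_summable hne (summable_norm_neg_mul hμ z) h

theorem pos_of_one_add_neg_mul_eq_zero {μ : ℝ} (hμ : 0 ≤ μ) {z : ℂ} (h : 1 + -z * μ = 0) :
    ∃ r : ℝ, 0 < r ∧ z = r := by
  have h1 : z * μ = 1 := by linear_combination -h
  have h0 : (μ : ℂ) ≠ 0 := right_ne_zero_of_mul_eq_one h1
  have h0' : 0 < μ := lt_of_le_of_ne hμ (by exact_mod_cast h0.symm)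
  refine ⟨μ⁻¹, inv_pos.mpr h0', ?_⟩
  rw [Complex.ofReal_inv, eq_inv_of_mul_eq_one_left h1]

/-- The order of a zero `z` of `∏ (1 - z μᵢ)` is at most the number of factors vanishing at `z`. -/
theorem analyticOrderAt_tprod_le {ι : Type*} {μ : ι → ℝ} (hμ : Summable μ) (z : ℂ) (m : ℕ)
    (hm : ∀ s : Finset ι, (∀ i ∈ s, 1 + -z * μ i = 0) → s.card ≤ m) :
    analyticOrderAt (fun w : ℂ => ∏' i, (1 + -w * μ i)) z ≤ m := by
  classical
  have hfin : {i | 1 + -z * (μ i : ℂ) = 0}.Finite := by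
    by_contra hinf
    obtain ⟨s, hs, hc⟩ := Set.Infinite.exists_subset_card_eq hinf (m + 1)
    have := hm s fun i hi => hs hi
    omega
  set J : Finset ι := hfin.toFinset with hJ
  have hJm : ∀ i, i ∈ J ↔ 1 + -z * (μ i : ℂ) = 0 := fun i => by simp [hJ]
  have hcard : J.card ≤ m := hm J fun i hi => (hJm i).mp hi
  let μ' : ι → ℝ := fun i => if i ∈ J then 0 else μ i
  have hμ' : Summable μ' := by
    refine .of_norm_bounded hμ.norm fun i => ?_
    by_cases hi : i ∈ J <;> simp [μ', hi]
  have hsplit : (fun w : ℂ => ∏' i, (1 + -w * μ i)) =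
      (∏ i ∈ J, fun w : ℂ => 1 + -w * (μ i : ℂ)) * fun w : ℂ => ∏' i, (1 + -w * μ' i) := by
    ext w
    have h1 : Multipliable fun i => 1 + -w * (μ' i : ℂ) :=
      multipliable_one_add_of_summable (summable_norm_neg_mul hμ' w)
    have h2 : HasProd (fun i => if i ∈ J then 1 + -w * (μ i : ℂ) else 1)
        (∏ i ∈ J, (1 + -w * (μ i : ℂ))) := by
      have := hasProd_prod_of_ne_finset_one (f := fun i => if i ∈ J then 1 + -w * (μ i : ℂ) else 1)
        (s := J) (L := .unconditional ι) fun i hi => by simp [hi]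
      convert this using 1
      exact Finset.prod_congr rfl fun i hi => by simp [hi]
    rw [Pi.mul_apply, Finset.prod_apply, ← h2.tprod_eq, ← h2.multipliable.tprod_mul h1]
    refine tprod_congr fun i => ?_
    by_cases hi : i ∈ J <;> simp [μ', hi]
  have han : ∀ i, AnalyticAt ℂ (fun w : ℂ => 1 + -w * (μ i : ℂ)) z := fun i => by fun_prop
  have h2 : analyticOrderAt (fun w : ℂ => ∏' i, (1 + -w * μ' i)) z = 0 := by
    rw [analyticOrderAt_eq_zero]
    right
    intro h
    obtain ⟨i, hi⟩ := exists_of_tprod_eq_zero hμ' h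
    by_cases hiJ : i ∈ J
    · simp [μ', hiJ] at hi
    · simp only [μ', if_neg hiJ] at hi
      exact hiJ ((hJm i).mpr hi)
  have h3 : ∀ i ∈ J, analyticOrderAt (fun w : ℂ => 1 + -w * (μ i : ℂ)) z = 1 := by
    intro i hi
    have hz := (hJm i).mp hi
    have h0 : (μ i : ℂ) ≠ 0 := by
      intro h0
      simp [h0] at hz
    refine (AnalyticAt.analyticOrderAt_eq_natCast (n := 1) (han i)).mpr
      ⟨fun _ => -(μ i : ℂ), by fun_prop, by simpa using h0, .of_forall fun w => ?_⟩
    simp only [pow_one, smul_eq_mul]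
    linear_combination hz
  have h4 : AnalyticAt ℂ (fun w : ℂ => ∏' i, (1 + -w * μ' i)) z :=
    (differentiable_tprod hμ').analyticAt z
  have h5 : ∀ s ⊆ J, AnalyticAt ℂ (∏ i ∈ s, fun w : ℂ => 1 + -w * (μ i : ℂ)) z ∧
      analyticOrderAt (∏ i ∈ s, fun w : ℂ => 1 + -w * (μ i : ℂ)) z = s.card := by
    intro s hs
    induction s using Finset.induction_on with
    | empty =>
      simp only [Finset.prod_empty, Finset.card_empty]
      refine ⟨analyticAt_const, ?_⟩
      rw [Nat.cast_zero, analyticOrderAt_eq_zero]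
      right
      simp
    | insert i s hi ih =>
      obtain ⟨ih1, ih2⟩ := ih ((Finset.subset_insert i s).trans hs)
      rw [Finset.prod_insert hi, Finset.card_insert_of_notMem hi]
      refine ⟨(han i).mul ih1, ?_⟩
      rw [analyticOrderAt_mul (han i) ih1, ih2, h3 i (hs (Finset.mem_insert_self i s))]
      push_cast
      ring
  rw [hsplit, analyticOrderAt_mul (h5 J subset_rfl).1 h4, (h5 J subset_rfl).2, h2, add_zero]
  exact_mod_cast hcard

end Determinant

namespace C0Semigroup

/-! ### Bounded semigroups, their generators and resolvents -/

variable {H H₀ : Type*} [NormedAddCommGroup H] [InnerProductSpace ℂ H] [CompleteSpace H]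
  [NormedAddCommGroup H₀] [InnerProductSpace ℂ H₀] [CompleteSpace H₀]

section Semigroup

variable (S : C0Semigroup H)

theorem op_comm (s t : ℝ≥0) (ξ : H) : S.op s (S.op t ξ) = S.op t (S.op s ξ) := by
  rw [← mul_apply_eq_comp, ← mul_apply_eq_comp, ← S.op_add, ← S.op_add, add_comm]

theorem op_add_apply (s t : ℝ≥0) (ξ : H) : S.op (s + t) ξ = S.op s (S.op t ξ) := by
  rw [S.op_add, mul_apply_eq_comp]

theorem op_zero_apply (ξ : H) : S.op 0 ξ = ξ := by
  rw [S.op_zero]; rfl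

variable {S} {M : ℝ}

theorem bound_nonneg (hM : ∀ t, ‖S.op t‖ ≤ M) : 0 ≤ M := (norm_nonneg _).trans (hM 0)

theorem norm_op_le (hM : ∀ t, ‖S.op t‖ ≤ M) (t : ℝ≥0) (ξ : H) : ‖S.op t ξ‖ ≤ M * ‖ξ‖ :=
  (S.op t).le_of_opNorm_le (hM t) ξ

theorem norm_op_sub_le (hM : ∀ t, ‖S.op t‖ ≤ M) (s t : ℝ≥0) (ξ : H) :
    ‖S.op s ξ - S.op t ξ‖ ≤ M * ‖S.op (max s t - min s t) ξ - ξ‖ := by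
  wlog h : t ≤ s generalizing s t
  · rw [norm_sub_rev, max_comm, min_comm]
    exact this t s (le_of_not_ge h)
  rw [max_eq_left h, min_eq_right h]
  have h1 : S.op s ξ = S.op t (S.op (s - t) ξ) := by
    rw [← op_add_apply, add_tsub_cancel_of_le h]
  rw [h1, ← map_sub]
  exact norm_op_le hM _ _

theorem continuous_orbit (hM : ∀ t, ‖S.op t‖ ≤ M) (ξ : H) : Continuous fun t => S.op t ξ := by
  rw [continuous_iff_continuousAt]
  intro t
  rw [ContinuousAt, tendsto_iff_norm_sub_tendsto_zero]
  have h1 : Tendsto (fun s : ℝ≥0 => max s t - min s t) (𝓝 t) (𝓝 0) := by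
    have : Continuous fun s : ℝ≥0 => max s t - min s t := by fun_prop
    simpa using this.tendsto t
  have h2 := ((S.strongly_continuous ξ).comp h1).sub_const ξ |>.norm.const_mul M
  rw [sub_self, norm_zero, mul_zero] at h2
  exact squeeze_zero (fun s => norm_nonneg _) (fun s => norm_op_sub_le hM s t ξ) h2

/-- The semigroup is jointly continuous in time and in the initial state. -/
theorem continuous_op (hM : ∀ t, ‖S.op t‖ ≤ M) : Continuous fun p : ℝ≥0 × H => S.op p.1 p.2 := by
  rw [continuous_iff_continuousAt]
  rintro ⟨t, ξ⟩
  rw [ContinuousAt, tendsto_iff_norm_sub_tendsto_zero]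
  have h1 : Tendsto (fun p : ℝ≥0 × H => M * ‖p.2 - ξ‖ + ‖S.op p.1 ξ - S.op t ξ‖)
      (𝓝 (t, ξ)) (𝓝 0) := by
    have : Continuous fun p : ℝ≥0 × H => M * ‖p.2 - ξ‖ + ‖S.op p.1 ξ - S.op t ξ‖ := by
      have := (continuous_orbit hM ξ).comp (continuous_fst (X := ℝ≥0) (Y := H))
      simp only [Function.comp_def] at this
      fun_prop
    simpa using this.tendsto (t, ξ)
  refine squeeze_zero (fun s => norm_nonneg _) (fun p => ?_) h1
  calc ‖S.op p.1 p.2 - S.op t ξ‖ = ‖S.op p.1 (p.2 - ξ) + (S.op p.1 ξ - S.op t ξ)‖ := by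
        rw [map_sub]; congr 1; abel
    _ ≤ _ := (norm_add_le _ _).trans (add_le_add_left (norm_op_le hM _ _) _)

theorem continuous_op_toNNReal (hM : ∀ t, ‖S.op t‖ ≤ M) (ξ : H) :
    Continuous fun t : ℝ => S.op t.toNNReal ξ :=
  (continuous_orbit hM ξ).comp continuous_real_toNNReal

/-- The resolvent `(z + A)⁻¹ ξ = ∫₀^∞ e^{-zt} e^{-tA} ξ dt` for `Re z > 0`. -/
def res (S : C0Semigroup H) (z : ℂ) (ξ : H) : H :=
  ∫ t in Ioi (0 : ℝ), Complex.exp (-(z * t)) • S.op t.toNNReal ξ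

theorem norm_exp_smul_op_le (hM : ∀ t, ‖S.op t‖ ≤ M) (z : ℂ) (ξ : H) (t : ℝ) :
    ‖Complex.exp (-(z * t)) • S.op t.toNNReal ξ‖ ≤ Real.exp (-z.re * t) * (M * ‖ξ‖) := by
  rw [norm_smul, Complex.norm_exp]
  refine mul_le_mul (le_of_eq ?_) (norm_op_le hM _ _) (norm_nonneg _) (Real.exp_nonneg _)
  simp

theorem integrable_exp_smul_op (hM : ∀ t, ‖S.op t‖ ≤ M) {z : ℂ} (hz : 0 < z.re) (ξ : H) :
    IntegrableOn (fun t : ℝ => Complex.exp (-(z * t)) • S.op t.toNNReal ξ) (Ioi 0) := by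
  have h1 : IntegrableOn (fun t : ℝ => Real.exp (-z.re * t) * (M * ‖ξ‖)) (Ioi 0) :=
    (integrableOn_exp_mul_Ioi (by linarith) 0).mul_const _
  refine Integrable.mono' h1 ?_ (.of_forall fun t => norm_exp_smul_op_le hM z ξ t)
  have := continuous_op_toNNReal hM ξ
  exact Continuous.aestronglyMeasurable (by fun_prop)

theorem norm_res_le (hM : ∀ t, ‖S.op t‖ ≤ M) {z : ℂ} (hz : 0 < z.re) (ξ : H) :
    ‖S.res z ξ‖ ≤ M / z.re * ‖ξ‖ := by
  have h1 : IntegrableOn (fun t : ℝ => Real.exp (-z.re * t) * (M * ‖ξ‖)) (Ioi 0) :=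
    (integrableOn_exp_mul_Ioi (by linarith) 0).mul_const _
  refine (norm_integral_le_of_norm_le h1 (.of_forall fun t => norm_exp_smul_op_le hM z ξ t)).trans
    (le_of_eq ?_)
  rw [integral_mul_const, integral_exp_mul_Ioi (by linarith)]
  simp
  ring

theorem res_add (hM : ∀ t, ‖S.op t‖ ≤ M) {z : ℂ} (hz : 0 < z.re) (ξ η : H) :
    S.res z (ξ + η) = S.res z ξ + S.res z η := by
  rw [res, res, res, ← integral_add (integrable_exp_smul_op hM hz ξ)
    (integrable_exp_smul_op hM hz η)]
  simp

theorem res_smul (z c : ℂ) (ξ : H) : S.res z (c • ξ) = c • S.res z ξ := by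
  rw [res, res, ← integral_smul]
  simp_rw [map_smul, smul_comm c]

/-- The resolvent as a bounded operator. -/
def resCLM (hM : ∀ t, ‖S.op t‖ ≤ M) {z : ℂ} (hz : 0 < z.re) : H →L[ℂ] H :=
  LinearMap.mkContinuous
    { toFun := S.res z
      map_add' := res_add hM hz
      map_smul' := fun c ξ => res_smul z c ξ } (M / z.re) fun ξ => norm_res_le hM hz ξ

theorem resCLM_apply (hM : ∀ t, ‖S.op t‖ ≤ M) {z : ℂ} (hz : 0 < z.re) (ξ : H) :
    resCLM hM hz ξ = S.res z ξ := rfl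

theorem res_op (hM : ∀ t, ‖S.op t‖ ≤ M) {z : ℂ} (hz : 0 < z.re) (ξ : H) (s : ℝ≥0) :
    S.res z (S.op s ξ) = S.op s (S.res z ξ) := by
  rw [res, res, ← ContinuousLinearMap.integral_comp_comm _ (integrable_exp_smul_op hM hz ξ)]
  simp_rw [map_smul, op_comm S s]

theorem tendsto_average {f : ℝ → H} (hf : Continuous f) :
    Tendsto (fun h : ℝ => (h : ℂ)⁻¹ • ∫ t in 0..h, f t) (𝓝[>] 0) (𝓝 (f 0)) := by
  have h1 := (intervalIntegral.integral_hasDerivAt_right (hf.intervalIntegrable 0 0)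
    (hf.stronglyMeasurableAtFilter _ _) hf.continuousAt)
  have h2 := h1.tendsto_slope_zero_right
  refine h2.congr fun t => ?_
  rw [zero_add, intervalIntegral.integral_same, sub_zero, ← Complex.ofReal_inv,
    Complex.coe_smul]

theorem setIntegral_Ioi_comp_add {V : Type*} [NormedAddCommGroup V] [NormedSpace ℝ V] (f : ℝ → V)
    (a h : ℝ) : ∫ t in Ioi a, f (t + h) = ∫ t in Ioi (a + h), f t := by
  rw [← (measurePreserving_add_right volume h).setIntegral_preimage_emb
    (measurableEmbedding_addRight h) f, Set.preimage_add_const_Ioi, add_sub_cancel_right]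

/-- `(z + A)⁻¹` maps into the domain of `A`, and `A (z + A)⁻¹ ξ = ξ - z (z + A)⁻¹ ξ`. -/
theorem genRel_res (hM : ∀ t, ‖S.op t‖ ≤ M) {z : ℂ} (hz : 0 < z.re) (ξ : H) :
    S.GenRel (S.res z ξ) (ξ - z • S.res z ξ) := by
  let f : ℝ → H := fun t => Complex.exp (-(z * t)) • S.op t.toNNReal ξ
  have hf : Continuous f := by
    have := continuous_op_toNNReal hM ξ
    simp only [f]
    fun_prop
  have hfi : IntegrableOn f (Ioi 0) := integrable_exp_smul_op hM hz ξ
  -- Shifting the variable of integration: `e^{-hA} (z + A)⁻¹ ξ = e^{zh} ∫_h^∞ e^{-zt} e^{-tA} ξ dt`.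
  have h1 : ∀ h : ℝ, 0 < h → S.op h.toNNReal (S.res z ξ) =
      Complex.exp (z * h) • (S.res z ξ - ∫ t in 0..h, f t) := by
    intro h hh
    have e1 : S.res z ξ - ∫ t in 0..h, f t = ∫ t in Ioi h, f t := by
      rw [sub_eq_iff_eq_add, add_comm]
      exact (intervalIntegral.integral_interval_add_Ioi hfi
        (hfi.mono_set (Ioi_subset_Ioi hh.le))).symm
    have e2 : ∫ t in Ioi h, f t = ∫ t in Ioi (0 : ℝ), f (t + h) := by
      rw [setIntegral_Ioi_comp_add, zero_add]
    rw [e1, e2, ← integral_smul, res, ← ContinuousLinearMap.integral_comp_comm _ hfi]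
    refine setIntegral_congr_fun measurableSet_Ioi fun t ht => ?_
    have ht' : (0 : ℝ) < t := ht
    simp only [f, map_smul]
    rw [smul_smul, ← Complex.exp_add, Real.toNNReal_add ht'.le hh.le, op_add_apply, op_comm]
    congr 2
    push_cast
    ring
  have h2 : Tendsto (fun h : ℝ => ((h : ℂ)⁻¹ * (1 - Complex.exp (z * h))) • S.res z ξ +
      Complex.exp (z * h) • (h : ℂ)⁻¹ • ∫ t in 0..h, f t) (𝓝[>] 0)
      (𝓝 ((-z) • S.res z ξ + (1 : ℂ) • ξ)) := by
    refine Tendsto.add (Tendsto.smul_const ?_ _) (Tendsto.smul ?_ ?_)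
    · have d : HasDerivAt (fun h : ℝ => 1 - Complex.exp (z * h)) (-z) 0 := by
        have d1 : HasDerivAt (fun h : ℝ => z * (h : ℂ)) z 0 := by
          simpa using (Complex.ofRealCLM.hasDerivAt (x := (0 : ℝ))).const_mul z
        simpa using (d1.cexp).const_sub 1
      refine d.tendsto_slope_zero_right.congr fun t => ?_
      simp
    · have : Continuous fun h : ℝ => Complex.exp (z * h) := by fun_prop
      have h3 := (this.tendsto 0).mono_left (nhdsWithin_le_nhds (s := Ioi 0))
      simpa using h3
    · have := tendsto_average hf
      simpa [f, op_zero_apply] using this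
  have h3 : (-z) • S.res z ξ + (1 : ℂ) • ξ = ξ - z • S.res z ξ := by
    rw [one_smul, neg_smul]; abel
  rw [GenRel, ← h3]
  refine h2.congr' ?_
  filter_upwards [self_mem_nhdsWithin] with h hh
  rw [h1 h hh]
  module

/-- `(z + A)⁻¹ (z + A) ξ = ξ` for `ξ` in the domain of `A`. -/
theorem res_of_genRel (hM : ∀ t, ‖S.op t‖ ≤ M) {z : ℂ} (hz : 0 < z.re) {ξ η : H}
    (h : S.GenRel ξ η) : S.res z η = ξ - z • S.res z ξ := by
  refine tendsto_nhds_unique ?_ (genRel_res hM hz ξ)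
  refine (((resCLM hM hz).continuous.tendsto η).comp h).congr fun t => ?_
  simp only [Function.comp_apply, map_smul, map_sub, resCLM_apply, res_op hM hz]

theorem GenRel.mem {ξ η : H} (h : S.GenRel ξ η) : ξ ∈ S.A.domain := ⟨η, h⟩

theorem genRel_A (ξ : S.A.domain) : S.GenRel ξ (S.A ξ) := ξ.2.choose_spec

/-- The substitution `t = u / r` in the integral defining `r (r + A)⁻¹ ξ`. -/
theorem smul_res_eq (S : C0Semigroup H) {r : ℝ} (hr : 0 < r) (ξ : H) :
    (r : ℂ) • S.res r ξ =
      ∫ u in Ioi (0 : ℝ), Complex.exp (-(u : ℂ)) • S.op (r⁻¹ * u).toNNReal ξ := by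
  have h := integral_comp_mul_left_Ioi (fun u : ℝ => Complex.exp (-(r * u : ℂ)) •
    S.op u.toNNReal ξ) 0 (inv_pos.mpr hr)
  rw [mul_zero, inv_inv] at h
  rw [res, Complex.coe_smul, ← h]
  refine setIntegral_congr_fun measurableSet_Ioi fun t _ => ?_
  have : (r : ℂ) ≠ 0 := by exact_mod_cast hr.ne'
  push_cast
  rw [mul_inv_cancel_left₀ this]

/-- `r (r + A)⁻¹ ξ → ξ` as `r → ∞`, so that the domain of `A` is dense. -/
theorem tendsto_smul_res (hM : ∀ t, ‖S.op t‖ ≤ M) (ξ : H) :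
    Tendsto (fun r : ℝ => (r : ℂ) • S.res r ξ) atTop (𝓝 ξ) := by
  have hexp : IntegrableOn (fun u : ℝ => Real.exp (-u)) (Ioi 0) := by
    simpa using integrableOn_exp_mul_Ioi (a := -1) (by norm_num) 0
  have h1 : Tendsto (fun r : ℝ => ∫ u in Ioi (0 : ℝ), Complex.exp (-(u : ℂ)) •
      S.op (r⁻¹ * u).toNNReal ξ) atTop
      (𝓝 (∫ u in Ioi (0 : ℝ), Complex.exp (-(u : ℂ)) • ξ)) := by
    refine tendsto_integral_filter_of_dominated_convergence
      (fun u => Real.exp (-u) * (M * ‖ξ‖)) (.of_forall fun r => ?_) (.of_forall fun r =>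
        .of_forall fun u => ?_) (hexp.mul_const _) (.of_forall fun u => ?_)
    · have h2 : Continuous fun u : ℝ => S.op (r⁻¹ * u).toNNReal ξ :=
        (continuous_op_toNNReal hM ξ).comp (continuous_const_mul r⁻¹)
      exact Continuous.aestronglyMeasurable (by fun_prop)
    · rw [norm_smul, Complex.norm_exp]
      refine mul_le_mul (le_of_eq (by simp)) (norm_op_le hM _ _) (norm_nonneg _)
        (Real.exp_nonneg _)
    · refine Tendsto.const_smul ?_ _
      have h2 : Tendsto (fun r : ℝ => r⁻¹ * u) atTop (𝓝 0) := by
        simpa using tendsto_inv_atTop_zero.mul_const u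
      have h3 := ((continuous_op_toNNReal hM ξ).tendsto 0).comp h2
      simpa [op_zero_apply, Function.comp_def] using h3
  have h4 : ∫ u in Ioi (0 : ℝ), Complex.exp (-(u : ℂ)) • ξ = ξ := by
    rw [integral_smul_const]
    have := integral_exp_mul_complex_Ioi (a := -1) (by simp) 0
    simp only [neg_mul, one_mul] at this
    rw [this]
    simp
  rw [h4] at h1
  refine h1.congr' ?_
  filter_upwards [eventually_gt_atTop 0] with r hr
  rw [smul_res_eq S hr]

theorem dense_domain (hM : ∀ t, ‖S.op t‖ ≤ M) : Dense (S.A.domain : Set H) := by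
  intro ξ
  refine mem_closure_of_tendsto (tendsto_smul_res hM ξ) ?_
  filter_upwards [eventually_gt_atTop 0] with r hr
  exact S.A.domain.smul_mem _ (genRel_res hM (by simpa using hr) ξ).mem

end Semigroup

section Output

variable {S : C0Semigroup H} {M : ℝ} {C : S.A.domain →ₗ[ℂ] H₀}

theorem one_re_pos : (0 : ℝ) < (1 : ℂ).re := by simp

/-- The resolvent with values in the domain of `A`. -/
def resDom (hM : ∀ t, ‖S.op t‖ ≤ M) {z : ℂ} (hz : 0 < z.re) : H →ₗ[ℂ] S.A.domain :=
  (resCLM hM hz : H →ₗ[ℂ] H).codRestrict S.A.domain fun ξ => (genRel_res hM hz ξ).mem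

theorem coe_resDom (hM : ∀ t, ‖S.op t‖ ≤ M) {z : ℂ} (hz : 0 < z.re) (ξ : H) :
    (resDom hM hz ξ : H) = S.res z ξ := rfl

theorem A_resDom (hM : ∀ t, ‖S.op t‖ ≤ M) {z : ℂ} (hz : 0 < z.re) (ξ : H) :
    S.A (resDom hM hz ξ) = ξ - z • S.res z ξ :=
  (genRel_A _).unique (genRel_res hM hz ξ)

/-- The bounded operator `C (1 + A)⁻¹`. -/
def outRes (hM : ∀ t, ‖S.op t‖ ≤ M) (hC : GraphBounded C) : H →L[ℂ] H₀ :=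
  LinearMap.mkContinuousOfExistsBound (C ∘ₗ resDom hM one_re_pos) (by
    obtain ⟨c, hc⟩ := hC
    refine ⟨|c| * (M + (1 + M)), fun ξ => ?_⟩
    refine (hc _).trans ?_
    have hM0 := bound_nonneg hM
    have h1 : ‖(resDom hM one_re_pos ξ : H)‖ ≤ M * ‖ξ‖ := by
      rw [coe_resDom]
      simpa using norm_res_le hM one_re_pos ξ
    have h2 : ‖S.A (resDom hM one_re_pos ξ)‖ ≤ (1 + M) * ‖ξ‖ := by
      rw [A_resDom, one_smul]
      refine (norm_sub_le _ _).trans ?_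
      rw [coe_resDom] at h1
      linarith
    rw [mul_assoc]
    refine mul_le_mul (le_abs_self c) ?_ (Real.sqrt_nonneg _) (abs_nonneg _)
    refine (Real.sqrt_le_left (by positivity)).mpr ?_
    rw [add_mul]
    nlinarith [norm_nonneg (resDom hM one_re_pos ξ : H),
      norm_nonneg (S.A (resDom hM one_re_pos ξ))])

theorem outRes_apply (hM : ∀ t, ‖S.op t‖ ≤ M) (hC : GraphBounded C) (ξ : H) :
    outRes hM hC ξ = C (resDom hM one_re_pos ξ) := rfl

/-- `C = (C (1 + A)⁻¹) (1 + A)` on the domain of `A`. -/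
theorem C_eq_outRes (hM : ∀ t, ‖S.op t‖ ≤ M) (hC : GraphBounded C) (ξ : S.A.domain) :
    C ξ = outRes hM hC (ξ + S.A ξ) := by
  rw [outRes_apply]
  congr 1
  refine Subtype.ext ?_
  rw [coe_resDom, res_add hM one_re_pos, res_of_genRel hM one_re_pos (genRel_A ξ), one_smul]
  abel

theorem coe_onDomain (t : ℝ≥0) (ξ : S.A.domain) : (S.onDomain t ξ : H) = S.op t ξ := rfl

theorem A_onDomain (t : ℝ≥0) (ξ : S.A.domain) : S.A (S.onDomain t ξ) = S.op t (S.A ξ) :=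
  (genRel_A _).unique ((genRel_A ξ).orbit t)

theorem output_eq (hM : ∀ t, ‖S.op t‖ ≤ M) (hC : GraphBounded C) (ξ : S.A.domain) (s : ℝ) :
    output C ξ s = outRes hM hC (S.op s.toNNReal (ξ + S.A ξ)) := by
  rw [output, C_eq_outRes hM hC, coe_onDomain, A_onDomain, ← map_add (S.op _)]

theorem continuous_output (hM : ∀ t, ‖S.op t‖ ≤ M) (hC : GraphBounded C) (ξ : S.A.domain) :
    Continuous (output C ξ) := by
  have h : output C ξ = fun s => outRes hM hC (S.op s.toNNReal (ξ + S.A ξ)) :=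
    funext fun s => output_eq hM hC ξ s
  rw [h]
  exact (outRes hM hC).continuous.comp (continuous_op_toNNReal hM _)

theorem denseRange_subtype (hM : ∀ t, ‖S.op t‖ ≤ M) : DenseRange S.A.domain.subtype := by
  rw [DenseRange, Submodule.coe_subtype, Subtype.range_coe]
  exact dense_domain hM

theorem norm_outputL2_le (h : Admissible C) (ξ : S.A.domain) :
    ‖outputL2 h ξ‖ ≤ |h.choose| * ‖(ξ : H)‖ := by
  have h1 := (h.choose_spec ξ).2
  have h2 : ‖outputL2 h ξ‖ ^ 2 = ∫ s, ‖output C ξ s‖ ^ 2 ∂halfLine := by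
    rw [← inner_self_eq_norm_sq (𝕜 := ℂ), L2.inner_def, ← integral_re]
    · refine integral_congr_ae ?_
      filter_upwards [(h.choose_spec ξ).1.coeFn_toLp] with s hs
      change RCLike.re ⟪((h.choose_spec ξ).1.toLp) s, ((h.choose_spec ξ).1.toLp) s⟫_ℂ = _
      rw [hs, inner_self_eq_norm_sq]
    · exact L2.integrable_inner _ _
  refine le_of_sq_le_sq ?_ (by positivity)
  rw [h2, mul_pow, sq_abs]
  exact h1

theorem obsAdj_apply (hM : ∀ t, ‖S.op t‖ ≤ M) (h : Admissible C) (ξ : S.A.domain) :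
    obsAdj h (ξ : H) = outputL2 h ξ :=
  LinearMap.extendOfNorm_eq (denseRange_subtype hM) ⟨_, norm_outputL2_le h⟩ ξ

theorem coeFn_obsAdj (hM : ∀ t, ‖S.op t‖ ≤ M) (h : Admissible C) (ξ : S.A.domain) :
    obsAdj h (ξ : H) =ᵐ[halfLine] output C ξ := by
  rw [obsAdj_apply hM]
  exact (h.choose_spec ξ).1.coeFn_toLp

end Output

section Gramian

variable {S : C0Semigroup H} {C : S.A.domain →ₗ[ℂ] H₀}

theorem proj_apply {F : Type*} [NormedAddCommGroup F] [InnerProductSpace ℂ F] (x : ℝ) (f : L2 F) :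
    proj x f = projLin x f := rfl

theorem proj_comp_proj (x : ℝ) (f : L2 H₀) : proj x (proj x f) = proj x f := by
  refine Lp.ext ?_
  filter_upwards [coeFn_projLin x (proj x f), coeFn_projLin x f] with s h1 h2
  simp only [proj_apply] at h1 ⊢
  rw [h1]
  by_cases hs : s ∈ Ioi x
  · simp [hs]
  · simp [hs, h2]

theorem isSelfAdjoint_proj (x : ℝ) : (proj x : L2 H₀ →L[ℂ] L2 H₀).adjoint = proj x := by
  symm
  rw [ContinuousLinearMap.eq_adjoint_iff]
  intro f g
  rw [proj_apply, proj_apply, ← tailInner_eq, ← inner_conj_symm, ← tailInner_eq, tailInner,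
    tailInner, ← integral_conj]
  simp

theorem tailInner_eq_proj (x : ℝ) (f g : L2 H₀) :
    tailInner x f g = ⟪proj x f, proj x g⟫_ℂ := by
  rw [tailInner_eq, ← proj_apply, ← ContinuousLinearMap.adjoint_inner_right, isSelfAdjoint_proj,
    proj_comp_proj]

/-- The truncated output map `P_{(x,∞)} Θ†`. -/
def tailObs (h : Admissible C) (x : ℝ) : H →L[ℂ] L2 H₀ := proj x ∘L obsAdj h

theorem gramian_eq (h : Admissible C) (x : ℝ) :
    gramian h x = (tailObs h x).adjoint ∘L tailObs h x := by
  ext ξ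
  refine ext_inner_right ℂ fun η => ?_
  rw [gramian, InnerProductSpace.continuousLinearMapOfBilin_apply, ContinuousLinearMap.comp_apply,
    ContinuousLinearMap.adjoint_inner_left]
  change tailInner x (obsAdj h ξ) (obsAdj h η) = _
  rw [tailInner_eq_proj]
  rfl

theorem truncated_eq (h : Admissible C) (x : ℝ) :
    proj x ∘L (obs h).adjoint ∘L obs h ∘L proj x = tailObs h x ∘L (tailObs h x).adjoint := by
  rw [tailObs, ContinuousLinearMap.adjoint_comp, isSelfAdjoint_proj, obs,
    ContinuousLinearMap.adjoint_adjoint]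
  rfl

theorem isHilbertSchmidt_tailObs {h : Admissible C} (hΘ : IsHilbertSchmidt (obs h)) (x : ℝ) :
    IsHilbertSchmidt (tailObs h x) := by
  have h1 := hΘ.adjoint
  rw [obs, ContinuousLinearMap.adjoint_adjoint] at h1
  exact h1.comp_left _

theorem norm_sq_tailObs (h : Admissible C) (x : ℝ) (ξ : H) :
    ‖tailObs h x ξ‖ ^ 2 = ∫ s in Ioi x, ‖obsAdj h ξ s‖ ^ 2 ∂halfLine := by
  have h1 : ((‖tailObs h x ξ‖ ^ 2 : ℝ) : ℂ) = tailInner x (obsAdj h ξ) (obsAdj h ξ) := by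
    rw [tailInner_eq_proj, inner_self_eq_norm_sq_to_K]
    norm_cast
  rw [tailInner] at h1
  have h2 : ∀ s, ⟪obsAdj h ξ s, obsAdj h ξ s⟫_ℂ = ((‖obsAdj h ξ s‖ ^ 2 : ℝ) : ℂ) := fun s => by
    rw [inner_self_eq_norm_sq_to_K]; norm_cast
  simp_rw [h2] at h1
  exact Complex.ofReal_injective (h1.trans integral_ofReal)

end Gramian
end C0Semigroup

/-! ### Plancherel's theorem for the Laplace transform of the output -/

section Fourier

variable {F : Type*} [NormedAddCommGroup F] [InnerProductSpace ℂ F] [CompleteSpace F]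

theorem memLp_exp_smul {z : ℂ} (hz : 0 < z.re) (v : F) :
    MemLp (fun s : ℝ => Complex.exp (-(z * s)) • v) 2 halfLine := by
  have hc : Continuous fun s : ℝ => Complex.exp (-(z * s)) • v := by fun_prop
  rw [memLp_two_iff_integrable_sq_norm hc.aestronglyMeasurable]
  have h1 : IntegrableOn (fun t : ℝ => Real.exp (-(2 * z.re) * t) * ‖v‖ ^ 2) (Ioi 0) :=
    (integrableOn_exp_mul_Ioi (by linarith) 0).mul_const _
  refine h1.congr (.of_forall fun s => ?_)
  simp only [norm_smul, Complex.norm_exp, mul_pow, ← Real.exp_nat_mul]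
  congr 2
  simp
  ring

theorem integrable_exp_smul {z : ℂ} (hz : 0 < z.re) (f : L2 F) :
    Integrable (fun s : ℝ => Complex.exp (-(z * s)) • f s) halfLine := by
  rw [← memLp_one_iff_integrable]
  have h1 : MemLp (fun s : ℝ => Complex.exp (-(z * s))) 2 halfLine := by
    simpa using memLp_exp_smul hz (1 : ℂ)
  exact (Lp.memLp f).smul h1

theorem inner_integral_exp_smul {z : ℂ} (hz : 0 < z.re) (f : L2 F) (v : F) :
    ⟪v, ∫ s in Ioi (0 : ℝ), Complex.exp (-(z * s)) • f s⟫_ℂ =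
      ⟪(memLp_exp_smul (z := starRingEnd ℂ z) (by simpa using hz) v).toLp, f⟫_ℂ := by
  rw [← integral_inner (integrable_exp_smul hz f), L2.inner_def]
  refine integral_congr_ae ?_
  filter_upwards [(memLp_exp_smul (z := starRingEnd ℂ z) (by simpa using hz) v).coeFn_toLp]
    with s hs
  rw [hs, inner_smul_left, inner_smul_right, ← Complex.exp_conj]
  simp

theorem enorm_sq_eq_lintegral {μ : Measure ℝ} (f : Lp F 2 μ) :
    ‖f‖ₑ ^ 2 = ∫⁻ s, ‖f s‖ₑ ^ 2 ∂μ := by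
  rw [Lp.enorm_def, eLpNorm_eq_lintegral_rpow_enorm_toReal (by norm_num) (by norm_num),
    ← ENNReal.rpow_natCast, ← ENNReal.rpow_mul]
  simp

open scoped FourierTransform ContDiff SchwartzMap in
/-- On `L¹ ∩ L²` the Fourier transform of `L²` is given by the Fourier integral. -/
theorem coeFn_fourier_toLp {u : ℝ → F} (h1 : Integrable u) (h2 : MemLp u 2) :
    (𝓕 h2.toLp : Lp F 2 (volume : Measure ℝ)) =ᵐ[volume] 𝓕 u := by
  have hcont : Continuous (𝓕 u) := VectorFourier.fourierIntegral_continuous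
    Real.continuous_fourierChar (by exact continuous_inner) h1
  refine ae_eq_of_integral_contDiff_smul_eq ((Lp.memLp _).locallyIntegrable (by norm_num))
    hcont.locallyIntegrable fun g g_smooth g_cpt => ?_
  have hg₁ : HasCompactSupport (Complex.ofRealCLM ∘ g) := g_cpt.comp_left rfl
  have hg₂ : ContDiff ℝ ∞ (Complex.ofRealCLM ∘ g) := by fun_prop
  let G : 𝓢(ℝ, ℂ) := hg₁.toSchwartzMap hg₂
  have e1 := congrArg (fun T => T G) (Lp.fourier_toTemperedDistribution_eq (h2.toLp u))
  simp only [TemperedDistribution.fourier_apply, Lp.toTemperedDistribution_apply] at e1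
  have e2 : ∫ x, g x • (𝓕 h2.toLp : Lp F 2 (volume : Measure ℝ)) x =
      ∫ x, G x • (𝓕 h2.toLp : Lp F 2 (volume : Measure ℝ)) x := by
    simp [G]
  have e3 : ∫ x, (𝓕 G) x • (h2.toLp u) x = ∫ x, (𝓕 G) x • u x := by
    refine integral_congr_ae ?_
    filter_upwards [h2.coeFn_toLp] with x hx
    rw [hx]
  have e4 : ∫ x, (𝓕 G) x • u x = ∫ x, G x • (𝓕 u) x :=
    by
      have := VectorFourier.integral_fourierIntegral_smul_eq_flip (L := innerₗ ℝ)
        (μ := volume) (ν := volume) Real.continuous_fourierChar (by exact continuous_inner)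
        (f := G) G.integrable h1
      rw [flip_innerₗ] at this
      exact this
  rw [e2, ← e1, e3, e4]
  simp [G]

open scoped FourierTransform in
/-- If the Fourier transforms of the functions `e^{-αs} f(s)` on `(0, ∞)`, with `α = 1 / (n + 1)`,
converge pointwise to `g`, then `g` is the Fourier transform of `f`, and Plancherel's formula
holds. -/
theorem enorm_sq_eq_of_tendsto_laplace (f : L2 F) (g : ℝ → F)
    (hg : ∀ w : ℝ, Tendsto (fun n : ℕ => ∫ s in Ioi (0 : ℝ),
      Complex.exp (-((((n : ℝ) + 1)⁻¹ + 2 * Real.pi * w * Complex.I) * s)) • f s) atTop (𝓝 (g w))) :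
    ‖f‖ₑ ^ 2 = ∫⁻ w, ‖g w‖ₑ ^ 2 := by
  let a : ℕ → ℝ := fun n => ((n : ℝ) + 1)⁻¹
  have ha : ∀ n, 0 < a n := fun n => by positivity
  have ha0 : Tendsto a atTop (𝓝 0) := by
    simpa [a] using tendsto_one_div_add_atTop_nhds_zero_nat (𝕜 := ℝ)
  have hare : ∀ n, 0 < (a n : ℂ).re := fun n => by simpa using ha n
  let u : ℝ → F := (Ioi 0).indicator f
  let v : ℕ → ℝ → F := fun n => (Ioi 0).indicator fun s => Complex.exp (-((a n : ℂ) * s)) • f s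
  have hu : MemLp u 2 := (memLp_indicator_iff_restrict measurableSet_Ioi).mpr (Lp.memLp f)
  have hexp : ∀ n (s : ℝ), 0 < s → ‖Complex.exp (-((a n : ℂ) * s))‖ ≤ 1 := by
    intro n s hs
    rw [Complex.norm_exp]
    have : 0 ≤ a n * s := (mul_pos (ha n) hs).le
    simpa using this
  have hv1 : ∀ n, Integrable (v n) := fun n =>
    (integrable_indicator_iff measurableSet_Ioi).mpr (integrable_exp_smul (hare n) f)
  have hv : ∀ n, MemLp (v n) 2 := by
    intro n
    refine hu.of_le (hv1 n).aestronglyMeasurable (.of_forall fun s => ?_)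
    by_cases hs : s ∈ Ioi (0 : ℝ)
    · simp only [u, v, indicator_of_mem hs, norm_smul]
      exact mul_le_of_le_one_left (norm_nonneg _) (hexp n s hs)
    · simp [u, v, hs]
  have hF : ∀ n w, 𝓕 (v n) w = ∫ s in Ioi (0 : ℝ),
      Complex.exp (-((((n : ℝ) + 1)⁻¹ + 2 * Real.pi * w * Complex.I) * s)) • f s := by
    intro n w
    rw [Real.fourier_real_eq_integral_exp_smul, ← integral_indicator measurableSet_Ioi]
    refine integral_congr_ae (.of_forall fun s => ?_)
    by_cases hs : s ∈ Ioi (0 : ℝ)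
    · simp only [v, indicator_of_mem hs, smul_smul, ← Complex.exp_add, a]
      congr 2
      push_cast
      ring
    · simp [v, hs]
  have hlim : Tendsto (fun n => (hv n).toLp) atTop (𝓝 hu.toLp) := by
    rw [Lp.tendsto_Lp_iff_tendsto_eLpNorm'']
    have h1 : Tendsto (fun n => ∫⁻ s, ‖v n s - u s‖ₑ ^ (2 : ℝ)) atTop (𝓝 (∫⁻ _ : ℝ, 0)) := by
      refine tendsto_lintegral_of_dominated_convergence' (fun s => ‖u s‖ₑ ^ (2 : ℝ))
        (fun n => ((hv n).1.sub hu.1).enorm.pow_const _) (fun n => .of_forall fun s => ?_) ?_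
        (.of_forall fun s => ?_)
      · refine ENNReal.rpow_le_rpow ?_ (by norm_num)
        by_cases hs : s ∈ Ioi (0 : ℝ)
        · simp only [u, v, indicator_of_mem hs]
          have h2 : Complex.exp (-((a n : ℂ) * s)) • f s - f s =
              (((Real.exp (-(a n * s)) - 1 : ℝ)) : ℂ) • f s := by
            push_cast
            rw [sub_smul, one_smul]
          rw [h2, ← ofReal_norm, ← ofReal_norm, norm_smul, Complex.norm_real]
          refine ENNReal.ofReal_le_ofReal (mul_le_of_le_one_left (norm_nonneg _) ?_)
          have h3 : 0 ≤ a n * s := (mul_pos (ha n) hs).le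
          rw [Real.norm_eq_abs, abs_le]
          constructor
          · linarith [Real.exp_nonneg (-(a n * s))]
          · linarith [Real.exp_le_one_iff.mpr (neg_nonpos.mpr h3)]
        · simp [u, v, hs]
      · have h2 := (enorm_sq_eq_lintegral hu.toLp).symm
        have h3 : ∫⁻ s, ‖u s‖ₑ ^ (2 : ℝ) = ∫⁻ s, ‖hu.toLp u s‖ₑ ^ 2 := by
          refine lintegral_congr_ae ?_
          filter_upwards [hu.coeFn_toLp] with s hs
          rw [hs]
          norm_cast
        rw [h3, h2]
        simpa using hu.2.ne
      · by_cases hs : s ∈ Ioi (0 : ℝ)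
        · simp only [u, v, indicator_of_mem hs]
          have hc : Continuous fun b : ℝ => ‖Complex.exp (-((b : ℂ) * s)) • f s - f s‖ₑ ^ (2 : ℝ) :=
            (ENNReal.continuous_rpow_const (y := 2)).comp (Continuous.enorm (by fun_prop))
          have := (hc.tendsto 0).comp ha0
          simpa [Function.comp_def] using this
        · simp [u, v, hs]
    have h2 := h1.ennrpow_const (1 / 2)
    simp only [lintegral_zero] at h2
    rw [ENNReal.zero_rpow_of_pos (by norm_num)] at h2
    refine h2.congr fun n => ?_
    rw [eLpNorm_eq_lintegral_rpow_enorm_toReal (by norm_num) (by norm_num)]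
    simp
  have hlim2 := ((Lp.fourierTransformₗᵢ ℝ F).continuous.tendsto _).comp hlim
  obtain ⟨ns, hns, hae⟩ := (tendstoInMeasure_of_tendsto_Lp hlim2).exists_seq_tendsto_ae
  have hall : ∀ᵐ w : ℝ, ∀ n, (Lp.fourierTransformₗᵢ ℝ F (hv n).toLp) w = 𝓕 (v n) w :=
    ae_all_iff.mpr fun n => coeFn_fourier_toLp (hv1 n) (hv n)
  have hfg : (Lp.fourierTransformₗᵢ ℝ F hu.toLp : ℝ → F) =ᵐ[volume] g := by
    filter_upwards [hae, hall] with w h1 h2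
    refine tendsto_nhds_unique h1 (((hg w).comp hns.tendsto_atTop).congr fun n => ?_)
    simp only [Function.comp_apply, h2, hF]
  have e1 : ‖f‖ₑ ^ 2 = ‖hu.toLp‖ₑ ^ 2 := by
    rw [enorm_sq_eq_lintegral, enorm_sq_eq_lintegral, ← lintegral_indicator measurableSet_Ioi]
    refine lintegral_congr_ae ?_
    filter_upwards [hu.coeFn_toLp] with s hs
    rw [hs]
    by_cases hs : s ∈ Ioi (0 : ℝ) <;> simp [u, hs]
  have e2 : ‖hu.toLp‖ₑ = ‖Lp.fourierTransformₗᵢ ℝ F hu.toLp‖ₑ := by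
    rw [← ofReal_norm, ← ofReal_norm, LinearIsometryEquiv.norm_map]
  rw [e1, e2, enorm_sq_eq_lintegral]
  refine lintegral_congr_ae ?_
  filter_upwards [hfg] with w hw
  rw [hw]

end Fourier

namespace C0Semigroup

variable {H H₀ : Type*} [NormedAddCommGroup H] [InnerProductSpace ℂ H] [CompleteSpace H]
  [NormedAddCommGroup H₀] [InnerProductSpace ℂ H₀] [CompleteSpace H₀]
  {S : C0Semigroup H} {M : ℝ} {C : S.A.domain →ₗ[ℂ] H₀}

/-- The Laplace transform of the output `C e^{-sA} ξ` is `C (z + A)⁻¹ ξ`. -/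
theorem laplace_obsAdj (hM : ∀ t, ‖S.op t‖ ≤ M) (hC : GraphBounded C) (h : Admissible C)
    {z : ℂ} (hz : 0 < z.re) (ξ : H) :
    ∫ s in Ioi (0 : ℝ), Complex.exp (-(z * s)) • obsAdj h ξ s =
      outRes hM hC (ξ + (1 - z) • S.res z ξ) := by
  refine ext_inner_left ℂ fun v => ?_
  rw [inner_integral_exp_smul hz]
  refine congrFun ((denseRange_subtype hM).equalizer
    (g := fun ξ => ⟪(memLp_exp_smul (z := starRingEnd ℂ z) (by simpa using hz) v).toLp,
      obsAdj h ξ⟫_ℂ) (h := fun ξ => ⟪v, outRes hM hC (ξ + (1 - z) • S.res z ξ)⟫_ℂ)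
    ?_ ?_ (funext fun η => ?_)) ξ
  · exact continuous_const.inner (obsAdj h).continuous
  · have hr : Continuous (S.res z) := (resCLM hM hz).continuous
    exact continuous_const.inner ((outRes hM hC).continuous.comp (by fun_prop))
  · simp only [Function.comp_apply, Submodule.coe_subtype]
    rw [← inner_integral_exp_smul hz]
    congr 1
    have e1 : ∫ s in Ioi (0 : ℝ), Complex.exp (-(z * s)) • obsAdj h (η : H) s =
        ∫ s in Ioi (0 : ℝ), outRes hM hC
          (Complex.exp (-(z * s)) • S.op s.toNNReal (η + S.A η)) := by
      refine integral_congr_ae ?_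
      filter_upwards [coeFn_obsAdj hM h η] with s hs
      rw [hs, map_smul, output_eq hM hC]
    rw [e1, ContinuousLinearMap.integral_comp_comm _ (integrable_exp_smul_op hM hz _)]
    congr 1
    change S.res z (η + S.A η) = _
    rw [res_add hM hz, res_of_genRel hM hz (genRel_A η)]
    module

theorem genRel_shift {y : ℝ} {ζ : S.A.domain} {ξ : H} (h : S.shift y ζ = ξ) :
    S.GenRel ζ (ξ - (Complex.I * y) • (ζ : H)) := by
  have h1 := genRel_A ζ
  rw [← h]
  convert h1 using 1
  simp [shift]

/-- If `iy + A` is invertible, then `(α + iy + A)⁻¹ → (iy + A)⁻¹` strongly as `α → 0`. -/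
theorem tendsto_res (hM : ∀ t, ‖S.op t‖ ≤ M) {y : ℝ} {R : H → S.A.domain}
    (hR : ∀ ξ, S.shift y (R ξ) = ξ) (ξ : H) {α : ℕ → ℝ} (hα : ∀ n, 0 < α n)
    (hα0 : Tendsto α atTop (𝓝 0)) :
    Tendsto (fun n => S.res (α n + y * Complex.I) ξ) atTop (𝓝 (R ξ)) := by
  have hre : ∀ n, 0 < ((α n : ℂ) + y * Complex.I).re := fun n => by simpa using hα n
  -- The resolvent equation.
  have key : ∀ ξ n, S.res (α n + y * Complex.I) ξ =
      R ξ - (α n : ℂ) • S.res (α n + y * Complex.I) (R ξ) := by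
    intro ξ n
    have h1 := res_of_genRel hM (hre n) (genRel_shift (hR ξ))
    have h2 : ξ = (ξ - (Complex.I * y) • (R ξ : H)) + (Complex.I * y) • (R ξ : H) := by abel
    rw [h2, res_add hM (hre n), res_smul, h1, ← h2]
    module
  have hM0 := bound_nonneg hM
  -- Applied to `R ξ`, the resolvent equation bounds `(α + iy + A)⁻¹ R ξ` uniformly in `α`, although
  -- `(α + iy + A)⁻¹` is only known to have norm at most `M / α`.
  have hb : ∀ n, ‖(α n : ℂ) • S.res (α n + y * Complex.I) (R ξ)‖ ≤
      α n * ((1 + M) * ‖(R (R ξ) : H)‖) := by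
    intro n
    rw [norm_smul, Complex.norm_real, Real.norm_of_nonneg (hα n).le]
    refine mul_le_mul_of_nonneg_left ?_ (hα n).le
    rw [key (R ξ) n]
    refine (norm_sub_le _ _).trans ?_
    rw [add_mul, one_mul, norm_smul, Complex.norm_real, Real.norm_of_nonneg (hα n).le]
    refine add_le_add_right ?_ _
    have h1 := mul_le_mul_of_nonneg_left (norm_res_le hM (hre n) (R (R ξ) : H)) (hα n).le
    refine h1.trans (le_of_eq ?_)
    have : ((α n : ℂ) + y * Complex.I).re = α n := by simp
    rw [this, ← mul_assoc, mul_div_cancel₀ _ (hα n).ne']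
  have h0 := squeeze_zero_norm hb (by simpa using hα0.mul_const ((1 + M) * ‖(R (R ξ) : H)‖))
  have h2 := h0.const_sub (R ξ : H)
  rw [sub_zero] at h2
  exact h2.congr fun n => (key ξ n).symm

/-- Plancherel's formula `‖Θ† ξ‖² = ∫ ‖C (2πiw + A)⁻¹ ξ‖² dw`. -/
theorem enorm_sq_obsAdj (hM : ∀ t, ‖S.op t‖ ≤ M) (hC : GraphBounded C) (h : Admissible C)
    {R : ℝ → H → S.A.domain} (hR : ∀ y ξ, S.shift y (R y ξ) = ξ) (ξ : H) :
    ‖obsAdj h ξ‖ₑ ^ 2 = ∫⁻ w : ℝ, ‖C (R (2 * Real.pi * w) ξ)‖ₑ ^ 2 := by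
  refine enorm_sq_eq_of_tendsto_laplace _ _ fun w => ?_
  set y : ℝ := 2 * Real.pi * w with hy
  have hα : ∀ n : ℕ, (0 : ℝ) < ((n : ℝ) + 1)⁻¹ := fun n => by positivity
  have hα0 : Tendsto (fun n : ℕ => ((n : ℝ) + 1)⁻¹) atTop (𝓝 0) := by
    simpa using tendsto_one_div_add_atTop_nhds_zero_nat (𝕜 := ℝ)
  have hre : ∀ n : ℕ, 0 < (((((n : ℝ) + 1)⁻¹ : ℝ) : ℂ) + (y : ℂ) * Complex.I).re := by
    intro n
    rw [Complex.add_re, Complex.ofReal_re, Complex.re_ofReal_mul, Complex.I_re, mul_zero, add_zero]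
    exact hα n
  have h1 := tendsto_res hM (hR y) ξ hα hα0
  have h2 : Tendsto (fun n : ℕ => outRes hM hC (ξ + (1 - ((((n : ℝ) + 1)⁻¹ : ℝ) + y * Complex.I)) •
      S.res ((((n : ℝ) + 1)⁻¹ : ℝ) + y * Complex.I) ξ)) atTop
      (𝓝 (outRes hM hC (ξ + (1 - ((0 : ℝ) + y * Complex.I)) • (R y ξ : H)))) := by
    refine ((outRes hM hC).continuous.tendsto _).comp (Tendsto.const_add _ (Tendsto.smul ?_ h1))
    refine Tendsto.const_sub _ (Tendsto.add_const _ ?_)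
    exact (Complex.continuous_ofReal.tendsto 0).comp hα0
  have h3 : outRes hM hC (ξ + (1 - ((0 : ℝ) + y * Complex.I)) • (R y ξ : H)) = C (R y ξ) := by
    rw [C_eq_outRes hM hC (R y ξ), (genRel_A (R y ξ)).unique (genRel_shift (hR y ξ))]
    congr 1
    push_cast
    module
  rw [h3] at h2
  refine h2.congr fun n => ?_
  rw [← laplace_obsAdj hM hC h (hre n)]
  simp only [hy]
  push_cast
  rfl

/-- If `C (iy + A)⁻¹` is Hilbert-Schmidt with square integrable norm, then so is the observability
operator, since by Plancherel's theorem `2π ‖Θ†‖² = ∫ ‖C (iy + A)⁻¹‖² dy` in Hilbert-Schmidt norm. -/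
theorem isHilbertSchmidt_obs (hM : ∀ t, ‖S.op t‖ ≤ M) (hC : GraphBounded C) (h : Admissible C)
    (hR : ResolventHilbertSchmidt C) : IsHilbertSchmidt (obs h) := by
  obtain ⟨R, hR1, -, hR3⟩ := hR
  refine IsHilbertSchmidt.adjoint (T := obsAdj h) ?_
  have h1 : hsNormSq (obsAdj h : H →ₗ[ℂ] L2 H₀) ≤
      ∫⁻ w : ℝ, hsNormSq (C ∘ₗ R (2 * Real.pi * w)) := by
    -- Finite sums suffice, so that the measurability of `‖C R(y) e‖` in `y` plays no role.
    rw [hsNormSq, ENNReal.tsum_eq_iSup_sum]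
    refine iSup_le fun s => ?_
    have h2 : ∀ s : Finset (OnbIndex H), ∑ i ∈ s, ‖obsAdj h (onb H i)‖ₑ ^ 2 ≤
        ∫⁻ w : ℝ, ∑ i ∈ s, ‖C (R (2 * Real.pi * w) (onb H i))‖ₑ ^ 2 := by
      classical
      intro s
      induction s using Finset.induction_on with
      | empty => simp
      | insert i s hi ih =>
        simp_rw [Finset.sum_insert hi]
        rw [enorm_sq_obsAdj hM hC h fun y => (hR1 y).2]
        exact (add_le_add_right ih _).trans (le_lintegral_add _ _)
    refine (h2 s).trans (lintegral_mono fun w => ?_)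
    exact ENNReal.sum_le_tsum (f := fun i => ‖C (R (2 * Real.pi * w) (onb H i))‖ₑ ^ 2) s
  refine h1.trans_lt ?_
  have h2 : ∫⁻ w : ℝ, hsNormSq (C ∘ₗ R (2 * Real.pi * w)) =
      ENNReal.ofReal |(2 * Real.pi)⁻¹| * ∫⁻ y, hsNormSq (C ∘ₗ R y) := by
    have hne : (2 * Real.pi) ≠ 0 := by positivity
    have := lintegral_map_equiv (μ := volume) (fun y => hsNormSq (C ∘ₗ R y))
      (Homeomorph.mulLeft₀ (2 * Real.pi) hne).toMeasurableEquiv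
    simp only [Homeomorph.toMeasurableEquiv_coe, Homeomorph.coe_mulLeft₀] at this
    rw [← this, Real.map_volume_mul_left hne, lintegral_smul_measure, smul_eq_mul]
  rw [h2]
  exact ENNReal.mul_lt_top ENNReal.ofReal_lt_top hR3

end C0Semigroup

namespace C0Semigroup

/-! ### Semigroups with self-adjoint generator -/

variable {H H₀ : Type*} [NormedAddCommGroup H] [InnerProductSpace ℂ H] [CompleteSpace H]
  [NormedAddCommGroup H₀] [InnerProductSpace ℂ H₀] [CompleteSpace H₀]
  {S : C0Semigroup H} {M : ℝ} {C : S.A.domain →ₗ[ℂ] H₀}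

section SelfAdjoint

theorem inner_A_symm (hM : ∀ t, ‖S.op t‖ ≤ M) (hA : IsSelfAdjoint S.A) (ξ η : S.A.domain) :
    ⟪S.A ξ, (η : H)⟫_ℂ = ⟪(ξ : H), S.A η⟫_ℂ := by
  have h := LinearPMap.adjoint_isFormalAdjoint (T := S.A) (dense_domain hM)
  rw [LinearPMap.isSelfAdjoint_def.mp hA] at h
  exact h ξ η

theorem tendsto_sub_nhdsGT (s : ℝ) : Tendsto (fun y : ℝ => y - s) (𝓝[>] s) (𝓝[>] 0) := by
  refine tendsto_nhdsWithin_iff.mpr ⟨?_, ?_⟩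
  · have : Tendsto (fun y : ℝ => y - s) (𝓝 s) (𝓝 (s - s)) := tendsto_id.sub_const s
    rw [sub_self] at this
    exact this.mono_left nhdsWithin_le_nhds
  · filter_upwards [self_mem_nhdsWithin] with y (hy : s < y)
    exact sub_pos.mpr hy

theorem hasDerivWithinAt_op {ξ η : H} (h : S.GenRel ξ η) {s : ℝ} (hs : 0 ≤ s) :
    HasDerivWithinAt (fun t : ℝ => S.op t.toNNReal ξ) (-S.op s.toNNReal η) (Ici s) s := by
  rw [← hasDerivWithinAt_Ioi_iff_Ici, hasDerivWithinAt_iff_tendsto_slope' self_notMem_Ioi]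
  have h1 := ((h.orbit s.toNNReal).comp (tendsto_sub_nhdsGT s)).neg
  refine h1.congr' ?_
  filter_upwards [self_mem_nhdsWithin] with y (hy : s < y)
  have hy' : y.toNNReal = (y - s).toNNReal + s.toNNReal := by
    rw [← Real.toNNReal_add (sub_nonneg.mpr hy.le) hs, sub_add_cancel]
  simp only [Function.comp_apply]
  rw [slope_def_module, hy', op_add_apply, ← smul_neg, neg_sub, ← Complex.ofReal_inv,
    Complex.coe_smul]

theorem hasDerivWithinAt_op_sub (hM : ∀ t, ‖S.op t‖ ≤ M) {ξ η : H} (h : S.GenRel ξ η) {s t : ℝ}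
    (hst : s < t) :
    HasDerivWithinAt (fun u : ℝ => S.op (t - u).toNNReal ξ) (S.op (t - s).toNNReal η)
      (Ici s) s := by
  rw [← hasDerivWithinAt_Ioi_iff_Ici, hasDerivWithinAt_iff_tendsto_slope' self_notMem_Ioi]
  have h0 : Tendsto (fun y : ℝ => (t - y).toNNReal) (𝓝[>] s) (𝓝 (t - s).toNNReal) :=
    (Continuous.tendsto (by fun_prop) s).mono_left nhdsWithin_le_nhds
  have h1 := ((continuous_op hM).tendsto ((t - s).toNNReal, η)).comp
    (h0.prodMk_nhds (h.comp (tendsto_sub_nhdsGT s)))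
  refine h1.congr' ?_
  have hlt : ∀ᶠ y in 𝓝[>] s, y < t := nhdsWithin_le_nhds (eventually_lt_nhds hst)
  filter_upwards [self_mem_nhdsWithin, hlt] with y (hy : s < y) hyt
  have hy' : (t - s).toNNReal = (t - y).toNNReal + (y - s).toNNReal := by
    rw [← Real.toNNReal_add (sub_nonneg.mpr hyt.le) (sub_nonneg.mpr hy.le)]
    congr 1
    ring
  rw [slope_def_module, hy', op_add_apply]
  simp only [Function.comp_apply, map_smul, map_sub]
  rw [← Complex.ofReal_inv, Complex.coe_smul]

/-- If `A` is self-adjoint, then so is `e^{-tA}`: for `ξ, η` in the domain of `A` the function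
`s ↦ ⟨e^{-sA} ξ, e^{-(t-s)A} η⟩` has vanishing derivative. -/
theorem inner_op_symm (hM : ∀ t, ‖S.op t‖ ≤ M) (hA : IsSelfAdjoint S.A) (t : ℝ≥0) (ξ η : H) :
    ⟪S.op t ξ, η⟫_ℂ = ⟪ξ, S.op t η⟫_ℂ := by
  have key : ∀ ξ η : S.A.domain, ⟪S.op t (ξ : H), (η : H)⟫_ℂ = ⟪(ξ : H), S.op t (η : H)⟫_ℂ := by
    intro ξ η
    have hcont : Continuous fun s : ℝ =>
        ⟪S.op s.toNNReal (ξ : H), S.op ((t : ℝ) - s).toNNReal (η : H)⟫_ℂ :=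
      (continuous_op_toNNReal hM _).inner
        ((continuous_op_toNNReal hM _).comp (continuous_const.sub continuous_id))
    have h := constant_of_has_deriv_right_zero (a := 0) (b := (t : ℝ)) hcont.continuousOn
      (fun s hs => ?_) t ⟨t.2, le_rfl⟩
    · simpa [op_zero_apply] using h
    · have h1 := (hasDerivWithinAt_op (genRel_A ξ) hs.1).inner ℂ
        (hasDerivWithinAt_op_sub hM (genRel_A η) hs.2)
      have h2 := inner_A_symm hM hA (S.onDomain s.toNNReal ξ)
        (S.onDomain ((t : ℝ) - s).toNNReal η)
      rw [A_onDomain, A_onDomain, coe_onDomain, coe_onDomain] at h2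
      rw [inner_neg_left, h2, add_neg_cancel] at h1
      exact h1
  have h1 : ∀ ξ : S.A.domain, ⟪S.op t (ξ : H), η⟫_ℂ = ⟪(ξ : H), S.op t η⟫_ℂ := fun ξ =>
    congrFun ((denseRange_subtype hM).equalizer
      (g := fun η => ⟪S.op t (ξ : H), η⟫_ℂ) (h := fun η => ⟪(ξ : H), S.op t η⟫_ℂ)
      (by fun_prop) (by fun_prop) (funext fun η => key ξ η)) η
  exact congrFun ((denseRange_subtype hM).equalizer
      (g := fun ξ => ⟪S.op t ξ, η⟫_ℂ) (h := fun ξ => ⟪ξ, S.op t η⟫_ℂ)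
      (by fun_prop) (by fun_prop) (funext fun ξ => h1 ξ)) ξ

theorem adjoint_op (hM : ∀ t, ‖S.op t‖ ≤ M) (hA : IsSelfAdjoint S.A) (t : ℝ≥0) :
    (S.op t).adjoint = S.op t :=
  ((ContinuousLinearMap.eq_adjoint_iff _ _).mpr fun ξ η => inner_op_symm hM hA t ξ η).symm

theorem isPositive_op (hM : ∀ t, ‖S.op t‖ ≤ M) (hA : IsSelfAdjoint S.A) (t : ℝ≥0) :
    (S.op t).IsPositive := by
  have h := ContinuousLinearMap.isPositive_adjoint_comp_self (S.op (t / 2))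
  rw [adjoint_op hM hA] at h
  have h2 : S.op t = S.op (t / 2) ∘L S.op (t / 2) := by
    conv_lhs => rw [← add_halves t, S.op_add]
    rfl
  rw [h2]
  exact h

/-- A bounded semigroup of self-adjoint operators consists of contractions. -/
theorem norm_op_le_one (hM : ∀ t, ‖S.op t‖ ≤ M) (hA : IsSelfAdjoint S.A) (t : ℝ≥0) :
    ‖S.op t‖ ≤ 1 := by
  -- `‖e^{-tA}‖^k = ‖e^{-ktA}‖ ≤ M` for `k = 2ⁿ`, by the C*-identity.
  have h1 : ∀ n : ℕ, ‖S.op t‖ ^ 2 ^ n ≤ ‖S.op (2 ^ n * t)‖ := by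
    intro n
    induction n with
    | zero => simp
    | succ n ih =>
      have h2 : S.op (2 ^ (n + 1) * t) = star (S.op (2 ^ n * t)) * S.op (2 ^ n * t) := by
        rw [ContinuousLinearMap.star_eq_adjoint, adjoint_op hM hA, ← S.op_add]
        congr 1
        ring
      rw [h2, CStarRing.norm_star_mul_self, pow_succ, mul_two, pow_add]
      exact mul_le_mul ih ih (by positivity) (norm_nonneg _)
  by_contra! hlt
  obtain ⟨n, hn⟩ := pow_unbounded_of_one_lt M hlt
  have h3 : ‖S.op t‖ ^ n ≤ ‖S.op t‖ ^ 2 ^ n := pow_le_pow_right₀ hlt.le n.lt_two_pow_self.le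
  linarith [h1 n, hM (2 ^ n * t)]

theorem op_nsmul (t : ℝ≥0) (n : ℕ) : S.op (n * t) = S.op t ^ n := by
  induction n with
  | zero => simp [S.op_zero]
  | succ n ih => rw [Nat.cast_succ, add_mul, one_mul, S.op_add, ih, pow_succ]

/-- `‖(1 - E) Eⁿ‖ ≤ 1 / (n + 1)` for `0 ≤ E ≤ 1`, since `(n + 1) (1 - x) xⁿ ≤ 1` on `[0, 1]`. -/
theorem norm_one_sub_mul_pow_le {E : H →L[ℂ] H} (h0 : E.IsPositive) (h1 : ‖E‖ ≤ 1) (n : ℕ) :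
    ‖(1 - E) * E ^ n‖ ≤ ((n : ℝ) + 1)⁻¹ := by
  have hsa : IsSelfAdjoint E := h0.isSelfAdjoint
  have hnn : 0 ≤ E := (ContinuousLinearMap.nonneg_iff_isPositive _).mpr h0
  have hcfc : (1 - E) * E ^ n = cfc (fun x : ℝ => (1 - x) * x ^ n) E := by
    rw [cfc_mul (fun x : ℝ => 1 - x) (fun x => x ^ n) E, cfc_sub (fun _ : ℝ => 1) (fun x => x) E,
      cfc_pow_id (R := ℝ) E n, cfc_const_one ℝ E, cfc_id' ℝ E]
  rw [hcfc]
  refine norm_cfc_le (by positivity) fun x hx => ?_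
  have hx0 : 0 ≤ x := spectrum_nonneg_of_nonneg hnn hx
  have hx1 : x ≤ 1 := by
    have h2 := spectrum.norm_le_norm_mul_of_mem hx
    have h3 : ‖(1 : H →L[ℂ] H)‖ ≤ 1 := ContinuousLinearMap.norm_id_le
    have h4 : ‖E‖ * ‖(1 : H →L[ℂ] H)‖ ≤ 1 := mul_le_one₀ h1 (norm_nonneg _) h3
    exact (le_abs_self x).trans (h2.trans h4)
  rw [Real.norm_of_nonneg (mul_nonneg (sub_nonneg.mpr hx1) (by positivity)), ← one_div,
    le_div_iff₀ (by positivity)]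
  have h2 : (∑ i ∈ Finset.range (n + 1), x ^ i) * (1 - x) = 1 - x ^ (n + 1) :=
    geom_sum_mul_neg x (n + 1)
  have h3 : ((n : ℝ) + 1) * x ^ n ≤ ∑ i ∈ Finset.range (n + 1), x ^ i := by
    have := Finset.card_nsmul_le_sum (Finset.range (n + 1)) (fun i => x ^ i) (x ^ n)
      fun i hi => pow_le_pow_of_le_one hx0 hx1 (Nat.lt_succ_iff.mp (Finset.mem_range.mp hi))
    simpa using this
  nlinarith [mul_le_mul_of_nonneg_right h3 (sub_nonneg.mpr hx1), pow_nonneg hx0 (n + 1)]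

/-- The smoothing estimate `‖A e^{-tA} ξ‖ ≤ ‖ξ‖ / t`: with `τ = t / (n + 1)` and `E = e^{-τA}`, the
difference quotient of the orbit is `τ⁻¹ (1 - E) E^{n+1} ξ`. -/
theorem norm_op_A_le (hM : ∀ t, ‖S.op t‖ ≤ M) (hA : IsSelfAdjoint S.A) {t : ℝ≥0} (ht : 0 < t)
    (ξ : S.A.domain) : ‖S.op t (S.A ξ)‖ ≤ (t : ℝ)⁻¹ * ‖(ξ : H)‖ := by
  have h1 := (genRel_A ξ).orbit t
  let τ : ℕ → ℝ := fun n => (t : ℝ) / ((n : ℝ) + 1)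
  have ht' : (0 : ℝ) < t := ht
  have hτ : ∀ n, 0 < τ n := fun n => by positivity
  have hτ0 : Tendsto τ atTop (𝓝[>] 0) := by
    refine tendsto_nhdsWithin_iff.mpr ⟨?_, .of_forall hτ⟩
    have := (tendsto_one_div_add_atTop_nhds_zero_nat (𝕜 := ℝ)).const_mul (t : ℝ)
    simpa [τ, div_eq_mul_inv] using this
  refine le_of_tendsto (h1.comp hτ0).norm (.of_forall fun n => ?_)
  set E := S.op (τ n).toNNReal with hE
  have hEt : S.op t = E ^ (n + 1) := by
    rw [hE, ← op_nsmul]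
    congr 1
    refine NNReal.coe_injective ?_
    rw [NNReal.coe_mul, Real.coe_toNNReal _ (hτ n).le, NNReal.coe_natCast]
    simp only [τ]
    push_cast
    field_simp
  have h2 : S.op t ξ - E (S.op t ξ) = ((1 - E) * E ^ (n + 1)) (ξ : H) := by
    rw [hEt]
    rfl
  simp only [Function.comp_apply]
  rw [← hE, h2, norm_smul, norm_inv, Complex.norm_real, Real.norm_of_nonneg (hτ n).le]
  have h3 := norm_one_sub_mul_pow_le (isPositive_op hM hA (τ n).toNNReal)
    (norm_op_le_one hM hA _) (n + 1)
  have h4 := ((1 - E) * E ^ (n + 1)).le_of_opNorm_le h3 (ξ : H)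
  refine (mul_le_mul_of_nonneg_left h4 (inv_nonneg.mpr (hτ n).le)).trans ?_
  rw [← mul_assoc]
  refine mul_le_mul_of_nonneg_right ?_ (norm_nonneg _)
  simp only [τ]
  push_cast
  rw [inv_div, ← one_div, ← one_div, div_mul_div_comm, mul_one]
  rw [div_le_div_iff₀ (by positivity) ht']
  nlinarith

/-- The operator `C e^{-tA}` is bounded for `t > 0`. -/
theorem norm_output_le (hM : ∀ t, ‖S.op t‖ ≤ M) (hA : IsSelfAdjoint S.A) (hC : GraphBounded C)
    {t : ℝ} (ht : 0 < t) (ξ : S.A.domain) :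
    ‖(C ∘ₗ S.onDomain t.toNNReal) ξ‖ ≤
      ‖outRes hM hC‖ * (1 + t⁻¹) * ‖S.A.domain.subtype ξ‖ := by
  have h1 : (C ∘ₗ S.onDomain t.toNNReal) ξ = output C ξ t := rfl
  rw [h1, output_eq hM hC, mul_assoc]
  refine (outRes hM hC).le_opNorm_of_le ?_
  rw [map_add]
  refine (norm_add_le _ _).trans ?_
  rw [add_mul]
  refine add_le_add ((S.op _).le_of_opNorm_le (norm_op_le_one hM hA _) _) ?_
  have h2 := norm_op_A_le hM hA (Real.toNNReal_pos.mpr ht) ξ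
  rwa [Real.coe_toNNReal _ ht.le] at h2

theorem outputAt_apply (hM : ∀ t, ‖S.op t‖ ≤ M) (hA : IsSelfAdjoint S.A) (hC : GraphBounded C)
    {t : ℝ} (ht : 0 < t) (ξ : S.A.domain) : outputAt C t (ξ : H) = output C ξ t :=
  LinearMap.extendOfNorm_eq (denseRange_subtype hM) ⟨_, norm_output_le hM hA hC ht⟩ ξ

theorem outputAt_add (hM : ∀ t, ‖S.op t‖ ≤ M) (hA : IsSelfAdjoint S.A) (hC : GraphBounded C)
    {s t : ℝ} (hs : 0 < s) (ht : 0 ≤ t) : outputAt C (s + t) = outputAt C s ∘L S.op t.toNNReal := by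
  refine ContinuousLinearMap.ext fun ξ => congrFun ((denseRange_subtype hM).equalizer
      (g := outputAt C (s + t)) (h := outputAt C s ∘L S.op t.toNNReal)
      (outputAt C (s + t)).continuous (outputAt C s ∘L S.op t.toNNReal).continuous
      (funext fun ξ => ?_)) ξ
  simp only [Function.comp_apply, Submodule.coe_subtype, ContinuousLinearMap.comp_apply]
  rw [outputAt_apply hM hA hC (by linarith), ← coe_onDomain, outputAt_apply hM hA hC hs, output,
    output]
  congr 1
  refine Subtype.ext ?_
  rw [coe_onDomain, coe_onDomain, coe_onDomain, ← op_add_apply, Real.toNNReal_add hs.le ht]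

/-- `Θ† ξ (s) = C e^{-sA} ξ` for all `ξ` and almost every `s > 0`. -/
theorem coeFn_obsAdj_eq (hM : ∀ t, ‖S.op t‖ ≤ M) (hA : IsSelfAdjoint S.A) (hC : GraphBounded C)
    (h : Admissible C) (ξ : H) : obsAdj h ξ =ᵐ[halfLine] fun s => outputAt C s ξ := by
  obtain ⟨ξs, hξs, hlim⟩ := mem_closure_iff_seq_limit.mp (dense_domain hM ξ)
  have h1 := ((obsAdj h).continuous.tendsto ξ).comp hlim
  obtain ⟨ns, hns, hae⟩ := (tendstoInMeasure_of_tendsto_Lp h1).exists_seq_tendsto_ae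
  have h2 : ∀ᵐ s ∂halfLine, ∀ n, obsAdj h (ξs n) s = output C ⟨ξs n, hξs n⟩ s :=
    ae_all_iff.mpr fun n => coeFn_obsAdj hM h ⟨ξs n, hξs n⟩
  filter_upwards [hae, h2, ae_restrict_mem measurableSet_Ioi] with s e1 e2 hs
  refine tendsto_nhds_unique e1 ?_
  have h3 := (((outputAt C s).continuous.tendsto ξ).comp hlim).comp hns.tendsto_atTop
  refine h3.congr fun n => ?_
  simp only [Function.comp_apply]
  rw [e2, ← outputAt_apply hM hA hC hs]

end SelfAdjoint

end C0Semigroup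

/-! ### The kernel of the Hankel operator and the trace of the Gramian -/

/-- Basis vectors have distance `√2`, so that the balls of radius `1 / 2` about them are disjoint. -/
theorem countable_onbIndex (E : Type*) [NormedAddCommGroup E] [InnerProductSpace ℂ E]
    [CompleteSpace E] [TopologicalSpace.SeparableSpace E] : Countable (OnbIndex E) := by
  refine Pairwise.countable_of_isOpen_disjoint (s := fun i => Metric.ball (onb E i) (1 / 2))
    (fun i j hij => Metric.ball_disjoint_ball ?_) (fun i => Metric.isOpen_ball)
    fun i => ⟨_, Metric.mem_ball_self (by norm_num)⟩
  have h1 : ‖onb E i - onb E j‖ ^ 2 = 2 := by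
    rw [norm_sub_sq (𝕜 := ℂ), (onb E).orthonormal.1 i, (onb E).orthonormal.1 j,
      (onb E).orthonormal.2 hij]
    norm_num
  rw [dist_eq_norm]
  nlinarith [norm_nonneg (onb E i - onb E j)]

theorem enorm_sq_le_hsNormSq {E F : Type*} [NormedAddCommGroup E] [InnerProductSpace ℂ E]
    [CompleteSpace E] [NormedAddCommGroup F] [InnerProductSpace ℂ F] [CompleteSpace F]
    (T : E →L[ℂ] F) : ‖T‖ₑ ^ 2 ≤ hsNormSq (T : E →ₗ[ℂ] F) := by
  by_cases hT : hsNormSq (T : E →ₗ[ℂ] F) = ∞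
  · rw [hT]; exact le_top
  · have h := norm_sq_le_hsNormSq (T := T) (lt_top_iff_ne_top.mpr hT)
    rw [← ofReal_norm, ← ENNReal.ofReal_pow (norm_nonneg _)]
    exact ENNReal.ofReal_le_of_le_toReal h

namespace C0Semigroup

variable {H H₀ : Type*} [NormedAddCommGroup H] [InnerProductSpace ℂ H] [CompleteSpace H]
  [NormedAddCommGroup H₀] [InnerProductSpace ℂ H₀] [CompleteSpace H₀]
  {S : C0Semigroup H} {M : ℝ} {C : S.A.domain →ₗ[ℂ] H₀}

theorem adjoint_outputAt_add (hM : ∀ t, ‖S.op t‖ ≤ M) (hA : IsSelfAdjoint S.A)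
    (hC : GraphBounded C) {s t : ℝ} (hs : 0 < s) (ht : 0 ≤ t) :
    (outputAt C (s + t)).adjoint = S.op t.toNNReal ∘L (outputAt C s).adjoint := by
  rw [outputAt_add hM hA hC hs ht, ContinuousLinearMap.adjoint_comp, adjoint_op hM hA]

theorem outputAt_comp_adjoint (hM : ∀ t, ‖S.op t‖ ≤ M) (hA : IsSelfAdjoint S.A)
    (hC : GraphBounded C) {a u v : ℝ} (ha : 0 < a) (hu : 0 ≤ u) (hv : 0 ≤ v) :
    outputAt C (a + u) ∘L (outputAt C (a + v)).adjoint =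
      outputAt C a ∘L S.op (u + v).toNNReal ∘L (outputAt C a).adjoint := by
  rw [adjoint_outputAt_add hM hA hC ha hv, outputAt_add hM hA hC ha hu, Real.toNNReal_add hu hv,
    S.op_add]
  rfl

theorem phi_add (hM : ∀ t, ‖S.op t‖ ≤ M) (hA : IsSelfAdjoint S.A) (hC : GraphBounded C)
    {s t : ℝ} (hs : 0 < s) (ht : 0 ≤ t) :
    phi C (s + t) = outputAt C (s / 2) ∘L S.op t.toNNReal ∘L (outputAt C (s / 2)).adjoint := by
  have ht2 : 0 ≤ t / 2 := div_nonneg ht zero_le_two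
  have h := outputAt_comp_adjoint hM hA hC (half_pos hs) ht2 ht2
  rw [← add_div, add_halves] at h
  exact h

/-- `φ(s + t) = C e^{-sA} (C e^{-tA})†`. -/
theorem phi_add_eq (hM : ∀ t, ‖S.op t‖ ≤ M) (hA : IsSelfAdjoint S.A) (hC : GraphBounded C)
    {s t : ℝ} (hs : 0 < s) (ht : 0 < t) :
    phi C (s + t) = outputAt C s ∘L (outputAt C t).adjoint := by
  have ha : 0 < min s t := lt_min hs ht
  have h1 := outputAt_comp_adjoint hM hA hC ha (sub_nonneg.mpr (min_le_left s t))
    (sub_nonneg.mpr (min_le_right s t))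
  have h2 : 0 ≤ (s - min s t + (t - min s t)) / 2 :=
    div_nonneg (add_nonneg (sub_nonneg.mpr (min_le_left s t))
      (sub_nonneg.mpr (min_le_right s t))) zero_le_two
  have h3 := outputAt_comp_adjoint hM hA hC ha h2 h2
  have e1 : min s t + (s - min s t) = s := by ring
  have e2 : min s t + (t - min s t) = t := by ring
  have e3 : min s t + (s - min s t + (t - min s t)) / 2 = (s + t) / 2 := by ring
  rw [e1, e2] at h1
  rw [e3, add_halves] at h3
  rw [phi, h1, h3]

theorem enorm_sq_tailObs (h : Admissible C) (x : ℝ) (ξ : H) :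
    ‖tailObs h x ξ‖ₑ ^ 2 = ∫⁻ s in Ioi x, ‖obsAdj h ξ s‖ₑ ^ 2 ∂halfLine := by
  rw [enorm_sq_eq_lintegral, ← lintegral_indicator (μ := halfLine) (s := Ioi x) measurableSet_Ioi]
  refine lintegral_congr_ae ?_
  filter_upwards [coeFn_projLin x (obsAdj h ξ)] with s hs
  change ‖projLin x (obsAdj h ξ) s‖ₑ ^ 2 = _
  rw [hs]
  by_cases hx : s ∈ Ioi x <;> simp [hx]

/-- The Hilbert-Schmidt norm of `P_{(x,∞)} Θ†` is the integral of that of `C e^{-sA}`. -/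
theorem hsNormSq_tailObs [TopologicalSpace.SeparableSpace H] (hM : ∀ t, ‖S.op t‖ ≤ M)
    (hA : IsSelfAdjoint S.A) (hC : GraphBounded C) (h : Admissible C) (x : ℝ) :
    hsNormSq (tailObs h x : H →ₗ[ℂ] L2 H₀) =
      ∫⁻ s in Ioi x, hsNormSq (outputAt C s : H →ₗ[ℂ] H₀) ∂halfLine := by
  have := countable_onbIndex H
  have h1 : ∀ i, ∀ᵐ s ∂(halfLine.restrict (Ioi x)),
      ‖obsAdj h (onb H i) s‖ₑ ^ 2 = ‖outputAt C s (onb H i)‖ₑ ^ 2 := by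
    intro i
    filter_upwards [ae_restrict_of_ae (coeFn_obsAdj_eq hM hA hC h (onb H i))] with s hs
    rw [hs]
  have h2 : ∀ i, ‖tailObs h x (onb H i)‖ₑ ^ 2 =
      ∫⁻ s in Ioi x, ‖outputAt C s (onb H i)‖ₑ ^ 2 ∂halfLine := fun i => by
    rw [enorm_sq_tailObs, lintegral_congr_ae (h1 i)]
  have h3 : ∑' i, ‖tailObs h x (onb H i)‖ₑ ^ 2 =
      ∑' i, ∫⁻ s in Ioi x, ‖outputAt C s (onb H i)‖ₑ ^ 2 ∂halfLine := tsum_congr h2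
  refine h3.trans ?_
  rw [← lintegral_tsum fun i => ?_]
  · rfl
  · exact ((Lp.aestronglyMeasurable (obsAdj h (onb H i))).restrict.enorm.pow_const 2).congr (h1 i)

variable [TopologicalSpace.SeparableSpace H]

theorem lintegral_hsNormSq_outputAt_lt_top (hM : ∀ t, ‖S.op t‖ ≤ M) (hA : IsSelfAdjoint S.A)
    (hC : GraphBounded C) (h : Admissible C) (hΘ : IsHilbertSchmidt (obs h)) :
    ∫⁻ s, hsNormSq (outputAt C s : H →ₗ[ℂ] H₀) ∂halfLine < ∞ := by
  have h1 := hsNormSq_tailObs hM hA hC h 0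
  rw [Measure.restrict_restrict_of_subset subset_rfl] at h1
  rw [← h1]
  exact isHilbertSchmidt_tailObs hΘ 0

/-- `C e^{-xA}` is Hilbert-Schmidt for every `x > 0`: its Hilbert-Schmidt norm is integrable and
decreasing. -/
theorem isHilbertSchmidt_outputAt (hM : ∀ t, ‖S.op t‖ ≤ M) (hA : IsSelfAdjoint S.A)
    (hC : GraphBounded C) (h : Admissible C) (hΘ : IsHilbertSchmidt (obs h)) {x : ℝ}
    (hx : 0 < x) : IsHilbertSchmidt (outputAt C x) := by
  by_contra hn
  have h0 : hsNormSq (outputAt C x : H →ₗ[ℂ] H₀) = ∞ := not_lt_top_iff.mp hn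
  have h1 : ∀ s ∈ Ioo 0 x, hsNormSq (outputAt C s : H →ₗ[ℂ] H₀) = ∞ := by
    intro s hs
    by_contra hs'
    have e : s + (x - s) = x := by ring
    have h2 := outputAt_add hM hA hC hs.1 (sub_nonneg.mpr hs.2.le)
    rw [e] at h2
    refine hn ?_
    rw [h2]
    exact IsHilbertSchmidt.comp_right (lt_top_iff_ne_top.mpr hs')
  have h2 := lintegral_hsNormSq_outputAt_lt_top hM hA hC h hΘ
  have h3 : ∫⁻ s in Ioo 0 x, hsNormSq (outputAt C s : H →ₗ[ℂ] H₀) ≤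
      ∫⁻ s, hsNormSq (outputAt C s : H →ₗ[ℂ] H₀) ∂halfLine :=
    lintegral_mono_set Ioo_subset_Ioi_self
  rw [setLIntegral_congr_fun measurableSet_Ioo h1, setLIntegral_const, Real.volume_Ioo,
    ENNReal.top_mul (by simpa using hx)] at h3
  exact absurd h2 (not_lt.mpr h3)

/-- For self-adjoint `A` the operator `Θ†Θ` is the Hankel operator with kernel `φ`. The integral
converges absolutely since `‖φ(s + t) f(t)‖ ≤ ‖C e^{-sA}‖ ‖C e^{-tA}‖ ‖f(t)‖`, and `‖C e^{-tA}‖` is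
square integrable by the Hilbert-Schmidt property. -/
theorem isHankelOperator_phi (hM : ∀ t, ‖S.op t‖ ≤ M) (hA : IsSelfAdjoint S.A)
    (hC : GraphBounded C) (h : Admissible C) (hΘ : IsHilbertSchmidt (obs h)) :
    IsHankelOperator (phi C) ((obs h).adjoint ∘L obs h) := by
  intro f
  have h1 := coeFn_obsAdj_eq hM hA hC h (obs h f)
  filter_upwards [h1, ae_restrict_mem measurableSet_Ioi] with s hs (hs0 : 0 < s)
  have hmeas : AEStronglyMeasurable (fun t => phi C (s + t) (f t)) halfLine := by
    have h2 : AEStronglyMeasurable (fun t : ℝ =>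
        outputAt C (s / 2) (S.op t.toNNReal ((outputAt C (s / 2)).adjoint (f t)))) halfLine := by
      refine (outputAt C (s / 2)).continuous.comp_aestronglyMeasurable ?_
      refine (continuous_op hM).comp_aestronglyMeasurable (AEStronglyMeasurable.prodMk
        continuous_real_toNNReal.aestronglyMeasurable ?_)
      exact ((outputAt C (s / 2)).adjoint).continuous.comp_aestronglyMeasurable
        (Lp.aestronglyMeasurable f)
    refine h2.congr ?_
    filter_upwards [ae_restrict_mem measurableSet_Ioi] with t (ht : 0 < t)
    rw [phi_add hM hA hC hs0 ht.le]
    rfl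
  have hint : Integrable (fun t => phi C (s + t) (f t)) halfLine := by
    refine ⟨hmeas, ?_⟩
    -- The Hilbert-Schmidt norm of `C e^{-tA}` serves as a majorant of its operator norm, and only
    -- the other summand has to be measurable.
    have h3 : ∀ᵐ t ∂halfLine, ‖phi C (s + t) (f t)‖ₑ ≤ ‖outputAt C s‖ₑ *
        (hsNormSq (outputAt C t : H →ₗ[ℂ] H₀) + ‖f t‖ₑ ^ 2) := by
      filter_upwards [ae_restrict_mem measurableSet_Ioi] with t (ht : 0 < t)
      rw [phi_add_eq hM hA hC hs0 ht, ContinuousLinearMap.comp_apply]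
      refine (enorm_apply_le _ _).trans (mul_le_mul_right ?_ _)
      refine (enorm_apply_le _ _).trans ?_
      have e1 : ‖(outputAt C t).adjoint‖ₑ = ‖outputAt C t‖ₑ := by
        rw [← ofReal_norm, ← ofReal_norm, LinearIsometryEquiv.norm_map]
      rw [e1]
      refine le_trans ?_ (add_le_add_left (enorm_sq_le_hsNormSq (outputAt C t)) _)
      rcases le_total ‖outputAt C t‖ₑ ‖f t‖ₑ with hle | hle
      · exact (mul_le_mul_left hle _).trans (by rw [← sq]; exact le_add_self)
      · exact (mul_le_mul_right hle _).trans (by rw [← sq]; exact le_self_add)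
    refine (lintegral_mono_ae h3).trans_lt ?_
    rw [lintegral_const_mul' _ _ (by simp),
      lintegral_add_right' _ ((Lp.aestronglyMeasurable f).enorm.pow_const 2),
      ← enorm_sq_eq_lintegral]
    exact ENNReal.mul_lt_top (by simp)
      (ENNReal.add_lt_top.mpr ⟨lintegral_hsNormSq_outputAt_lt_top hM hA hC h hΘ, by simp⟩)
  refine ⟨hint, ?_⟩
  have h4 : ((obs h).adjoint ∘L obs h) f = obsAdj h (obs h f) := by
    rw [ContinuousLinearMap.comp_apply, obs, ContinuousLinearMap.adjoint_adjoint]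
  rw [h4, hs]
  refine ext_inner_left ℂ fun v => ?_
  rw [← integral_inner hint, ← ContinuousLinearMap.adjoint_inner_left, obs,
    ContinuousLinearMap.adjoint_inner_right, L2.inner_def]
  refine integral_congr_ae ?_
  filter_upwards [coeFn_obsAdj_eq hM hA hC h ((outputAt C s).adjoint v),
    ae_restrict_mem measurableSet_Ioi] with t ht (ht0 : 0 < t)
  rw [ht, phi_add_eq hM hA hC hs0 ht0, ContinuousLinearMap.comp_apply,
    ← ContinuousLinearMap.adjoint_inner_left, ← ContinuousLinearMap.adjoint_inner_right]

theorem phi_two_mul (x : ℝ) :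
    phi C (2 * x) = (outputAt C x).adjoint.adjoint ∘L (outputAt C x).adjoint := by
  rw [phi, ContinuousLinearMap.adjoint_adjoint, mul_div_cancel_left₀ x two_ne_zero]

theorem trace_phi_two_mul (x : ℝ) :
    trace (phi C (2 * x)) = ((hsNormSq (outputAt C x : H →ₗ[ℂ] H₀)).toReal : ℂ) := by
  rw [phi_two_mul, trace_adjoint_comp_self, hsNormSq_adjoint]

/-- For `s ≥ a` the Hilbert-Schmidt norm is that of `e^{-(s-a)A} (C e^{-aA})†`, a series with the
summable majorant given by `(C e^{-aA})†`, as the semigroup is contractive. -/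
theorem continuousOn_hsNormSq_outputAt (hM : ∀ t, ‖S.op t‖ ≤ M) (hA : IsSelfAdjoint S.A)
    (hC : GraphBounded C) (h : Admissible C) (hΘ : IsHilbertSchmidt (obs h)) {a : ℝ}
    (ha : 0 < a) :
    ContinuousOn (fun s => (hsNormSq (outputAt C s : H →ₗ[ℂ] H₀)).toReal) (Ici a) := by
  have h1 : Continuous fun s : ℝ =>
      ∑' i, ‖S.op (s - a).toNNReal ((outputAt C a).adjoint (onb H₀ i))‖ ^ 2 := by
    refine continuous_tsum (u := fun i => ‖(outputAt C a).adjoint (onb H₀ i)‖ ^ 2)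
      (fun i => ?_) ((isHilbertSchmidt_outputAt hM hA hC h hΘ ha).adjoint.summable _) fun i s => ?_
    · exact (((continuous_op_toNNReal hM _).comp (continuous_sub_right a)).norm).pow 2
    · rw [norm_pow, norm_norm]
      refine pow_le_pow_left₀ (norm_nonneg _) ?_ 2
      simpa using (S.op (s - a).toNNReal).le_of_opNorm_le (norm_op_le_one hM hA _)
        ((outputAt C a).adjoint (onb H₀ i))
  refine h1.continuousOn.congr fun s hs => ?_
  have e : a + (s - a) = s := by ring
  have h2 := adjoint_outputAt_add hM hA hC ha (sub_nonneg.mpr hs)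
  rw [e] at h2
  simp only
  rw [← hsNormSq_adjoint, hsNormSq_toReal (onb H₀), h2]
  rfl

/-- `d/dx trace Q_x = - trace φ(2x)`. -/
theorem hasDerivAt_trace_gramian (hM : ∀ t, ‖S.op t‖ ≤ M) (hA : IsSelfAdjoint S.A)
    (hC : GraphBounded C) (h : Admissible C) (hΘ : IsHilbertSchmidt (obs h)) {x : ℝ}
    (hx : 0 < x) :
    HasDerivAt (fun u : ℝ => trace (gramian h u)) (-trace (phi C (2 * x))) x := by
  set k : ℝ → ℝ := fun s => (hsNormSq (outputAt C s : H →ₗ[ℂ] H₀)).toReal with hk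
  have ha : 0 < x / 2 := half_pos hx
  have hkc : ContinuousOn k (Ici (x / 2)) := continuousOn_hsNormSq_outputAt hM hA hC h hΘ ha
  have hkm : AEStronglyMeasurable k (volume.restrict (Ioi (x / 2))) :=
    (hkc.mono Ioi_subset_Ici_self).aestronglyMeasurable measurableSet_Ioi
  have hfin : ∀ s ∈ Ioi (x / 2), ENNReal.ofReal (k s) = hsNormSq (outputAt C s : H →ₗ[ℂ] H₀) :=
    fun s hs => ENNReal.ofReal_toReal
      (isHilbertSchmidt_outputAt hM hA hC h hΘ (ha.trans hs)).ne
  have hki : IntegrableOn k (Ioi (x / 2)) := by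
    refine ⟨hkm, ?_⟩
    rw [hasFiniteIntegral_iff_ofReal (.of_forall fun s => ENNReal.toReal_nonneg),
      setLIntegral_congr_fun measurableSet_Ioi hfin]
    exact (lintegral_mono_set (Ioi_subset_Ioi ha.le)).trans_lt
      (lintegral_hsNormSq_outputAt_lt_top hM hA hC h hΘ)
  have htr : ∀ u ∈ Ioi (x / 2), trace (gramian h u) =
      ((∫ s in Ioi (x / 2), k s) - ∫ s in (x / 2)..u, k s : ℝ) := by
    intro u hu
    have hu' : x / 2 < u := hu
    rw [gramian_eq, trace_adjoint_comp_self, hsNormSq_tailObs hM hA hC h,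
      Measure.restrict_restrict_of_subset (Ioi_subset_Ioi (ha.trans hu').le)]
    congr 1
    have e1 := intervalIntegral.integral_interval_add_Ioi hki
      (hki.mono_set (Ioi_subset_Ioi hu'.le))
    rw [eq_sub_iff_add_eq', ← e1]
    congr 1
    rw [integral_eq_lintegral_of_nonneg_ae (.of_forall fun s => ENNReal.toReal_nonneg)
      (hkm.mono_set (Ioi_subset_Ioi hu'.le)), setLIntegral_congr_fun measurableSet_Ioi
        fun s hs => hfin s (hu'.trans hs)]
  have hd : HasDerivAt (fun u => (∫ s in Ioi (x / 2), k s) - ∫ s in (x / 2)..u, k s) (-k x) x := by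
    refine HasDerivAt.const_sub _ (intervalIntegral.integral_hasDerivAt_right ?_ ?_ ?_)
    · refine (hkc.mono ?_).intervalIntegrable
      rw [uIcc_of_le (by linarith)]
      exact Icc_subset_Ici_self
    · exact (hkc.mono Ioi_subset_Ici_self).stronglyMeasurableAtFilter isOpen_Ioi x
        (by simpa using hx)
    · exact hkc.continuousAt (Ici_mem_nhds (by linarith))
  rw [trace_phi_two_mul]
  have hd' := hd.ofReal_comp
  rw [Complex.ofReal_neg] at hd'
  refine hd'.congr_of_eventuallyEq ?_
  filter_upwards [Ioi_mem_nhds (show x / 2 < x by linarith)] with u hu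
  exact htr u hu

end C0Semigroup

/-! ### Counting eigenvalues -/

section Counting

variable {E : Type*} [NormedAddCommGroup E] [InnerProductSpace ℂ E] [CompleteSpace E]
  {ι κ : Type*}

theorem inner_eigenbasis_apply {A : E →L[ℂ] E} (hA : IsSelfAdjoint A) {b : HilbertBasis ι ℂ E}
    {μ : ι → ℝ} (hb : ∀ i, A (b i) = (μ i : ℂ) • b i) (i : ι) (w : E) :
    ⟪b i, A w⟫_ℂ = μ i * ⟪b i, w⟫_ℂ := by
  rw [← ContinuousLinearMap.adjoint_inner_left, ← ContinuousLinearMap.star_eq_adjoint,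
    hA.star_eq, hb, inner_smul_left, Complex.conj_ofReal]

theorem hasSum_norm_sq_eigenbasis {A : E →L[ℂ] E} (hA : IsSelfAdjoint A)
    {b : HilbertBasis ι ℂ E} {μ : ι → ℝ} (hb : ∀ i, A (b i) = (μ i : ℂ) • b i) (w : E) :
    HasSum (fun i => μ i ^ 2 * ‖⟪b i, w⟫_ℂ‖ ^ 2) (‖A w‖ ^ 2) := by
  refine (hasSum_norm_inner_sq b (A w)).congr_fun fun i => ?_
  rw [inner_eigenbasis_apply hA hb, norm_mul, mul_pow, Complex.norm_real, Real.norm_eq_abs, sq_abs]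

theorem hasSum_re_inner_eigenbasis {A : E →L[ℂ] E} (hA : IsSelfAdjoint A)
    {b : HilbertBasis ι ℂ E} {μ : ι → ℝ} (hb : ∀ i, A (b i) = (μ i : ℂ) • b i) (w : E) :
    HasSum (fun i => μ i * ‖⟪b i, w⟫_ℂ‖ ^ 2) (⟪w, A w⟫_ℂ).re := by
  have h := Complex.reCLM.hasSum (b.hasSum_inner_mul_inner w (A w))
  refine h.congr_fun fun i => ?_
  have h1 : ⟪w, b i⟫_ℂ * ⟪b i, A w⟫_ℂ = ((μ i * ‖⟪b i, w⟫_ℂ‖ ^ 2 : ℝ) : ℂ) := by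
    rw [inner_eigenbasis_apply hA hb, ← inner_conj_symm, mul_left_comm, Complex.conj_mul']
    push_cast
    rfl
  simp only [Complex.reCLM_apply, h1, Complex.ofReal_re]

/-- If `W` has smaller dimension than the span of `b i`, `i ∈ J`, then a linear map into `W`
annihilates a nonzero vector of this span. -/
theorem exists_ne_zero_of_finrank_lt {W : Type*} [AddCommGroup W] [Module ℂ W]
    [FiniteDimensional ℂ W] (b : HilbertBasis ι ℂ E) (J : Finset ι) (L : E →ₗ[ℂ] W)
    (h : Module.finrank ℂ W < J.card) :
    ∃ w : E, w ≠ 0 ∧ (∀ i ∉ J, ⟪b i, w⟫_ℂ = 0) ∧ L w = 0 := by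
  have ho : Orthonormal ℂ fun j : J => b j := b.orthonormal.comp _ Subtype.val_injective
  have h1 : (L ∘ₗ Fintype.linearCombination ℂ fun j : J => b j).ker ≠ ⊥ :=
    LinearMap.ker_ne_bot_of_finrank_lt (by simpa using h)
  obtain ⟨a, ha, ha0⟩ := Submodule.exists_mem_ne_zero_of_ne_bot h1
  refine ⟨Fintype.linearCombination ℂ (fun j : J => b j) a, fun h0 => ha0 ?_, fun i hi => ?_, ha⟩
  · ext j
    have h2 := ho.inner_right_fintype a j
    rw [Fintype.linearCombination_apply] at h0
    rw [h0, inner_zero_right] at h2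
    exact h2.symm
  · rw [Fintype.linearCombination_apply, inner_sum]
    refine Finset.sum_eq_zero fun j _ => ?_
    rw [inner_smul_right, b.orthonormal.2 (fun hij : i = j => hi (hij ▸ j.2)), mul_zero]

/-- Let `N` and `Γ` be self-adjoint operators with eigenbases `c` and `b`, let `N < Γ` in the
sense of quadratic forms off the kernel of `N`, and let `‖Γ w‖ ≤ ‖N w‖` on the kernel of a linear
map `G` of finite rank. If all eigenvalues of `N` exceed `-a`, then the multiplicity of the
eigenvalue `a > 0` of `Γ` is at most the dimension of the range of `G`.

The form inequality shows that `N` has no more eigenvalues `≥ a` than `Γ` has eigenvalues `> a`.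
If `a` had too large a multiplicity, then some `w ≠ 0` in the spectral subspace of `Γ` for `[a, ∞)`
would be annihilated by `G` and orthogonal to the spectral subspace of `N` for `[a, ∞)`, so that
`‖Γ w‖ ≥ a ‖w‖ > ‖N w‖`. -/
theorem card_eigenvalue_le_finrank {V : Type*} [AddCommGroup V] [Module ℂ V]
    [FiniteDimensional ℂ V] {N Γ : E →L[ℂ] E} (hN : IsSelfAdjoint N) (hΓ : IsSelfAdjoint Γ)
    {b : HilbertBasis ι ℂ E} {μ : ι → ℝ} (hb : ∀ i, Γ (b i) = (μ i : ℂ) • b i)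
    {c : HilbertBasis κ ℂ E} {ν : κ → ℝ} (hc : ∀ k, N (c k) = (ν k : ℂ) • c k)
    (hlt : ∀ w, N w ≠ 0 → (⟪w, N w⟫_ℂ).re < (⟪w, Γ w⟫_ℂ).re)
    (G : E →ₗ[ℂ] V) (hG : ∀ w, G w = 0 → ‖Γ w‖ ≤ ‖N w‖)
    {a : ℝ} (ha : 0 < a) (hν : ∀ k, -a < ν k) (hfin : {i | a < μ i}.Finite)
    (s : Finset ι) (hs : ∀ i ∈ s, μ i = a) : s.card ≤ Module.finrank ℂ V := by
  classical
  set I := hfin.toFinset with hI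
  have hIm : ∀ i, i ∈ I ↔ a < μ i := fun i => by simp [hI]
  -- `N` has at most as many eigenvalues `≥ a` as `Γ` has eigenvalues `> a`.
  have hK : ∀ K : Finset κ, (∀ k ∈ K, a ≤ ν k) → K.card ≤ I.card := by
    intro K hK
    by_contra! hcard
    obtain ⟨w, hw0, hwc, hwL⟩ := exists_ne_zero_of_finrank_lt c K
      (LinearMap.pi fun i : I => (innerSL ℂ (b i)).toLinearMap) (by simpa using hcard)
    have hwb : ∀ i ∈ I, ⟪b i, w⟫_ℂ = 0 := fun i hi => congrFun hwL ⟨i, hi⟩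
    have h1 : a * ‖w‖ ^ 2 ≤ (⟪w, N w⟫_ℂ).re := by
      refine hasSum_le (fun k => ?_) ((hasSum_norm_inner_sq c w).mul_left a)
        (hasSum_re_inner_eigenbasis hN hc w)
      by_cases hk : k ∈ K
      · exact mul_le_mul_of_nonneg_right (hK k hk) (by positivity)
      · simp [hwc k hk]
    have h2 : (⟪w, Γ w⟫_ℂ).re ≤ a * ‖w‖ ^ 2 := by
      refine hasSum_le (fun i => ?_) (hasSum_re_inner_eigenbasis hΓ hb w)
        ((hasSum_norm_inner_sq b w).mul_left a)
      by_cases hi : i ∈ I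
      · simp [hwb i hi]
      · exact mul_le_mul_of_nonneg_right (not_lt.mp fun h => hi ((hIm i).mpr h)) (by positivity)
    have h3 : 0 < a * ‖w‖ ^ 2 := by positivity
    have h4 : N w ≠ 0 := by
      intro h0
      rw [h0, inner_zero_right, Complex.zero_re] at h1
      linarith
    linarith [hlt w h4]
  have hKfin : {k | a ≤ ν k}.Finite := by
    by_contra hinf
    obtain ⟨K, hK1, hK2⟩ := Set.Infinite.exists_subset_card_eq hinf (I.card + 1)
    have := hK K fun k hk => hK1 hk
    omega
  set K := hKfin.toFinset with hKdef
  have hKm : ∀ k, k ∈ K ↔ a ≤ ν k := fun k => by simp [hKdef]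
  have hKI := hK K fun k hk => (hKm k).mp hk
  by_contra! hcard
  have hdisj : Disjoint I s := Finset.disjoint_left.mpr fun i hi his =>
    ((hIm i).mp hi).ne' (hs i his)
  obtain ⟨w, hw0, hwb, hwL⟩ := exists_ne_zero_of_finrank_lt b (I ∪ s)
    ((LinearMap.pi fun k : K => (innerSL ℂ (c k)).toLinearMap).prod G) (by
      rw [Finset.card_union_of_disjoint hdisj]
      simp
      omega)
  have hwc : ∀ k ∈ K, ⟪c k, w⟫_ℂ = 0 := fun k hk => congrFun (congrArg Prod.fst hwL) ⟨k, hk⟩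
  have hle := hG w (congrArg Prod.snd hwL)
  have h1 : a ^ 2 * ‖w‖ ^ 2 ≤ ‖Γ w‖ ^ 2 := by
    refine hasSum_le (fun i => ?_) ((hasSum_norm_inner_sq b w).mul_left (a ^ 2))
      (hasSum_norm_sq_eigenbasis hΓ hb w)
    by_cases hi : i ∈ I ∪ s
    · have hai : a ≤ μ i := by
        rcases Finset.mem_union.mp hi with hi | hi
        · exact ((hIm i).mp hi).le
        · exact (hs i hi).ge
      gcongr
    · simp [hwb i hi]
  have hνsq : ∀ k ∉ K, ν k ^ 2 < a ^ 2 := fun k hk =>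
    sq_lt_sq' (hν k) (not_le.mp fun h => hk ((hKm k).mpr h))
  obtain ⟨k₀, hk₀⟩ : ∃ k, ⟪c k, w⟫_ℂ ≠ 0 := by
    by_contra! hall
    refine hw0 ?_
    have h5 := hasSum_norm_inner_sq c w
    simp only [hall, norm_zero, ne_eq, OfNat.ofNat_ne_zero, not_false_eq_true, zero_pow] at h5
    simpa using (hasSum_zero.unique h5).symm
  have h2 : ‖N w‖ ^ 2 < a ^ 2 * ‖w‖ ^ 2 := by
    refine hasSum_lt (i := k₀) (fun k => ?_) ?_ (hasSum_norm_sq_eigenbasis hN hc w)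
      ((hasSum_norm_inner_sq c w).mul_left (a ^ 2))
    · by_cases hk : k ∈ K
      · simp [hwc k hk]
      · exact mul_le_mul_of_nonneg_right (hνsq k hk).le (by positivity)
    · have hk : k₀ ∉ K := fun hk => hk₀ (hwc k₀ hk)
      exact mul_lt_mul_of_pos_right (hνsq k₀ hk) (by positivity)
  have h3 : ‖Γ w‖ ^ 2 ≤ ‖N w‖ ^ 2 := pow_le_pow_left₀ (norm_nonneg _) hle 2
  linarith

end Counting

namespace C0Semigroup

/-! ### The Lyapunov equation and the multiplicity of the eigenvalues -/

variable {H H₀ : Type*} [NormedAddCommGroup H] [InnerProductSpace ℂ H] [CompleteSpace H]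
  [NormedAddCommGroup H₀] [InnerProductSpace ℂ H₀] [CompleteSpace H₀]
  {S : C0Semigroup H} {M : ℝ} {C : S.A.domain →ₗ[ℂ] H₀}

theorem integrableOn_norm_sq_output (h : Admissible C) (ξ : S.A.domain) {x : ℝ} (hx : 0 ≤ x) :
    IntegrableOn (fun s => ‖output C ξ s‖ ^ 2) (Ioi x) :=
  IntegrableOn.mono_set ((h.choose_spec ξ).1.integrable_norm_pow two_ne_zero) (Ioi_subset_Ioi hx)

theorem output_onDomain (ξ : S.A.domain) {s t : ℝ} (hs : 0 ≤ s) (ht : 0 ≤ t) :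
    output C (S.onDomain t.toNNReal ξ) s = output C ξ (s + t) := by
  rw [output, output]
  congr 1
  refine Subtype.ext ?_
  rw [coe_onDomain, coe_onDomain, coe_onDomain, ← op_add_apply, Real.toNNReal_add hs ht]

theorem norm_sq_tailObs_op (hM : ∀ t, ‖S.op t‖ ≤ M) (h : Admissible C) {x : ℝ} (hx : 0 ≤ x)
    (ξ : S.A.domain) {t : ℝ} (ht : 0 ≤ t) :
    ‖tailObs h x (S.op t.toNNReal ξ)‖ ^ 2 =
      (∫ s in Ioi x, ‖output C ξ s‖ ^ 2) - ∫ s in x..x + t, ‖output C ξ s‖ ^ 2 := by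
  have h1 : ‖tailObs h x (S.op t.toNNReal ξ)‖ ^ 2 = ∫ s in Ioi x, ‖output C ξ (s + t)‖ ^ 2 := by
    rw [norm_sq_tailObs, Measure.restrict_restrict_of_subset (Ioi_subset_Ioi hx)]
    have h2 := coeFn_obsAdj hM h (S.onDomain t.toNNReal ξ)
    rw [coe_onDomain] at h2
    have h3 := ae_mono (Measure.restrict_mono_set volume (Ioi_subset_Ioi hx)) h2
    refine integral_congr_ae ?_
    filter_upwards [h3, ae_restrict_mem measurableSet_Ioi] with s hs (hxs : x < s)
    rw [hs, output_onDomain ξ (hx.trans hxs.le) ht]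
  rw [h1, setIntegral_Ioi_comp_add (fun s => ‖output C ξ s‖ ^ 2), eq_sub_iff_add_eq',
    intervalIntegral.integral_interval_add_Ioi (integrableOn_norm_sq_output h ξ hx)
      (integrableOn_norm_sq_output h ξ (by linarith))]

/-- The Lyapunov equation `⟨Q_x ξ, A ξ⟩ + ⟨Q_x A ξ, ξ⟩ = ‖C e^{-xA} ξ‖²`, obtained by
differentiating `‖P_{(x,∞)} Θ† e^{-tA} ξ‖² = ∫_{x+t}^∞ ‖C e^{-sA} ξ‖² ds` at `t = 0`. -/
theorem lyapunov (hM : ∀ t, ‖S.op t‖ ≤ M) (hC : GraphBounded C) (h : Admissible C) {x : ℝ}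
    (hx : 0 ≤ x) (ξ : S.A.domain) :
    2 * (⟪tailObs h x ξ, tailObs h x (S.A ξ)⟫_ℂ).re = ‖output C ξ x‖ ^ 2 := by
  have hcont : Continuous fun s => ‖output C ξ s‖ ^ 2 := (continuous_output hM hC ξ).norm.pow 2
  have hd1 : HasDerivWithinAt (fun t : ℝ => ⟪tailObs h x (S.op t.toNNReal ξ),
      tailObs h x (S.op t.toNNReal ξ)⟫_ℂ)
      (⟪tailObs h x (S.op (0 : ℝ).toNNReal ξ), tailObs h x (-S.op (0 : ℝ).toNNReal (S.A ξ))⟫_ℂ +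
        ⟪tailObs h x (-S.op (0 : ℝ).toNNReal (S.A ξ)), tailObs h x (S.op (0 : ℝ).toNNReal ξ)⟫_ℂ)
      (Ici 0) 0 := by
    have h1 := hasDerivWithinAt_op (genRel_A ξ) le_rfl
    have h2 := ((tailObs h x).restrictScalars ℝ).hasFDerivAt.comp_hasDerivWithinAt (0 : ℝ) h1
    exact h2.inner ℂ h2
  have hd2 : HasDerivWithinAt (fun t : ℝ => (((∫ s in Ioi x, ‖output C ξ s‖ ^ 2) -
      ∫ s in x..x + t, ‖output C ξ s‖ ^ 2 : ℝ) : ℂ)) (((-‖output C ξ x‖ ^ 2 : ℝ)) : ℂ)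
      (Ici 0) 0 := by
    have h1 := intervalIntegral.integral_hasDerivAt_right (hcont.intervalIntegrable x (x + 0))
      (hcont.stronglyMeasurableAtFilter _ _) hcont.continuousAt
    have h2 := (h1.comp_const_add x 0).const_sub (∫ s in Ioi x, ‖output C ξ s‖ ^ 2)
    rw [add_zero] at h2
    exact h2.ofReal_comp.hasDerivWithinAt
  have hd3 := hd2.congr (f₁ := fun t : ℝ => ⟪tailObs h x (S.op t.toNNReal ξ),
      tailObs h x (S.op t.toNNReal ξ)⟫_ℂ) (fun t ht => by
        rw [← norm_sq_tailObs_op hM h hx ξ ht, inner_self_eq_norm_sq_to_K]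
        norm_cast) (by
        rw [← norm_sq_tailObs_op hM h hx ξ le_rfl, inner_self_eq_norm_sq_to_K]
        norm_cast)
  have he := (uniqueDiffOn_Ici (0 : ℝ) 0 self_mem_Ici).eq_deriv _ hd1 hd3
  rw [Real.toNNReal_zero, op_zero_apply, op_zero_apply] at he
  have he2 := congrArg Complex.re he
  rw [map_neg, inner_neg_left, inner_neg_right, ← inner_conj_symm (tailObs h x (S.A ξ))] at he2
  simp only [Complex.add_re, Complex.neg_re, Complex.conj_re, Complex.ofReal_re] at he2
  linarith

theorem re_ofReal_pos {r : ℝ} (hr : 0 < r) : 0 < (r : ℂ).re := by simpa using hr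

/-- Under the Cayley transform `(A - r)(A + r)⁻¹ = 1 - 2r (r + A)⁻¹` the Lyapunov equation becomes
the Stein equation `Q - B† Q B = 2r (C (r + A)⁻¹)† C (r + A)⁻¹`. -/
theorem norm_sq_tailObs_cayley (hM : ∀ t, ‖S.op t‖ ≤ M) (hC : GraphBounded C)
    (h : Admissible C) {x : ℝ} (hx : 0 ≤ x) {r : ℝ} (hr : 0 < r) (η : H) :
    ‖tailObs h x η‖ ^ 2 - ‖tailObs h x (η - (2 * r : ℂ) • S.res r η)‖ ^ 2 =
      2 * r * ‖output C (resDom hM (re_ofReal_pos hr) η) x‖ ^ 2 := by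
  have h1 := lyapunov hM hC h hx (resDom hM (re_ofReal_pos hr) η)
  rw [A_resDom, coe_resDom] at h1
  set u := tailObs h x (S.res r η) with hu
  set v := tailObs h x (η - (r : ℂ) • S.res r η) with hv
  have e1 : tailObs h x η = v + (r : ℂ) • u := by
    rw [hu, hv, ← map_smul, ← map_add, sub_add_cancel]
  have e2 : tailObs h x (η - (2 * r : ℂ) • S.res r η) = v - (r : ℂ) • u := by
    rw [hu, hv, ← map_smul, ← map_sub]
    congr 1
    module
  rw [e1, e2, ← h1, norm_add_sq (𝕜 := ℂ), norm_sub_sq (𝕜 := ℂ), inner_smul_right,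
    ← inner_conj_symm v u]
  simp only [RCLike.re_to_complex, Complex.re_ofReal_mul, Complex.conj_re]
  ring

theorem re_inner_A_nonneg (hM : ∀ t, ‖S.op t‖ ≤ M) (hA : IsSelfAdjoint S.A) (ξ : S.A.domain) :
    0 ≤ (⟪(ξ : H), S.A ξ⟫_ℂ).re := by
  have h1 : Tendsto (fun t : ℝ => (⟪(ξ : H), (t : ℂ)⁻¹ • ((ξ : H) - S.op t.toNNReal ξ)⟫_ℂ).re)
      (𝓝[>] 0) (𝓝 (⟪(ξ : H), S.A ξ⟫_ℂ).re) :=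
    (Complex.continuous_re.tendsto _).comp (tendsto_const_nhds.inner (genRel_A ξ))
  refine ge_of_tendsto h1 ?_
  filter_upwards [self_mem_nhdsWithin] with t (ht : 0 < t)
  rw [inner_smul_right, ← Complex.ofReal_inv, Complex.re_ofReal_mul, inner_sub_right,
    Complex.sub_re]
  refine mul_nonneg (inv_nonneg.mpr ht.le) (sub_nonneg.mpr ?_)
  have h2 := (Complex.re_le_norm _).trans (norm_inner_le_norm (𝕜 := ℂ) (ξ : H)
    (S.op t.toNNReal ξ))
  have h3 := (S.op t.toNNReal).le_of_opNorm_le (norm_op_le_one hM hA _) (ξ : H)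
  have h4 : (⟪(ξ : H), (ξ : H)⟫_ℂ).re = ‖(ξ : H)‖ ^ 2 := inner_self_eq_norm_sq (𝕜 := ℂ) (ξ : H)
  rw [h4]
  nlinarith [norm_nonneg (ξ : H)]

theorem inner_res_symm (hM : ∀ t, ‖S.op t‖ ≤ M) (hA : IsSelfAdjoint S.A) {r : ℝ} (hr : 0 < r)
    (ξ η : H) : ⟪S.res r ξ, η⟫_ℂ = ⟪ξ, S.res r η⟫_ℂ := by
  have h1 := inner_A_symm hM hA (resDom hM (re_ofReal_pos hr) ξ) (resDom hM (re_ofReal_pos hr) η)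
  rw [A_resDom, A_resDom, coe_resDom, coe_resDom, inner_sub_left, inner_sub_right,
    inner_smul_left, inner_smul_right, Complex.conj_ofReal] at h1
  exact (sub_left_injective h1).symm

theorem isSelfAdjoint_resCLM (hM : ∀ t, ‖S.op t‖ ≤ M) (hA : IsSelfAdjoint S.A) {r : ℝ}
    (hr : 0 < r) : IsSelfAdjoint (resCLM hM (re_ofReal_pos hr)) :=
  ((ContinuousLinearMap.eq_adjoint_iff _ _).mpr fun ξ η => inner_res_symm hM hA hr ξ η).symm

/-- The resolvent `(r + A)⁻¹` is strictly positive. -/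
theorem re_inner_res_pos (hM : ∀ t, ‖S.op t‖ ≤ M) (hA : IsSelfAdjoint S.A) {r : ℝ} (hr : 0 < r)
    {η : H} (hη : η ≠ 0) : 0 < (⟪η, S.res r η⟫_ℂ).re := by
  have h1 := re_inner_A_nonneg hM hA (resDom hM (re_ofReal_pos hr) η)
  rw [A_resDom, coe_resDom, inner_sub_right, inner_smul_right, Complex.sub_re,
    Complex.re_ofReal_mul] at h1
  have h4 : (⟪S.res r η, S.res r η⟫_ℂ).re = ‖S.res r η‖ ^ 2 :=
    inner_self_eq_norm_sq (𝕜 := ℂ) (S.res r η)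
  have h5 : S.res r η ≠ 0 := by
    intro h0
    have h6 := A_resDom hM (re_ofReal_pos hr) η
    have h7 : resDom hM (re_ofReal_pos hr) η = 0 := Subtype.ext h0
    rw [h7, h0, smul_zero, sub_zero, LinearPMap.map_zero] at h6
    exact hη h6.symm
  rw [h4, inner_res_symm hM hA hr] at h1
  have h6 : 0 < r * ‖S.res r η‖ ^ 2 := by positivity
  linarith

/-- `P_{(x,∞)} Θ† e^{-tA} ξ` is a tail of a square integrable output, hence tends to `0`. -/
theorem tendsto_tailObs_op (hM : ∀ t, ‖S.op t‖ ≤ M) (h : Admissible C)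
    {x : ℝ} (hx : 0 ≤ x) (ξ : H) :
    Tendsto (fun t : ℝ => tailObs h x (S.op t.toNNReal ξ)) atTop (𝓝 0) := by
  have h1 : ∀ ξ : S.A.domain,
      Tendsto (fun t : ℝ => ‖tailObs h x (S.op t.toNNReal ξ)‖) atTop (𝓝 0) := by
    intro ξ
    have h2 : Tendsto (fun t : ℝ => (∫ s in Ioi x, ‖output C ξ s‖ ^ 2) -
        ∫ s in x..x + t, ‖output C ξ s‖ ^ 2) atTop (𝓝 0) := by
      have h3 := intervalIntegral_tendsto_integral_Ioi x (integrableOn_norm_sq_output h ξ hx)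
        (tendsto_atTop_add_const_left atTop x tendsto_id)
      have h4 := h3.const_sub (∫ s in Ioi x, ‖output C ξ s‖ ^ 2)
      rwa [sub_self] at h4
    have h3 : Tendsto (fun t : ℝ => ‖tailObs h x (S.op t.toNNReal ξ)‖ ^ 2) atTop (𝓝 0) := by
      refine h2.congr' ?_
      filter_upwards [eventually_ge_atTop 0] with t ht
      rw [norm_sq_tailObs_op hM h hx ξ ht]
    have h4 := (Real.continuous_sqrt.tendsto 0).comp h3
    simpa [Function.comp_def] using h4
  rw [tendsto_zero_iff_norm_tendsto_zero]
  have hM0 := bound_nonneg hM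
  refine Metric.tendsto_atTop'.mpr fun ε hε => ?_
  set L : ℝ := ‖tailObs h x‖ * M + 1 with hL
  have hLpos : 0 < L := by positivity
  obtain ⟨ξ', hξ', hd⟩ := Metric.dense_iff.mp (dense_domain hM) ξ (ε / (2 * L)) (by positivity)
  obtain ⟨t₀, ht₀⟩ := Metric.tendsto_atTop'.mp (h1 ⟨ξ', hd⟩) (ε / 2) (by positivity)
  refine ⟨t₀, fun t ht => ?_⟩
  have h2 := ht₀ t ht
  rw [dist_zero_right, norm_norm] at h2 ⊢
  have h3 : tailObs h x (S.op t.toNNReal ξ) = tailObs h x (S.op t.toNNReal ξ') -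
      tailObs h x (S.op t.toNNReal (ξ' - ξ)) := by
    rw [← map_sub, ← map_sub, sub_sub_cancel]
  have h4 : ‖ξ' - ξ‖ < ε / (2 * L) := by rwa [mem_ball_iff_norm] at hξ'
  have h5 : ‖tailObs h x (S.op t.toNNReal (ξ' - ξ))‖ ≤ L * ‖ξ' - ξ‖ := by
    refine ((tailObs h x).le_opNorm_of_le (norm_op_le hM _ _)).trans ?_
    rw [hL, add_mul, one_mul, mul_assoc]
    linarith [norm_nonneg (ξ' - ξ)]
  have h6 : L * ‖ξ' - ξ‖ < ε / 2 := by
    have := mul_lt_mul_of_pos_left h4 hLpos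
    have e : L * (ε / (2 * L)) = ε / 2 := by field_simp
    rwa [e] at this
  rw [h3]
  refine (norm_sub_le _ _).trans_lt ?_
  linarith

theorem norm_smul_res_le (hM : ∀ t, ‖S.op t‖ ≤ M) {r : ℝ} (hr : 0 < r) (ξ : H) :
    ‖(r : ℂ) • S.res r ξ‖ ≤ M * ‖ξ‖ := by
  have h1 := norm_res_le hM (re_ofReal_pos hr) ξ
  rw [Complex.ofReal_re] at h1
  rw [norm_smul, Complex.norm_real, Real.norm_of_nonneg hr.le]
  refine (mul_le_mul_of_nonneg_left h1 hr.le).trans (le_of_eq ?_)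
  field_simp

/-- `P_{(x,∞)} Θ† r (r + A)⁻¹ → 0` strongly as `r` decreases to `0`. -/
theorem tendsto_tailObs_smul_res (hM : ∀ t, ‖S.op t‖ ≤ M)
    (h : Admissible C) {x : ℝ} (hx : 0 ≤ x) (ξ : H) :
    Tendsto (fun r : ℝ => tailObs h x ((r : ℂ) • S.res r ξ)) (𝓝[>] 0) (𝓝 0) := by
  have hexp : IntegrableOn (fun u : ℝ => Real.exp (-u)) (Ioi 0) := by
    simpa using integrableOn_exp_mul_Ioi (a := -1) (by norm_num) 0
  have hcont : ∀ r : ℝ, Continuous fun u : ℝ => S.op (r⁻¹ * u).toNNReal ξ := fun r =>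
    (continuous_op_toNNReal hM ξ).comp (continuous_const_mul r⁻¹)
  have hbd : ∀ r u : ℝ, ‖Complex.exp (-(u : ℂ)) • S.op (r⁻¹ * u).toNNReal ξ‖ ≤
      Real.exp (-u) * (M * ‖ξ‖) := fun r u => by
    rw [norm_smul, Complex.norm_exp]
    exact mul_le_mul (le_of_eq (by simp)) (norm_op_le hM _ _) (norm_nonneg _) (Real.exp_nonneg _)
  have h1 : Tendsto (fun r : ℝ => ∫ u in Ioi (0 : ℝ), tailObs h x (Complex.exp (-(u : ℂ)) •
      S.op (r⁻¹ * u).toNNReal ξ)) (𝓝[>] 0) (𝓝 (∫ u in Ioi (0 : ℝ), (0 : L2 H₀))) := by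
    refine tendsto_integral_filter_of_dominated_convergence
      (fun u => ‖tailObs h x‖ * (Real.exp (-u) * (M * ‖ξ‖))) (.of_forall fun r => ?_)
      (.of_forall fun r => .of_forall fun u => (tailObs h x).le_opNorm_of_le (hbd r u))
      ((hexp.mul_const _).const_mul _) ?_
    · have := hcont r
      exact Continuous.aestronglyMeasurable (by fun_prop)
    · filter_upwards [ae_restrict_mem measurableSet_Ioi] with u (hu : 0 < u)
      have h2 : Tendsto (fun r : ℝ => r⁻¹ * u) (𝓝[>] 0) atTop :=
        tendsto_inv_nhdsGT_zero.atTop_mul_const hu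
      have h3 := ((tendsto_tailObs_op hM h hx ξ).comp h2).const_smul (Complex.exp (-(u : ℂ)))
      rw [smul_zero] at h3
      refine h3.congr fun r => ?_
      rw [map_smul]
      rfl
  rw [integral_zero] at h1
  refine h1.congr' ?_
  filter_upwards [self_mem_nhdsWithin] with r (hr : 0 < r)
  rw [smul_res_eq S hr]
  exact ContinuousLinearMap.integral_comp_comm _ (Integrable.mono' (hexp.mul_const _)
    (by have := hcont r; exact Continuous.aestronglyMeasurable (by fun_prop))
    (.of_forall fun u => hbd r u))

/-- As `T = P_{(x,∞)} Θ†` is Hilbert-Schmidt, the strong convergence `T r (r + A)⁻¹ → 0` implies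
that `T r (r + A)⁻¹ T† → 0` in norm. -/
theorem exists_norm_comp_res_lt (hM : ∀ t, ‖S.op t‖ ≤ M)
    (h : Admissible C) (hΘ : IsHilbertSchmidt (obs h)) {x : ℝ} (hx : 0 ≤ x) {ε : ℝ}
    (hε : 0 < ε) : ∃ (r : ℝ) (hr : 0 < r),
      ‖tailObs h x ∘L ((2 * r : ℂ) • resCLM hM (re_ofReal_pos hr)) ∘L (tailObs h x).adjoint‖
        < ε := by
  set T := tailObs h x with hTdef
  have hT : IsHilbertSchmidt T := isHilbertSchmidt_tailObs hΘ x
  have hM0 := bound_nonneg hM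
  have h1 : Tendsto (fun r : ℝ => ∑' i, ‖T ((r : ℂ) • S.res r (T.adjoint (onb (L2 H₀) i)))‖ ^ 2)
      (𝓝[>] 0) (𝓝 (∑' _ : OnbIndex (L2 H₀), (0 : ℝ))) := by
    refine tendsto_tsum_of_dominated_convergence
      (bound := fun i => (‖T‖ * M) ^ 2 * ‖T.adjoint (onb (L2 H₀) i)‖ ^ 2)
      ((hT.adjoint.summable _).mul_left _) (fun i => ?_) ?_
    · simpa using ((tendsto_tailObs_smul_res hM h hx (T.adjoint (onb (L2 H₀) i))).norm.pow 2)
    · filter_upwards [self_mem_nhdsWithin] with r (hr : 0 < r) i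
      rw [norm_pow, norm_norm, ← mul_pow]
      refine pow_le_pow_left₀ (norm_nonneg _) ?_ 2
      rw [mul_assoc]
      exact T.le_opNorm_of_le (norm_smul_res_le hM hr _)
  rw [tsum_zero] at h1
  have h2 : ∀ᶠ r : ℝ in 𝓝[>] (0 : ℝ),
      ∑' i, ‖T ((r : ℂ) • S.res r (T.adjoint (onb (L2 H₀) i)))‖ ^ 2 < (ε / 2) ^ 2 :=
    h1.eventually_lt_const (by positivity)
  obtain ⟨r, hr2, hr⟩ := (h2.and self_mem_nhdsWithin).exists
  have hr : 0 < r := hr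
  refine ⟨r, hr, ?_⟩
  set R : L2 H₀ →L[ℂ] L2 H₀ := T ∘L ((r : ℂ) • resCLM hM (re_ofReal_pos hr)) ∘L T.adjoint with hR
  have hRhs : IsHilbertSchmidt R := hT.comp_right
  have h3 : ‖R‖ ^ 2 < (ε / 2) ^ 2 := by
    refine (norm_sq_le_hsNormSq hRhs).trans_lt ?_
    rw [hsNormSq_toReal (onb (L2 H₀))]
    exact hr2
  have h4 : ‖R‖ < ε / 2 := lt_of_pow_lt_pow_left₀ 2 (by positivity) h3
  have h5 : T ∘L ((2 * r : ℂ) • resCLM hM (re_ofReal_pos hr)) ∘L T.adjoint = (2 : ℂ) • R := by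
    rw [hR, mul_smul, ContinuousLinearMap.smul_comp, ContinuousLinearMap.comp_smul]
  rw [h5, norm_smul]
  simp
  linarith

/-- If `H₀` is finite dimensional, the nonzero eigenvalues of `P_{(x,∞)} Θ†Θ P_{(x,∞)}` have
multiplicity at most the dimension of `H₀`. -/
theorem card_eigenvalue_truncated_le [FiniteDimensional ℂ H₀] (hM : ∀ t, ‖S.op t‖ ≤ M)
    (hA : IsSelfAdjoint S.A) (hC : GraphBounded C) (h : Admissible C)
    (hΘ : IsHilbertSchmidt (obs h)) {x : ℝ} (hx : 0 ≤ x) {ι : Type*}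
    {b : HilbertBasis ι ℂ (L2 H₀)} {μ : ι → ℝ}
    (hb : ∀ i, ((tailObs h x).adjoint.adjoint ∘L (tailObs h x).adjoint) (b i) = (μ i : ℂ) • b i)
    {a : ℝ} (ha : 0 < a) (s : Finset ι) (hs : ∀ i ∈ s, μ i = a) :
    s.card ≤ Module.finrank ℂ H₀ := by
  obtain ⟨r, hr, hrlt⟩ := exists_norm_comp_res_lt hM h hΘ hx ha
  have hT : IsHilbertSchmidt (tailObs h x) := isHilbertSchmidt_tailObs hΘ x
  have hsum := summable_eigenvalues hT.adjoint hb
  rw [ContinuousLinearMap.adjoint_adjoint] at hb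
  set T := tailObs h x with hTdef
  set J := resCLM hM (re_ofReal_pos hr) with hJ
  set B : H →L[ℂ] H := 1 - (2 * r : ℂ) • J with hB
  have hJsa : IsSelfAdjoint J := isSelfAdjoint_resCLM hM hA hr
  have hBsa : B.adjoint = B := by
    have h1 : IsSelfAdjoint ((2 * r : ℂ) • J) := by
      have : ((2 * r : ℂ)) • J = (2 * r : ℝ) • J := by
        rw [← Complex.coe_smul]; push_cast; rfl
      rw [this]
      exact IsSelfAdjoint.smul (IsSelfAdjoint.all _) hJsa
    exact ((IsSelfAdjoint.one _).sub h1 : IsSelfAdjoint B)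
  have hN : IsSelfAdjoint (T ∘L B ∘L T.adjoint) := by
    rw [IsSelfAdjoint, ContinuousLinearMap.star_eq_adjoint, ContinuousLinearMap.adjoint_comp,
      ContinuousLinearMap.adjoint_comp, ContinuousLinearMap.adjoint_adjoint, hBsa]
    rfl
  have hΓ : IsSelfAdjoint (T ∘L T.adjoint) := by
    rw [IsSelfAdjoint, ContinuousLinearMap.star_eq_adjoint, ContinuousLinearMap.adjoint_comp,
      ContinuousLinearMap.adjoint_adjoint]
  have hBapp : ∀ η, B η = η - (2 * r : ℂ) • S.res r η := fun η => rfl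
  have hNcomp : IsCompactOperator (T ∘L B ∘L T.adjoint) :=
    (IsHilbertSchmidt.comp_right (R := T) hT (T := B ∘L T.adjoint)).isCompactOperator
  obtain ⟨κ, c, ν, hc⟩ := exists_eigenbasis hNcomp hN
  have hdiff : ∀ w, (T ∘L B ∘L T.adjoint) w =
      (T ∘L T.adjoint) w - (T ∘L ((2 * r : ℂ) • J) ∘L T.adjoint) w := fun w => by
    simp [hB]
  -- The finite rank map is `C e^{-xA} (r + A)⁻¹ T†`.
  refine card_eigenvalue_le_finrank hN hΓ hb hc (fun w hw => ?_)
    (C ∘ₗ S.onDomain x.toNNReal ∘ₗ resDom hM (re_ofReal_pos hr) ∘ₗ (T.adjoint : L2 H₀ →ₗ[ℂ] H))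
    (fun w hw => ?_) ha (fun k => ?_) ?_ s hs
  · have h0 : T.adjoint w ≠ 0 := by
      intro h0
      simp [h0] at hw
    have h1 := re_inner_res_pos hM hA hr h0
    rw [hdiff, inner_sub_right, Complex.sub_re]
    have h2 : ⟪w, (T ∘L ((2 * r : ℂ) • J) ∘L T.adjoint) w⟫_ℂ =
        ((2 * r : ℝ) : ℂ) * ⟪T.adjoint w, S.res r (T.adjoint w)⟫_ℂ := by
      rw [ContinuousLinearMap.comp_apply, ← ContinuousLinearMap.adjoint_inner_left,
        ContinuousLinearMap.comp_apply, _root_.smul_apply, inner_smul_right]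
      push_cast
      rfl
    rw [h2, Complex.re_ofReal_mul]
    have : 0 < 2 * r * (⟪T.adjoint w, S.res r (T.adjoint w)⟫_ℂ).re := by positivity
    linarith
  · have h1 := norm_sq_tailObs_cayley hM hC h hx hr (T.adjoint w)
    have h2 : output C (resDom hM (re_ofReal_pos hr) (T.adjoint w)) x = 0 := hw
    rw [h2, norm_zero, zero_pow two_ne_zero, mul_zero, ← hBapp] at h1
    exact le_of_sq_le_sq (sub_nonpos.mp h1.le) (norm_nonneg _)
  · have h1 : ((ν k : ℝ) : ℂ) = ⟪c k, (T ∘L B ∘L T.adjoint) (c k)⟫_ℂ := by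
      rw [hc, inner_smul_right, inner_self_eq_norm_sq_to_K, c.orthonormal.1 k]
      simp
    have h2 : ν k = (⟪c k, (T ∘L B ∘L T.adjoint) (c k)⟫_ℂ).re := by rw [← h1, Complex.ofReal_re]
    have h3 : 0 ≤ (⟪c k, (T ∘L T.adjoint) (c k)⟫_ℂ).re := by
      rw [ContinuousLinearMap.comp_apply, ← ContinuousLinearMap.adjoint_inner_left]
      exact inner_self_nonneg (𝕜 := ℂ)
    have h4 := (Complex.re_le_norm _).trans (norm_inner_le_norm (𝕜 := ℂ) (c k)
      ((T ∘L ((2 * r : ℂ) • J) ∘L T.adjoint) (c k)))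
    have h5 := (T ∘L ((2 * r : ℂ) • J) ∘L T.adjoint).le_opNorm (c k)
    rw [c.orthonormal.1 k] at h4 h5
    rw [h2, hdiff, inner_sub_right, Complex.sub_re]
    linarith
  · have h1 := hsum.tendsto_cofinite_zero.eventually_lt_const ha
    refine (Filter.eventually_cofinite.mp h1).subset fun i hi => ?_
    exact not_lt.mpr (le_of_lt hi)

/-- `Q_x = T† T` and `P_{(x,∞)} Θ†Θ P_{(x,∞)} = T T†` have the same determinants; the latter operator
is written as `(T†)† T†` here. -/
theorem detOneAdd_gramian_comm {h : Admissible C} (hΘ : IsHilbertSchmidt (obs h)) (x : ℝ) (z : ℂ) :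
    detOneAdd (-(z • gramian h x)) =
      detOneAdd (-(z • ((tailObs h x).adjoint.adjoint ∘L (tailObs h x).adjoint))) := by
  rw [gramian_eq, ContinuousLinearMap.adjoint_adjoint]
  exact detOneAdd_comm (isHilbertSchmidt_tailObs hΘ x) z

universe u in
/-- The determinant of `I - z Q_x` as a product over the eigenvalues of
`P_{(x,∞)} Θ†Θ P_{(x,∞)}`. -/
theorem exists_detOneAdd_gramian_eq_tprod {H₀ : Type u} [NormedAddCommGroup H₀]
    [InnerProductSpace ℂ H₀] [CompleteSpace H₀] {C : S.A.domain →ₗ[ℂ] H₀} {h : Admissible C}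
    (hΘ : IsHilbertSchmidt (obs h)) (x : ℝ) :
    ∃ (ι : Type u) (b : HilbertBasis ι ℂ (L2 H₀)) (μ : ι → ℝ),
      (∀ i, ((tailObs h x).adjoint.adjoint ∘L (tailObs h x).adjoint) (b i) = (μ i : ℂ) • b i) ∧
      Summable μ ∧ (∀ i, 0 ≤ μ i) ∧
      (fun z : ℂ => detOneAdd (-(z • gramian h x))) = fun z : ℂ => ∏' i, (1 + -z * (μ i : ℂ)) := by
  have hT := (isHilbertSchmidt_tailObs hΘ x).adjoint
  obtain ⟨ι, b, μ, hb⟩ := exists_eigenbasis_adjoint_comp_self hT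
  refine ⟨ι, b, μ, hb, summable_eigenvalues hT hb, fun i => ?_, funext fun z => ?_⟩
  · rw [eigenvalue_eq_norm_sq hb]
    positivity
  · rw [detOneAdd_gramian_comm hΘ, detOneAdd_eq_tprod hT hb]

/-- The zeros of the determinant of `I - z Q_x` have order at most the dimension of `H₀`. -/
theorem analyticOrderAt_detOneAdd_gramian_le [FiniteDimensional ℂ H₀] (hM : ∀ t, ‖S.op t‖ ≤ M)
    (hA : IsSelfAdjoint S.A) (hC : GraphBounded C) (h : Admissible C)
    (hΘ : IsHilbertSchmidt (obs h)) {x : ℝ} (hx : 0 ≤ x) (z : ℂ) :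
    analyticOrderAt (fun w : ℂ => detOneAdd (-(w • gramian h x))) z ≤ Module.finrank ℂ H₀ := by
  obtain ⟨ι, b, μ, hb, hsum, hμ, hdet⟩ := exists_detOneAdd_gramian_eq_tprod hΘ x
  rw [hdet]
  refine analyticOrderAt_tprod_le hsum z _ fun s hs => ?_
  rcases s.eq_empty_or_nonempty with rfl | ⟨i₀, hi₀⟩
  · simp
  obtain ⟨a, ha, rfl⟩ := pos_of_one_add_neg_mul_eq_zero (hμ i₀) (hs i₀ hi₀)
  refine card_eigenvalue_truncated_le hM hA hC h hΘ hx hb (inv_pos.mpr ha) s fun i hi => ?_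
  have h1 : a * μ i = 1 := by
    have := hs i hi
    norm_cast at this
    linarith
  exact eq_inv_of_mul_eq_one_right h1

end C0Semigroup

end LinSys

end

theorem proposition2p2 {H H₀ : Type*}
    [NormedAddCommGroup H] [InnerProductSpace ℂ H] [CompleteSpace H]
    [TopologicalSpace.SeparableSpace H]
    [NormedAddCommGroup H₀] [InnerProductSpace ℂ H₀] [CompleteSpace H₀]
    [TopologicalSpace.SeparableSpace H₀]
    (S : LinSys.C0Semigroup H) (hS : ∃ M : ℝ, ∀ t, ‖S.op t‖ ≤ M)
    (C : S.A.domain →ₗ[ℂ] H₀) (hC : LinSys.C0Semigroup.GraphBounded C)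
    (h : LinSys.C0Semigroup.Admissible C) :
    let Θ := LinSys.C0Semigroup.obs h
    let Q := LinSys.C0Semigroup.gramian h
    let P := LinSys.proj (F := H₀)
    let φ := LinSys.C0Semigroup.phi C
    (LinSys.C0Semigroup.ResolventHilbertSchmidt C → LinSys.IsHilbertSchmidt Θ) ∧
    (LinSys.IsHilbertSchmidt Θ →
      (∀ x : ℝ, 0 ≤ x →
        LinSys.IsTraceClass (Q x) ∧
        LinSys.IsTraceClass (P x ∘L Θ.adjoint ∘L Θ ∘L P x) ∧
        (∀ z : ℂ, LinSys.detOneAdd (-(z • Q x)) =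
          LinSys.detOneAdd (-(z • (P x ∘L Θ.adjoint ∘L Θ ∘L P x)))) ∧
        Differentiable ℂ (fun z : ℂ => LinSys.detOneAdd (-(z • Q x))) ∧
        (∀ z : ℂ, LinSys.detOneAdd (-(z • Q x)) = 0 → ∃ r : ℝ, 0 < r ∧ z = r)) ∧
      (IsSelfAdjoint S.A →
        LinSys.IsHankelOperator φ (Θ.adjoint ∘L Θ) ∧
        (Θ.adjoint ∘L Θ).IsPositive ∧
        (∀ x : ℝ, 0 < x →
          LinSys.IsTraceClass (φ (2 * x)) ∧
          HasDerivAt (fun u : ℝ => LinSys.trace (Q u)) (-LinSys.trace (φ (2 * x))) x) ∧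
        (FiniteDimensional ℂ H₀ → ∀ x : ℝ, 0 ≤ x → ∀ z : ℂ,
          LinSys.detOneAdd (-(z • Q x)) = 0 →
          analyticOrderAt (fun w : ℂ => LinSys.detOneAdd (-(w • Q x))) z
            ≤ (Module.finrank ℂ H₀ : ℕ∞)))) := by
  obtain ⟨M, hM⟩ := hS
  intro Θ Q P φ
  refine ⟨fun hR => LinSys.C0Semigroup.isHilbertSchmidt_obs hM hC h hR, fun hΘ =>
    ⟨fun x _ => ?_, fun hA => ⟨LinSys.C0Semigroup.isHankelOperator_phi hM hA hC h hΘ,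
      ContinuousLinearMap.isPositive_adjoint_comp_self Θ, fun x hx => ⟨?_,
      LinSys.C0Semigroup.hasDerivAt_trace_gramian hM hA hC h hΘ hx⟩, fun _ x hx z _ =>
      LinSys.C0Semigroup.analyticOrderAt_detOneAdd_gramian_le hM hA hC h hΘ hx z⟩⟩⟩
  · have hT := LinSys.C0Semigroup.isHilbertSchmidt_tailObs hΘ x
    have hP : P x ∘L Θ.adjoint ∘L Θ ∘L P x =
        (LinSys.C0Semigroup.tailObs h x).adjoint.adjoint ∘L
          (LinSys.C0Semigroup.tailObs h x).adjoint := by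
      rw [ContinuousLinearMap.adjoint_adjoint]
      exact LinSys.C0Semigroup.truncated_eq h x
    obtain ⟨ι, b, μ, -, hsum, hμ, hdet⟩ :=
      LinSys.C0Semigroup.exists_detOneAdd_gramian_eq_tprod hΘ x
    refine ⟨?_, ?_, fun z => ?_, ?_, fun z hz => ?_⟩
    · change LinSys.IsTraceClass (LinSys.C0Semigroup.gramian h x)
      rw [LinSys.C0Semigroup.gramian_eq]
      exact hT.isTraceClass
    · rw [hP]
      exact hT.adjoint.isTraceClass
    · rw [hP]
      exact LinSys.C0Semigroup.detOneAdd_gramian_comm hΘ x z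
    · exact hdet ▸ LinSys.differentiable_tprod hsum
    · obtain ⟨i, hi⟩ := LinSys.exists_of_tprod_eq_zero hsum ((congrFun hdet z).symm.trans hz)
      exact LinSys.pos_of_one_add_neg_mul_eq_zero (hμ i) hi
  · change LinSys.IsTraceClass (LinSys.C0Semigroup.phi C (2 * x))
    rw [LinSys.C0Semigroup.phi_two_mul]
    exact (LinSys.C0Semigroup.isHilbertSchmidt_outputAt hM hA hC h hΘ hx).adjoint.isTraceClass
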